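/- Setting. Consider a pure state $|\Psi\rangle$ of a finite lattice $\bigotimes_v\mathbb C^{d_v}$, coarse-grained in polar fashion around a bulk point $p$: there are $n+2$ angular slices $x=0,\dots,n+1$, each divided into five radial layers $r=0,\dots,4$, successive layers being shifted by half a cell, so that cell $(x,r)$ borders $(x\pm1,r)$, $(x,r\pm1)$, $(x-1,r+1)$, $(x+1,r-1)$; one further cell is the rest of the system, bordering slices $0$ and $n+1$ and layer $4$. The cells with $r=0$ meet at $p$ and contain the corner region; the cells with $r\ge1$ are bulk supersites larger than the correlation length. For a region $X$ (a union of cells) let $\rho_X$ be the reduced density matrix, $S_X=-\mathrm{Tr}\,\rho_X\ln\rho_X$ and $K_X=-\ln\rho_X$ (zero on the kernel of $\rho_X$). A region is disk-like if it and its complement are nonempty and connected. A corner conformal ruler $\mathbb D=(A,A',B,C,C')$ consists of three consecutive sectors $A,B,C$ at $p$ (the slices $[i_0,i_1),[i_1,i_2),[i_2,i_3)$ with $1\le i_0<i_1<i_2<i_3\le n+1$, layers $0,1,2$) and two consecutive regions $A',C'$ of layer $3$, where $A'$ lies above the line between $A$ and $B$ and $C'$ above the line between $B$ and $C$; $A'$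 starts above $A$, $A'$ and $C'$ meet above $B$, and $C'$ ends above $C$. Put $$\Delta(\mathbb D)=S_{AA'B}+S_{CC'B}-S_{AA'}-S_{CC'},\qquad I(\mathbb D)=S_{AB}+S_{BC}-S_{ABC}-S_B,$$ let $\mathfrak c_{\rm tot}(\mathbb D)$ be the unique positive solution $c$ of $e^{-6\Delta/c}+e^{-6I/c}=1$ (and $0$ if there is none), and let $\eta(\mathbb D)=e^{-6\Delta(\mathbb D)/\mathfrak c_{\rm tot}(\mathbb D)}$. Axioms. (A0) $S_{BC}+S_C-S_B=0$ whenever $BC$ is a disk of bulk supersites and $B$ is an annulus around the disk $C$. (A1) $S_{BC}+S_{CD}-S_B-S_D=0$ whenever $BCD$ is a disk of bulk supersites, $C$ is a disk in its interior, and the annulus $BD$ around $C$ is cut radially into the disks $B$ and $D$. (Nonvanishing) $\mathfrak c_{\rm tot}(\mathbb D)\ne0$ for every ruler. (Stationarity) For every ruler $\mathbb D$, $\mathfrak c_{\rm tot}(\mathbb D)$ is stationary to first order in $\epsilon$ under every norm-preserving perturbation $|\Psi\rangle+\epsilon|\Psi'\rangle$ with $\langle\Psi|\Psi'\rangle=0$.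 (Genericity) For any two overlapping rulers $(A,X,B,C,Y)$ and $(B,Y,C,D,Z)$ the vectors $(K_{AXB}+K_{CYB}-K_{AX}-K_{CY})|\Psi\rangle$, $(K_{BYC}+K_{DZC}-K_{BY}-K_{DZ})|\Psi\rangle$ and $|\Psi\rangle$ are linearly independent. Intrinsic angles of such a state are positive numbers $\varphi_1,\dots,\varphi_n$ with $\sum_x\varphi_x<2\pi$ such that, writing $\varphi_{[i,j)}=\sum_{i\le x<j}\varphi_x$, for every ruler $$\eta(\mathbb D)=\eta_g(\varphi_a,\varphi_b,\varphi_c):=\frac{\sin(\varphi_a/2)\sin(\varphi_c/2)}{\sin((\varphi_a+\varphi_b)/2)\sin((\varphi_b+\varphi_c)/2)},$$ where $\varphi_a,\varphi_b,\varphi_c$ are the angles of the sectors $A,B,C$. A function $f$ is the sharp-corner contribution to the entanglement entropy if $S_X=(\text{boundary term})-\gamma+f(\varphi_{[i,j)})$ for every disk-like region $X$ made of the sector on the slices $[i,j)$, $1\le i<j\le n+1$, and possibly a run of consecutive cells of layer $3$ in the slices $1,\dots,n$. Here $\gamma$ is a constant, and the boundary term is a sum of contributions of the boundary segments of $X$ between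 adjacent cells and of the points, other than $p$, at which three cells meet and the boundary of $X$ turns around one of them. Theorem. Let $(|\Psi_j\rangle)_{j\in J}$ be a family of normalized states, each with a polar coarse-graining as above, that satisfy these axioms. 1. For each $j$, $\mathfrak c_{\rm tot}(\mathbb D)$ is a positive constant independent of the ruler $\mathbb D$. 2. For each $j$, intrinsic angles exist. 3. Let intrinsic angles be chosen for all $j$, and suppose that they become arbitrarily fine: for every $\delta>0$ there is a $j$ for which all the angles $\varphi_x$ and the remaining angle $2\pi-\sum_x\varphi_x$ are less than $\delta$. Let $f$ be continuous on $(0,2\pi)$ with $f(\pi)=0$, and let $f$ be the sharp-corner contribution for every $\Psi_j$. Then there is a constant $c_{\rm tot}>0$ such that $\mathfrak c_{\rm tot}(\mathbb D)=c_{\rm tot}$ and $\Delta(\mathbb D)=-\frac{c_{\rm tot}}6\ln\eta_g(\varphi_a,\varphi_b,\varphi_c)$ for all $j$ and all rulers, and $$f(\theta)=\frac{c_{\rm tot}}6\ln\sin\frac\theta2\qquad\text{for all }\theta\in(0,2\pi).$$ -/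

import Mathlib

noncomputable section

namespace CornerEntanglement

/-! ## Entanglement of a pure state on finitely many sites

Every site `v` carries the local Hilbert space `ℂ ^ (d v)`; a vector of the tensor product of all of
them is given by its components in the product basis. -/

section Quantum

/-- The many-body Hilbert space `⨂ v, ℂ ^ (d v)`. -/
abbrev Hilb {V : Type} [Fintype V] (d : V → ℕ) : Type :=
  EuclideanSpace ℂ (∀ v, Fin (d v))

/-- The basis configurations of a region `X`. -/
abbrev Conf {V : Type} (d : V → ℕ) (X : Finset V) : Type :=
  ∀ v : {v // v ∈ X}, Fin (d v)

/-- The basis configurations of the complement of `X`. -/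
abbrev CoConf {V : Type} (d : V → ℕ) (X : Finset V) : Type :=
  ∀ v : {v // v ∉ X}, Fin (d v)

/-- The configuration equal to `a` on `X` and to `b` off `X`. -/
def glue {V : Type} [DecidableEq V] {d : V → ℕ} (X : Finset V)
    (a : Conf d X) (b : CoConf d X) : ∀ v, Fin (d v) :=
  fun v => if h : v ∈ X then a ⟨v, h⟩ else b ⟨v, h⟩

/-- The reduced density matrix `ρ_X = Tr_{Xᶜ} |ψ⟩⟨ψ|`. -/
def reducedDensity {V : Type} [Fintype V] [DecidableEq V] {d : V → ℕ} (ψ : Hilb d)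
    (X : Finset V) : Matrix (Conf d X) (Conf d X) ℂ :=
  fun a a' => ∑ b : CoConf d X, ψ (glue X a b) * star (ψ (glue X a' b))

theorem reducedDensity_isHermitian {V : Type} [Fintype V] [DecidableEq V] {d : V → ℕ}
    (ψ : Hilb d) (X : Finset V) : (reducedDensity ψ X).IsHermitian := by
  ext a a'
  simp [Matrix.conjTranspose_apply, reducedDensity, mul_comm]

/-- The von Neumann entropy `S_X = -Tr (ρ_X log ρ_X)`. -/
def entropy {V : Type} [Fintype V] [DecidableEq V] {d : V → ℕ} (ψ : Hilb d)
    (X : Finset V) : ℝ :=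
  ∑ a, Real.negMulLog ((reducedDensity_isHermitian ψ X).eigenvalues a)

/-- The entanglement Hamiltonian `K_X = -log ρ_X`, a matrix on the Hilbert space of `X`. Since
`Real.log 0 = 0`, it is `-log ρ_X` on the support of `ρ_X` and zero on the kernel. -/
def entHam {V : Type} [Fintype V] [DecidableEq V] {d : V → ℕ} (ψ : Hilb d)
    (X : Finset V) : Matrix (Conf d X) (Conf d X) ℂ :=
  (reducedDensity_isHermitian ψ X).cfc (fun x => -Real.log x)

/-- The vector `(K_X ⊗ 1) ψ`. -/
def entHamVec {V : Type} [Fintype V] [DecidableEq V] {d : V → ℕ} (ψ : Hilb d)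
    (X : Finset V) : Hilb d :=
  WithLp.toLp 2 fun s =>
    ∑ a : Conf d X, entHam ψ X (fun v => s v) a * ψ (glue X a fun v => s v)

end Quantum

/-! ## The polar coarse-graining around a corner point

The lattice is coarse-grained around a point `p` of the bulk. The `n + 2` angular slices `(x, 0)` meet
at `p`; they contain the corner region (linear size below the correlation length). The cells
`(x, r)` with `r ≥ 1` are bulk supersites, of linear size larger than the correlation length. The
cells of a layer are shifted by half a cell against those of the previous layer, so that away from
`p` at most three cells meet at a point. The cell `none` is the rest of the system. -/

section Geometry

/-- The cells: `some (x, r)` is slice `x` at radial layer `r`; `none` is everything else. -/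
abbrev Cell (n : ℕ) : Type := Option (Fin (n + 2) × Fin 5)

/-- Half of the adjacency relation: `(x, r)` borders `(x + 1, r)`, `(x, r + 1)` and
`(x - 1, r + 1)`; the rest of the system borders the first and last slice and the last layer. -/
def borders {n : ℕ} : Cell n → Cell n → Prop
  | some (x, r), some (y, q) =>
      (q.val = r.val ∧ y.val = x.val + 1) ∨
      (q.val = r.val + 1 ∧ (y.val = x.val ∨ y.val + 1 = x.val))
  | none, some (x, r) => x.val = 0 ∨ x.val = n + 1 ∨ r.val = 4
  | _, none => False

/-- Two cells are adjacent when they share a boundary segment. -/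
def cellGraph (n : ℕ) : SimpleGraph (Cell n) := SimpleGraph.fromRel borders

/-- A union of cells is disk-like when it and its complement (on the sphere obtained by collapsing
the boundary of the system) are both nonempty and connected. -/
def DiskLike {n : ℕ} (X : Finset (Cell n)) : Prop :=
  ((cellGraph n).induce (X : Set (Cell n))).Connected ∧
    ((cellGraph n).induce (X : Set (Cell n))ᶜ).Connected

/-- `X` consists of bulk supersites. -/
def InBulk {n : ℕ} (X : Finset (Cell n)) : Prop :=
  ∀ c ∈ X, ∃ x : Fin (n + 2), ∃ r : Fin 5, c = some (x, r) ∧ 1 ≤ r.val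

/-- `C` does not border the complement of `Y`. -/
def Surrounded {n : ℕ} (C Y : Finset (Cell n)) : Prop :=
  ∀ c ∈ C, ∀ e, e ∉ Y → ¬ (cellGraph n).Adj c e

/-- A disk `B ∪ C` of bulk supersites, `B` being an annulus around the disk `C`. -/
structure A0Partition {n : ℕ} (B C : Finset (Cell n)) : Prop where
  bulk : InBulk (B ∪ C)
  disjoint : Disjoint B C
  center : DiskLike C
  whole : DiskLike (B ∪ C)
  surrounded : Surrounded C (B ∪ C)

/-- A disk `B ∪ C ∪ D` of bulk supersites with a central disk `C` whose surrounding annulus is cut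
radially into the two disks `B` and `D`. -/
structure A1Partition {n : ℕ} (B C D : Finset (Cell n)) : Prop where
  bulk : InBulk (B ∪ C ∪ D)
  disjoint_BC : Disjoint B C
  disjoint_CD : Disjoint C D
  disjoint_BD : Disjoint B D
  center : DiskLike C
  left : DiskLike B
  right : DiskLike D
  left_center : DiskLike (B ∪ C)
  center_right : DiskLike (C ∪ D)
  whole : DiskLike (B ∪ C ∪ D)
  surrounded : Surrounded C (B ∪ C ∪ D)

/-- The pie-shaped sector made of the slices `i ≤ x < j`, out to layer `2`. -/
def sector (n i j : ℕ) : Finset (Cell n) :=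
  Finset.univ.filter fun c =>
    ∃ x : Fin (n + 2), ∃ r : Fin 5, c = some (x, r) ∧ i ≤ x.val ∧ x.val < j ∧ r.val ≤ 2

/-- The cells `s ≤ x < t` of layer `3`. The cell `(x, 3)` lies on top of the boundary line between
the slices `x` and `x + 1`. -/
def blocks (n s t : ℕ) : Finset (Cell n) :=
  Finset.univ.filter fun c =>
    ∃ x : Fin (n + 2), ∃ r : Fin 5, c = some (x, r) ∧ s ≤ x.val ∧ x.val < t ∧ r.val = 3

/-- A corner conformal ruler `𝔻 = (A, A', B, C, C')` at `p`: three consecutive sectors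
`A = [i₀, i₁)`, `B = [i₁, i₂)`, `C = [i₂, i₃)`, and two consecutive outer regions, `A' = [s, m)` and
`C' = [m, t)`. `A'` reaches from above `A` to above `B` across the line between `A` and `B`, and `C'`
from there to above `C` across the line between `B` and `C`. Slices `0` and `n + 1` are not used. -/
structure Ruler (n : ℕ) where
  i₀ : ℕ
  i₁ : ℕ
  i₂ : ℕ
  i₃ : ℕ
  s : ℕ
  m : ℕ
  t : ℕ
  one_le_i₀ : 1 ≤ i₀
  i₀_le_s : i₀ ≤ s
  s_lt_i₁ : s < i₁
  i₁_le_m : i₁ ≤ m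
  m_lt_i₂ : m < i₂
  i₂_le_t : i₂ ≤ t
  t_lt_i₃ : t < i₃
  i₃_le : i₃ ≤ n + 1

namespace Ruler

def A {n : ℕ} (D : Ruler n) : Finset (Cell n) := sector n D.i₀ D.i₁
def B {n : ℕ} (D : Ruler n) : Finset (Cell n) := sector n D.i₁ D.i₂
def C {n : ℕ} (D : Ruler n) : Finset (Cell n) := sector n D.i₂ D.i₃
def A' {n : ℕ} (D : Ruler n) : Finset (Cell n) := blocks n D.s D.m
def C' {n : ℕ} (D : Ruler n) : Finset (Cell n) := blocks n D.m D.t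

/-- `D = (A, X, B, C, Y)` and `E = (B, Y, C, D, Z)` overlap as in the partition
`(A, B, C, D, X, Y, Z)`. -/
def Chained {n : ℕ} (D E : Ruler n) : Prop :=
  E.i₀ = D.i₁ ∧ E.i₁ = D.i₂ ∧ E.i₂ = D.i₃ ∧ E.s = D.m ∧ E.m = D.t

end Ruler

end Geometry

/-! ## States on a coarse-grained lattice -/

/-- A lattice of sites with local dimensions, each site lying in one cell of a polar
coarse-graining. -/
structure PolarLattice where
  n : ℕ
  Site : Type
  [fintypeSite : Fintype Site]
  [decEqSite : DecidableEq Site]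
  cell : Site → Cell n
  dim : Site → ℕ

attribute [instance] PolarLattice.fintypeSite PolarLattice.decEqSite

section States

/-- The Hilbert space of the lattice. -/
abbrev PolarLattice.H (W : PolarLattice) : Type := Hilb W.dim

/-- The sites contained in a union of cells. -/
def sites (W : PolarLattice) (X : Finset (Cell W.n)) : Finset W.Site :=
  Finset.univ.filter fun v => W.cell v ∈ X

/-- The entanglement entropy of a union of cells. -/
def S (W : PolarLattice) (ψ : W.H) (X : Finset (Cell W.n)) : ℝ :=
  entropy ψ (sites W X)

/-- `K_X ψ` for a union of cells `X`. -/
def K (W : PolarLattice) (ψ : W.H) (X : Finset (Cell W.n)) : W.H :=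
  entHamVec ψ (sites W X)

/-- Axiom A0. -/
def AxiomA0 (W : PolarLattice) (ψ : W.H) : Prop :=
  ∀ B C : Finset (Cell W.n), A0Partition B C → S W ψ (B ∪ C) + S W ψ C - S W ψ B = 0

/-- Axiom A1. -/
def AxiomA1 (W : PolarLattice) (ψ : W.H) : Prop :=
  ∀ B C D : Finset (Cell W.n), A1Partition B C D →
    S W ψ (B ∪ C) + S W ψ (C ∪ D) - S W ψ B - S W ψ D = 0

/-- `Δ(𝔻) = S_{AA'B} + S_{CC'B} - S_{AA'} - S_{CC'}`. -/
def Δ (W : PolarLattice) (ψ : W.H) (D : Ruler W.n) : ℝ :=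
  S W ψ (D.A ∪ D.A' ∪ D.B) + S W ψ (D.C ∪ D.C' ∪ D.B) - S W ψ (D.A ∪ D.A') - S W ψ (D.C ∪ D.C')

/-- `I(𝔻) = S_{AB} + S_{BC} - S_{ABC} - S_B`. -/
def I (W : PolarLattice) (ψ : W.H) (D : Ruler W.n) : ℝ :=
  S W ψ (D.A ∪ D.B) + S W ψ (D.B ∪ D.C) - S W ψ (D.A ∪ D.B ∪ D.C) - S W ψ D.B

/-- The vector `Δ̂(𝔻) ψ` with `Δ̂ = K_{AA'B} + K_{CC'B} - K_{AA'} - K_{CC'}`. -/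
def ΔVec (W : PolarLattice) (ψ : W.H) (D : Ruler W.n) : W.H :=
  K W ψ (D.A ∪ D.A' ∪ D.B) + K W ψ (D.C ∪ D.C' ∪ D.B) - K W ψ (D.A ∪ D.A') - K W ψ (D.C ∪ D.C')

open Classical in
/-- The (unique) positive solution `c` of `e ^ (-6 Δ / c) + e ^ (-6 I / c) = 1`, and `0` if there is
none (a positive solution exists exactly when `Δ` and `I` are both positive). -/
def solveC (δ ι : ℝ) : ℝ :=
  if h : ∃ c : ℝ, 0 < c ∧ Real.exp (-6 * δ / c) + Real.exp (-6 * ι / c) = 1 then h.choose else 0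

/-- `𝔠_tot(𝔻)` in the state `ψ`. -/
def ctot (W : PolarLattice) (ψ : W.H) (D : Ruler W.n) : ℝ := solveC (Δ W ψ D) (I W ψ D)

/-- `η(𝔻) = e ^ (-6 Δ(𝔻) / 𝔠_tot(𝔻))`. -/
def η (W : PolarLattice) (ψ : W.H) (D : Ruler W.n) : ℝ :=
  Real.exp (-6 * Δ W ψ D / ctot W ψ D)

/-- Stationarity: for every ruler, `𝔠_tot` has vanishing first-order variation under every
norm-preserving perturbation `ψ + ε ψ'` with `⟨ψ, ψ'⟩ = 0`. -/
def Stationary (W : PolarLattice) (ψ : W.H) : Prop :=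
  ∀ (D : Ruler W.n) (ψ' : W.H), inner ℂ ψ ψ' = 0 →
    HasDerivAt (fun ε : ℝ =>
      ctot W (((‖ψ + (ε : ℂ) • ψ'‖⁻¹ : ℝ) : ℂ) • (ψ + (ε : ℂ) • ψ')) D) 0 0

/-- Genericity: for every partition `(A, B, C, D, X, Y, Z)` made of two overlapping rulers,
`Δ̂(AX, B, CY) ψ`, `Δ̂(BY, C, DZ) ψ` and `ψ` are linearly independent. -/
def Generic (W : PolarLattice) (ψ : W.H) : Prop :=
  ∀ D E : Ruler W.n, D.Chained E → LinearIndependent ℂ ![ΔVec W ψ D, ΔVec W ψ E, ψ]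

end States

/-! ## Intrinsic angles and the corner contribution -/

section Angles

/-- The geometric cross-ratio of three consecutive angles. -/
def etaGeo (a b c : ℝ) : ℝ :=
  Real.sin (a / 2) * Real.sin (c / 2) / (Real.sin ((a + b) / 2) * Real.sin ((b + c) / 2))

/-- The angle of the corner made of the slices `i ≤ x < j`. -/
def angle (φ : ℕ → ℝ) (i j : ℕ) : ℝ := ∑ x ∈ Finset.Ico i j, φ x

/-- `φ` assigns intrinsic angles to the slices `1, …, n`: positive angles of total less than `2π`
whose geometric cross-ratios are the cross-ratios `η` computed from the state. -/
structure IntrinsicAngles (W : PolarLattice) (ψ : W.H) (φ : ℕ → ℝ) : Prop where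
  pos : ∀ x ∈ Finset.Ico 1 (W.n + 1), 0 < φ x
  total : angle φ 1 (W.n + 1) < 2 * Real.pi
  cross_ratio : ∀ D : Ruler W.n,
    η W ψ D = etaGeo (angle φ D.i₀ D.i₁) (angle φ D.i₁ D.i₂) (angle φ D.i₂ D.i₃)

open Classical in
/-- The part of the entropy of `X` that comes from its boundary away from `p`: each boundary segment
between a cell of `X` and a cell outside `X` contributes `α` (length times area-law coefficient), and
each point where three cells `u, v, w` meet and where the boundary of `X` turns around the cell `u`
contributes `κ u s(v, w)`. -/
def boundaryTerm {n : ℕ} (α : Sym2 (Cell n) → ℝ) (κ : Cell n → Sym2 (Cell n) → ℝ)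
    (X : Finset (Cell n)) : ℝ :=
  (∑ u ∈ X, ∑ v ∈ Xᶜ, if (cellGraph n).Adj u v then α s(u, v) else 0) +
  ∑ u : Cell n, ∑ e ∈ Finset.univ.filter (fun e : Sym2 (Cell n) => e ∈ (cellGraph n).edgeSet),
    if (∀ v ∈ e, (cellGraph n).Adj u v) ∧
        ((u ∈ X ∧ ∀ v ∈ e, v ∉ X) ∨ (u ∉ X ∧ ∀ v ∈ e, v ∈ X)) then κ u e else 0

/-- `f` is the contribution of a sharp corner to the entanglement entropy, as a function of the
intrinsic angle: every disk-like region `X` consisting of the sector `[i, j)` and possibly some outer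
cells, which has exactly one corner at `p`, of angle `φ_{[i, j)}`, satisfies
`S_X = (boundary term) - γ + f (φ_{[i, j)})`. -/
def CornerContribution (W : PolarLattice) (ψ : W.H) (φ : ℕ → ℝ) (f : ℝ → ℝ) : Prop :=
  ∃ (α : Sym2 (Cell W.n) → ℝ) (κ : Cell W.n → Sym2 (Cell W.n) → ℝ) (γ : ℝ),
    ∀ i j s t : ℕ, 1 ≤ i → i < j → j ≤ W.n + 1 → 1 ≤ s → t ≤ W.n + 1 →
      DiskLike (sector W.n i j ∪ blocks W.n s t) →
      S W ψ (sector W.n i j ∪ blocks W.n s t) =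
        boundaryTerm α κ (sector W.n i j ∪ blocks W.n s t) - γ + f (angle φ i j)

end Angles

end CornerEntanglement

end

/-! The proof replaces entropies by the vectors K_X ψ. Two facts make this possible. The entropy of
a region is real differentiable at every ψ, even where ρ_X has a kernel, with derivative 2 Re ⟨K_X ψ
- ψ, ·⟩ (`hasFDerivAt_entropy`); and strong subadditivity holds at every vector
(`entropy_strong_subadditivity`). Differentiating S_X = S_{Xᶜ} gives K_X ψ = K_{Xᶜ} ψ. A state that
saturates strong subadditivity minimizes the conditional mutual information, so the derivative
vanishes there, which is a linear identity between four vectors K_X ψ (`entHamVec_markov`).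

Axiom A1 then makes the change of K_U ψ under adding a cell away from p depend only on which
neighbors of that cell lie in U (`K_local`, `KDiff_eq_of_pattern`). Hence Δ̂ψ does not depend on A'
and C' (`dVec_eq`), and the five rulers built from four consecutive sectors obey linear relations
(`dStd_extend_right`, `dStd_extend_left`, `dStd_add`, and the telescoping ones for Î).

Stationarity says that η Δ̂ψ + (1 - η) Îψ is a multiple of ψ (`vector_fixed_point`). So Îψ = -r Δ̂ψ
modulo ψ, with r = η / (1 - η). Genericity allows the coefficients in the five linear relations to
be compared, and the result is exactly the set of relations between the cross-ratios of five points
on a line (`ratio_relations`). Taking expectation values in the same linear relations gives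
equations between 𝔠 log(1 + r) and 𝔠 log(1 + 1/r). Those equations would hold with a common 𝔠; the
differences of the constants solve a homogeneous linear system with nonzero determinant, so the five
constants agree (`eq_of_five_relations`). Moving rulers step by step gives the first claim. For the
second, the cross-ratio relations reconstruct points on the projective line, and the map x ↦ 2
arctan x carries them to a circle (`FivePointSystem.exists_angles`).

For the third claim, the boundary terms cancel in Δ (`boundaryTerm_add`). Hence Δ is the combination
f(a+b) + f(b+c) - f(a) - f(c), while Δ = -(𝔠/6) log η_g is the same combination for (𝔠/6) log
sin(θ/2). Fine angles come close to every triple (a, b, c), so by continuity the equation holds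
everywhere with one constant. At a = c it says that f - (𝔠/6) log sin(θ/2) is constant, and the
value at π fixes it. -/

noncomputable section

set_option linter.unusedSectionVars false

namespace CornerEntanglement

/-! ### Monotonicity of the relative entropy, by a variational formula -/

section RelativeEntropy

open Matrix

/-- `A = U diag(p) U†` with `U` unitary. -/
structure Diagonalizes {κ : Type*} [Fintype κ] [DecidableEq κ] (U : Matrix κ κ ℂ) (p : κ → ℝ)
    (A : Matrix κ κ ℂ) : Prop where
  left : Uᴴ * U = 1
  right : U * Uᴴ = 1
  eq : A = U * diagonal (fun i => (p i : ℂ)) * Uᴴ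

/-- The squared overlap of the `i`-th column of `U` with the `j`-th column of `V`. -/
def overlap {κ : Type*} [Fintype κ] (U V : Matrix κ κ ℂ) (i j : κ) : ℝ := ‖(Uᴴ * V) i j‖ ^ 2

variable {κ μ : Type*} [Fintype κ] [DecidableEq κ] [Fintype μ] [DecidableEq μ]

theorem overlap_nonneg (U V : Matrix κ κ ℂ) (i j : κ) : 0 ≤ overlap U V i j := by
  unfold overlap; positivity

theorem _root_.Matrix.IsHermitian.diagonalizes {A : Matrix κ κ ℂ} (hA : A.IsHermitian) :
    Diagonalizes (hA.eigenvectorUnitary : Matrix κ κ ℂ) hA.eigenvalues A where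
  left := Unitary.coe_star_mul_self hA.eigenvectorUnitary
  right := Unitary.coe_mul_star_self hA.eigenvectorUnitary
  eq := by
    conv_lhs => rw [hA.spectral_theorem, Unitary.conjStarAlgAut_apply]
    rfl

theorem Diagonalizes.trace_mul {U : Matrix κ κ ℂ} {p : κ → ℝ} {A : Matrix κ κ ℂ}
    (h : Diagonalizes U p A) (B : Matrix κ κ ℂ) :
    (A * B).trace = ∑ i, (p i : ℂ) * (Uᴴ * B * U) i i := by
  rw [h.eq, mul_assoc, mul_assoc, trace_mul_comm, mul_assoc, trace]
  simp [diagonal_mul]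

theorem Diagonalizes.trace_eq {U : Matrix κ κ ℂ} {p : κ → ℝ} {A : Matrix κ κ ℂ}
    (h : Diagonalizes U p A) : A.trace = ∑ i, (p i : ℂ) := by
  have := h.trace_mul 1
  simpa [h.left] using this

theorem sum_norm_sq_row {W : Matrix κ κ ℂ} (h : W * Wᴴ = 1) (i : κ) : ∑ j, ‖W i j‖ ^ 2 = 1 := by
  have := congrFun (congrFun h i) i
  simp only [mul_apply, conjTranspose_apply, one_apply_eq, RCLike.star_def, Complex.mul_conj'] at this
  exact_mod_cast this

theorem sum_norm_sq_col {W : Matrix κ κ ℂ} (h : Wᴴ * W = 1) (j : κ) : ∑ i, ‖W i j‖ ^ 2 = 1 := by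
  have := congrFun (congrFun h j) j
  simp only [mul_apply, conjTranspose_apply, one_apply_eq, RCLike.star_def, Complex.conj_mul'] at this
  exact_mod_cast this

theorem overlap_sum_right {U V : Matrix κ κ ℂ} (hU : Uᴴ * U = 1) (hV : V * Vᴴ = 1) (i : κ) :
    ∑ j, overlap U V i j = 1 := by
  refine sum_norm_sq_row ?_ i
  rw [conjTranspose_mul, conjTranspose_conjTranspose, mul_assoc, ← mul_assoc V, hV, one_mul, hU]

theorem overlap_sum_left {U V : Matrix κ κ ℂ} (hU : U * Uᴴ = 1) (hV : Vᴴ * V = 1) (j : κ) :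
    ∑ i, overlap U V i j = 1 := by
  refine sum_norm_sq_col ?_ j
  rw [conjTranspose_mul, conjTranspose_conjTranspose, mul_assoc, ← mul_assoc U, hU, one_mul, hV]

/-- The functional whose supremum over `X` is the resolvent form of the relative modular operator. -/
def resolventForm (ρ σ : Matrix κ κ ℂ) (t : ℝ) (X : Matrix κ κ ℂ) : ℝ :=
  (2 * (X * ρ).trace - (Xᴴ * σ * X).trace - t * (X * ρ * Xᴴ).trace).re

/-- In the eigenbases of ρ and σ the three traces decouple over the entries of `x`, so maximizing
over `X` becomes one scalar quadratic problem per pair of eigenvectors. -/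
theorem resolventForm_coord {U V ρ σ : Matrix κ κ ℂ} {p q : κ → ℝ} (hρ : Diagonalizes U p ρ)
    (hσ : Diagonalizes V q σ) (t : ℝ) (x : Matrix κ κ ℂ) :
    resolventForm ρ σ t (V * x * Uᴴ) =
      ∑ j, ∑ i, (2 * p i * (x j i * (Uᴴ * V) i j).re - (q j + t * p i) * ‖x j i‖ ^ 2) := by
  have h1 : (V * x * Uᴴ * ρ).trace = ∑ j, ∑ i, x j i * p i * (Uᴴ * V) i j := by
    have : V * x * Uᴴ * ρ = V * (x * diagonal (fun i => (p i : ℂ)) * Uᴴ) := by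
      rw [hρ.eq]
      simp only [mul_assoc]
      rw [← mul_assoc Uᴴ U, hρ.left, one_mul]
    rw [this, trace_mul_comm, mul_assoc, trace]
    simp [mul_apply (M := _ * diagonal _), mul_diagonal]
  have h2 : ((V * x * Uᴴ)ᴴ * σ * (V * x * Uᴴ)).trace = ∑ j, ∑ i, (q j : ℂ) * (‖x j i‖ ^ 2 : ℝ) := by
    have : (V * x * Uᴴ)ᴴ * σ * (V * x * Uᴴ) =
        U * (xᴴ * diagonal (fun i => (q i : ℂ)) * x * Uᴴ) := by
      rw [hσ.eq]
      simp only [mul_assoc, conjTranspose_mul, conjTranspose_conjTranspose]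
      rw [← mul_assoc Vᴴ V, hσ.left, one_mul, ← mul_assoc Vᴴ V, hσ.left, one_mul]
    rw [this, trace_mul_comm, mul_assoc, hρ.left, mul_one, trace, Finset.sum_comm]
    refine Finset.sum_congr rfl fun i _ => ?_
    rw [diag_apply, mul_apply]
    refine Finset.sum_congr rfl fun j _ => ?_
    rw [mul_diagonal, conjTranspose_apply, RCLike.star_def, mul_comm _ (q j : ℂ), mul_assoc,
      Complex.conj_mul']
    norm_cast
  have h3 : (V * x * Uᴴ * ρ * (V * x * Uᴴ)ᴴ).trace = ∑ j, ∑ i, (p i : ℂ) * (‖x j i‖ ^ 2 : ℝ) := by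
    have : V * x * Uᴴ * ρ * (V * x * Uᴴ)ᴴ =
        V * (x * diagonal (fun i => (p i : ℂ)) * xᴴ * Vᴴ) := by
      rw [hρ.eq]
      simp only [mul_assoc, conjTranspose_mul, conjTranspose_conjTranspose]
      rw [← mul_assoc Uᴴ U, hρ.left, one_mul, ← mul_assoc Uᴴ U, hρ.left, one_mul]
    rw [this, trace_mul_comm, mul_assoc, hσ.left, mul_one, trace]
    refine Finset.sum_congr rfl fun j _ => ?_
    rw [diag_apply, mul_apply]
    refine Finset.sum_congr rfl fun i _ => ?_
    rw [mul_diagonal, conjTranspose_apply, RCLike.star_def, mul_comm _ (p i : ℂ), mul_assoc,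
      Complex.mul_conj']
    norm_cast
  rw [resolventForm, h1, h2, h3]
  simp only [Finset.mul_sum, ← Finset.sum_sub_distrib, Complex.re_sum]
  refine Finset.sum_congr rfl fun j _ => Finset.sum_congr rfl fun i _ => ?_
  have : x j i * p i * (Uᴴ * V) i j = (p i : ℂ) * (x j i * (Uᴴ * V) i j) := by ring
  rw [this]
  simp only [Complex.sub_re, ← Complex.ofReal_mul, Complex.ofReal_re]
  rw [show (2 : ℂ) = ((2 : ℝ) : ℂ) by norm_num, Complex.re_ofReal_mul, Complex.re_ofReal_mul]
  ring

/-- Completing the square; equality holds at x = (p / s) times the conjugate of w, the witness used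
in `exists_resolventForm_eq`. -/
theorem two_mul_re_sub_le (p s : ℝ) (hs : 0 < s) (x w : ℂ) :
    2 * p * (x * w).re - s * ‖x‖ ^ 2 ≤ ‖w‖ ^ 2 * (p ^ 2 / s) := by
  rw [← mul_div_assoc, le_div_iff₀ hs]
  have h1 : (x * w).re = x.re * w.re - x.im * w.im := Complex.mul_re x w
  rw [h1, Complex.sq_norm, Complex.sq_norm, Complex.normSq_apply, Complex.normSq_apply]
  nlinarith [sq_nonneg (s * x.re - p * w.re), sq_nonneg (s * x.im + p * w.im)]

theorem resolventForm_le {U V ρ σ : Matrix κ κ ℂ} {p q : κ → ℝ} (hρ : Diagonalizes U p ρ)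
    (hσ : Diagonalizes V q σ) (hp : ∀ i, 0 ≤ p i) (hq : ∀ j, 0 < q j) {t : ℝ} (ht : 0 ≤ t)
    (X : Matrix κ κ ℂ) :
    resolventForm ρ σ t X ≤ ∑ j, ∑ i, overlap U V i j * (p i ^ 2 / (q j + t * p i)) := by
  have : X = V * (Vᴴ * X * U) * Uᴴ := by
    simp only [mul_assoc]
    rw [hρ.right, mul_one, ← mul_assoc, hσ.right, one_mul]
  rw [this, resolventForm_coord hρ hσ]
  refine Finset.sum_le_sum fun j _ => Finset.sum_le_sum fun i _ => ?_
  exact two_mul_re_sub_le _ _ (add_pos_of_pos_of_nonneg (hq j) (mul_nonneg ht (hp i))) _ _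

theorem exists_resolventForm_eq {U V ρ σ : Matrix κ κ ℂ} {p q : κ → ℝ} (hρ : Diagonalizes U p ρ)
    (hσ : Diagonalizes V q σ) (hp : ∀ i, 0 ≤ p i) (hq : ∀ j, 0 < q j) {t : ℝ} (ht : 0 ≤ t) :
    ∃ X, resolventForm ρ σ t X = ∑ j, ∑ i, overlap U V i j * (p i ^ 2 / (q j + t * p i)) := by
  refine ⟨V * (Matrix.of fun j i => ((p i / (q j + t * p i) : ℝ) : ℂ) * star ((Uᴴ * V) i j)) * Uᴴ, ?_⟩
  rw [resolventForm_coord hρ hσ]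
  refine Finset.sum_congr rfl fun j _ => Finset.sum_congr rfl fun i _ => ?_
  have hs : q j + t * p i ≠ 0 :=
    (add_pos_of_pos_of_nonneg (hq j) (mul_nonneg ht (hp i))).ne'
  rw [of_apply, overlap]
  generalize (Uᴴ * V) i j = w
  have h1 : (((p i / (q j + t * p i) : ℝ) : ℂ) * star w * w).re =
      p i / (q j + t * p i) * ‖w‖ ^ 2 := by
    rw [mul_assoc, RCLike.star_def, Complex.conj_mul', Complex.re_ofReal_mul]
    norm_cast
  rw [h1, norm_mul, Complex.norm_real, mul_pow, Real.norm_eq_abs, sq_abs, norm_star]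
  field_simp
  ring

/-- The relative entropy in terms of diagonalizations. -/
def relEnt (U V : Matrix κ κ ℂ) (p q : κ → ℝ) : ℝ :=
  ∑ j, ∑ i, overlap U V i j * (p i * (Real.log (p i) - Real.log (q j)))

/-- An approximation of the relative entropy. -/
def relEntAux (U V : Matrix κ κ ℂ) (p q : κ → ℝ) (t : ℝ) : ℝ :=
  ∑ j, ∑ i, overlap U V i j * (p i * (Real.log (q j + t * p i) - Real.log (q j)))

theorem hasDerivAt_relEntAux (U V : Matrix κ κ ℂ) {p q : κ → ℝ} (hp : ∀ i, 0 ≤ p i)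
    (hq : ∀ j, 0 < q j) {t : ℝ} (ht : 0 ≤ t) :
    HasDerivAt (relEntAux U V p q)
      (∑ j, ∑ i, overlap U V i j * (p i ^ 2 / (q j + t * p i))) t := by
  refine HasDerivAt.fun_sum fun j _ => HasDerivAt.fun_sum fun i _ => ?_
  have hs : q j + t * p i ≠ 0 :=
    (add_pos_of_pos_of_nonneg (hq j) (mul_nonneg ht (hp i))).ne'
  have h1 : HasDerivAt (fun t : ℝ => q j + t * p i) (p i) t := by
    simpa using ((hasDerivAt_id t).mul_const (p i)).const_add (q j)
  have h2 := (((h1.log hs).sub_const (Real.log (q j))).const_mul (p i)).const_mul (overlap U V i j)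
  exact h2.congr_deriv (by ring)

/-- Since log(q + t p) = log t + log(p + q / t), removing log t times the trace leaves the relative
entropy as t → ∞. The removed term depends only on Tr ρ, so it is the same on both sides of the
monotonicity inequality. -/
theorem tendsto_relEntAux (U V : Matrix κ κ ℂ) {p q : κ → ℝ} (hp : ∀ i, 0 ≤ p i)
    (hq : ∀ j, 0 < q j) :
    Filter.Tendsto (fun t : ℝ => relEntAux U V p q t -
      Real.log t * ∑ j, ∑ i, overlap U V i j * p i) Filter.atTop (nhds (relEnt U V p q)) := by
  unfold relEntAux relEnt
  simp_rw [Finset.mul_sum, ← Finset.sum_sub_distrib]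
  refine tendsto_finsetSum _ fun j _ => tendsto_finsetSum _ fun i _ => ?_
  rcases (hp i).eq_or_lt with h0 | h0
  · simp [← h0]
  have h1 : Filter.Tendsto (fun t : ℝ => Real.log (q j * t⁻¹ + p i)) Filter.atTop
      (nhds (Real.log (p i))) := by
    have : Filter.Tendsto (fun t : ℝ => q j * t⁻¹ + p i) Filter.atTop (nhds (q j * 0 + p i)) :=
      (tendsto_inv_atTop_zero.const_mul _).add_const _
    rw [mul_zero, zero_add] at this
    exact this.log h0.ne'
  refine Filter.Tendsto.congr' ?_ (((h1.sub_const (Real.log (q j))).const_mul (p i)).const_mul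
    (overlap U V i j))
  filter_upwards [Filter.eventually_gt_atTop 0] with t ht
  have : q j * t⁻¹ + p i = (q j + t * p i) / t := by field_simp
  rw [this, Real.log_div (add_pos (hq j) (mul_pos ht h0)).ne' ht.ne']
  ring

theorem sum_overlap_mul {U V ρ : Matrix κ κ ℂ} {p : κ → ℝ} (hρ : Diagonalizes U p ρ)
    (hV : V * Vᴴ = 1) : ∑ j, ∑ i, overlap U V i j * p i = ρ.trace.re := by
  rw [Finset.sum_comm, hρ.trace_eq, Complex.re_sum]
  refine Finset.sum_congr rfl fun i _ => ?_
  rw [← Finset.sum_mul, overlap_sum_right hρ.left hV, one_mul, Complex.ofReal_re]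

/-- Monotonicity of the relative entropy under restriction to a subalgebra. -/
theorem relEnt_le_of_restrict {U V ρ σ : Matrix κ κ ℂ} {p q : κ → ℝ} (hρ : Diagonalizes U p ρ)
    (hσ : Diagonalizes V q σ) (hp : ∀ i, 0 ≤ p i) (hq : ∀ j, 0 < q j)
    {U' V' ρ' σ' : Matrix μ μ ℂ} {p' q' : μ → ℝ} (hρ' : Diagonalizes U' p' ρ')
    (hσ' : Diagonalizes V' q' σ') (hp' : ∀ i, 0 ≤ p' i) (hq' : ∀ j, 0 < q' j)
    (ι : Matrix μ μ ℂ → Matrix κ κ ℂ) (hmul : ∀ Y Z, ι (Y * Z) = ι Y * ι Z)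
    (hstar : ∀ Y, ι Yᴴ = (ι Y)ᴴ) (hone : ι 1 = 1) (htρ : ∀ Y, (ι Y * ρ).trace = (Y * ρ').trace)
    (htσ : ∀ Y, (ι Y * σ).trace = (Y * σ').trace) :
    relEnt U' V' p' q' ≤ relEnt U V p q := by
  -- The optimizer `Y` of the small algebra is a competitor `ι Y` in the large one with the same
  -- value, because ι is a *-homomorphism and the traces agree.
  have key : ∀ t : ℝ, 0 ≤ t →
      ∑ j, ∑ i, overlap U' V' i j * (p' i ^ 2 / (q' j + t * p' i)) ≤
      ∑ j, ∑ i, overlap U V i j * (p i ^ 2 / (q j + t * p i)) := by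
    intro t ht
    obtain ⟨Y, hY⟩ := exists_resolventForm_eq hρ' hσ' hp' hq' ht
    rw [← hY]
    refine le_trans (le_of_eq ?_) (resolventForm_le hρ hσ hp hq ht (ι Y))
    unfold resolventForm
    congr 3
    · rw [htρ]
    · rw [trace_mul_comm, ← mul_assoc, trace_mul_comm (_ * σ), ← mul_assoc, ← htσ, hmul, hstar,
        mul_assoc, trace_mul_comm]
    · rw [trace_mul_comm, ← mul_assoc, ← htρ, hmul, hstar, mul_assoc, mul_assoc, trace_mul_comm (ι Y)ᴴ,
        mul_assoc]
  -- `relEntAux` vanishes at t = 0 and its derivative is the maximum of the resolvent form, so `key`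
  -- integrates.
  have mono : ∀ t : ℝ, 0 ≤ t → relEntAux U' V' p' q' t ≤ relEntAux U V p q t := by
    intro t ht
    have hd : ∀ s : ℝ, 0 ≤ s → HasDerivAt
        (fun s => relEntAux U V p q s - relEntAux U' V' p' q' s) _ s := fun s hs =>
      (hasDerivAt_relEntAux U V hp hq hs).sub (hasDerivAt_relEntAux U' V' hp' hq' hs)
    have hm : MonotoneOn (fun s => relEntAux U V p q s - relEntAux U' V' p' q' s) (Set.Ici 0) := by
      refine monotoneOn_of_deriv_nonneg (convex_Ici 0)
        (fun s hs => (hd s hs).continuousAt.continuousWithinAt)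
        (fun s hs => ?_) fun s hs => ?_
      · rw [interior_Ici] at hs
        exact (hd s (le_of_lt hs)).differentiableAt.differentiableWithinAt
      · rw [interior_Ici] at hs
        rw [(hd s (le_of_lt hs)).deriv]
        exact sub_nonneg.2 (key s (le_of_lt hs))
    have := hm (Set.mem_Ici.2 le_rfl) (Set.mem_Ici.2 ht) ht
    simpa [relEntAux] using this
  have htr : ρ.trace = ρ'.trace := by
    have := htρ 1
    rwa [hone, one_mul, one_mul] at this
  have h1 := tendsto_relEntAux U V hp hq
  have h2 := tendsto_relEntAux U' V' hp' hq'
  rw [sum_overlap_mul hρ hσ.right, htr] at h1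
  rw [sum_overlap_mul hρ' hσ'.right] at h2
  refine le_of_tendsto_of_tendsto h2 h1 ?_
  filter_upwards [Filter.eventually_ge_atTop 0] with t ht
  exact sub_le_sub_right (mono t ht) _

end RelativeEntropy

/-! ### Strong subadditivity for matrices -/

section VonNeumann

open Matrix Kronecker
open scoped ComplexOrder

variable {α β γ κ μ : Type*} [Fintype α] [DecidableEq α] [Fintype β] [DecidableEq β] [Fintype γ]
  [DecidableEq γ] [Fintype κ] [DecidableEq κ] [Fintype μ] [DecidableEq μ]

/-- The von Neumann entropy of a matrix, from the roots of its characteristic polynomial. -/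
def vnEntropy (A : Matrix κ κ ℂ) : ℝ :=
  (A.charpoly.roots.map fun z => Real.negMulLog z.re).sum

theorem Diagonalizes.vnEntropy_eq {U : Matrix κ κ ℂ} {p : κ → ℝ} {A : Matrix κ κ ℂ}
    (h : Diagonalizes U p A) : vnEntropy A = ∑ i, Real.negMulLog (p i) := by
  have hc : A.charpoly = ∏ i, (Polynomial.X - Polynomial.C (p i : ℂ)) := by
    rw [h.eq, charpoly_mul_comm, ← mul_assoc, h.left, one_mul, charpoly_diagonal]
  rw [vnEntropy, hc, Polynomial.roots_prod _ _
    (by simp [Finset.prod_ne_zero_iff, Polynomial.X_sub_C_ne_zero])]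
  simp

theorem vnEntropy_eq_sum_eigenvalues {A : Matrix κ κ ℂ} (hA : A.IsHermitian) :
    vnEntropy A = ∑ i, Real.negMulLog (hA.eigenvalues i) :=
  hA.diagonalizes.vnEntropy_eq

theorem vnEntropy_zero : vnEntropy (0 : Matrix κ κ ℂ) = 0 := by
  have : Diagonalizes (1 : Matrix κ κ ℂ) 0 0 := ⟨by simp, by simp, by simp⟩
  simp [this.vnEntropy_eq]

theorem vnEntropy_reindex (e : κ ≃ μ) (A : Matrix κ κ ℂ) :
    vnEntropy (reindex e e A) = vnEntropy A := by
  rw [vnEntropy, charpoly_reindex, vnEntropy]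

theorem vnEntropy_transpose (A : Matrix κ κ ℂ) : vnEntropy Aᵀ = vnEntropy A := by
  rw [vnEntropy, charpoly_transpose, vnEntropy]

/-- The two characteristic polynomials differ by a power of X, and the root 0 contributes nothing to
the entropy. This is what makes complementary regions equally entangled. -/
theorem vnEntropy_mul_comm (A : Matrix κ μ ℂ) (B : Matrix μ κ ℂ) :
    vnEntropy (A * B) = vnEntropy (B * A) := by
  have h := congrArg (fun P => (P.roots.map fun z : ℂ => Real.negMulLog z.re).sum)
    (charpoly_mul_comm' A B)
  have hz : ∀ (k : ℕ) (P : Polynomial ℂ), P ≠ 0 →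
      (((Polynomial.X ^ k * P).roots).map fun z : ℂ => Real.negMulLog z.re).sum =
        (P.roots.map fun z : ℂ => Real.negMulLog z.re).sum := by
    intro k P hP
    rw [Polynomial.roots_mul (mul_ne_zero (pow_ne_zero _ Polynomial.X_ne_zero) hP),
      Polynomial.roots_X_pow]
    simp [Multiset.map_nsmul, Multiset.sum_nsmul]
  rw [hz _ _ (charpoly_monic _).ne_zero, hz _ _ (charpoly_monic _).ne_zero] at h
  exact h

/-- The partial trace over the first factor. -/
def traceFst (R : Matrix (α × κ) (α × κ) ℂ) : Matrix κ κ ℂ := fun k l => ∑ a, R (a, k) (a, l)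

/-- The partial trace over the last factor. -/
def traceLast (R : Matrix (α × β × γ) (α × β × γ) ℂ) : Matrix (α × β) (α × β) ℂ :=
  fun x y => ∑ c, R (x.1, x.2, c) (y.1, y.2, c)

/-- The partial trace over the second factor. -/
def traceSnd (R : Matrix (κ × γ) (κ × γ) ℂ) : Matrix κ κ ℂ := fun k l => ∑ c, R (k, c) (l, c)

theorem traceFst_posSemidef {R : Matrix (α × κ) (α × κ) ℂ} (hR : R.PosSemidef) :
    (traceFst R).PosSemidef := by
  have : traceFst R = ∑ a, R.submatrix (fun k => (a, k)) (fun k => (a, k)) := by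
    ext k l
    simp [traceFst, Matrix.sum_apply]
  rw [this]
  exact posSemidef_sum _ fun a _ => hR.submatrix _

theorem traceLast_posSemidef {R : Matrix (α × β × γ) (α × β × γ) ℂ} (hR : R.PosSemidef) :
    (traceLast R).PosSemidef := by
  have : traceLast R = ∑ c, R.submatrix (fun x : α × β => (x.1, x.2, c))
      (fun x : α × β => (x.1, x.2, c)) := by
    ext k l
    simp [traceLast, Matrix.sum_apply]
  rw [this]
  exact posSemidef_sum _ fun a _ => hR.submatrix _

theorem Diagonalizes.one_kronecker {V : Matrix κ κ ℂ} {q : κ → ℝ} {τ : Matrix κ κ ℂ}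
    (h : Diagonalizes V q τ) :
    Diagonalizes ((1 : Matrix α α ℂ) ⊗ₖ V) (fun x => q x.2) ((1 : Matrix α α ℂ) ⊗ₖ τ) where
  left := by rw [conjTranspose_kronecker, ← mul_kronecker_mul, h.left]; simp
  right := by rw [conjTranspose_kronecker, ← mul_kronecker_mul, h.right]; simp
  eq := by
    have : diagonal (fun x : α × κ => (q x.2 : ℂ)) =
        (1 : Matrix α α ℂ) ⊗ₖ diagonal (fun i => (q i : ℂ)) := by
      rw [← diagonal_one, diagonal_kronecker_diagonal]
      simp
    rw [this, conjTranspose_kronecker, ← mul_kronecker_mul, ← mul_kronecker_mul, ← h.eq]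
    simp

theorem Diagonalizes.add_smul_one {V : Matrix κ κ ℂ} {q : κ → ℝ} {τ : Matrix κ κ ℂ}
    (h : Diagonalizes V q τ) (e : ℝ) :
    Diagonalizes V (fun i => q i + e) (τ + (e : ℂ) • 1) where
  left := h.left
  right := h.right
  eq := by
    have : diagonal (fun i => ((q i + e : ℝ) : ℂ)) =
        diagonal (fun i => (q i : ℂ)) + (e : ℂ) • 1 := by
      rw [← diagonal_one, ← diagonal_smul, diagonal_add]
      simp
    rw [this, mul_add, add_mul, ← h.eq, mul_smul_comm, mul_one, smul_mul_assoc, h.right]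

theorem Diagonalizes.sum_overlap_mul_left {U V ρ : Matrix κ κ ℂ} {p : κ → ℝ}
    (hρ : Diagonalizes U p ρ) (j : κ) :
    ∑ i, overlap U V i j * p i = ((Vᴴ * ρ * V) j j).re := by
  have : Vᴴ * ρ * V = (Uᴴ * V)ᴴ * diagonal (fun i => (p i : ℂ)) * (Uᴴ * V) := by
    rw [hρ.eq, conjTranspose_mul, conjTranspose_conjTranspose]
    simp only [mul_assoc]
  rw [this, mul_apply, Complex.re_sum]
  refine Finset.sum_congr rfl fun i _ => ?_
  rw [mul_diagonal, conjTranspose_apply, overlap]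
  generalize (Uᴴ * V) i j = w
  rw [mul_right_comm, RCLike.star_def, Complex.conj_mul']
  norm_cast

theorem relEnt_eq {U V ρ : Matrix κ κ ℂ} {p q : κ → ℝ} (hρ : Diagonalizes U p ρ)
    (hV : V * Vᴴ = 1) :
    relEnt U V p q = -vnEntropy ρ - ∑ j, Real.log (q j) * ((Vᴴ * ρ * V) j j).re := by
  have h1 : vnEntropy ρ = ∑ j, ∑ i, overlap U V i j * (- (p i * Real.log (p i))) := by
    rw [Finset.sum_comm, hρ.vnEntropy_eq]
    refine Finset.sum_congr rfl fun i _ => ?_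
    rw [← Finset.sum_mul, overlap_sum_right hρ.left hV, one_mul, Real.negMulLog]
    ring
  simp_rw [h1, ← hρ.sum_overlap_mul_left (V := V), Finset.mul_sum, ← Finset.sum_neg_distrib,
    ← Finset.sum_sub_distrib]
  unfold relEnt
  refine Finset.sum_congr rfl fun j _ => Finset.sum_congr rfl fun i _ => ?_
  ring

/-- The logarithm of 1 ⊗ τ tests ρ only through its marginal, so relative entropies against such
references are differences of entropies. The shift `e` keeps the reference invertible when the
marginal has a kernel. -/
theorem relEnt_one_kronecker {U ρ : Matrix (α × κ) (α × κ) ℂ} {p : α × κ → ℝ}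
    (hρ : Diagonalizes U p ρ) {V : Matrix κ κ ℂ} {q : κ → ℝ}
    (hV : Diagonalizes V q (traceFst ρ)) (e : ℝ) :
    relEnt U ((1 : Matrix α α ℂ) ⊗ₖ V) p (fun x => q x.2 + e) =
      -vnEntropy ρ - ∑ k, q k * Real.log (q k + e) := by
  rw [relEnt_eq hρ (hV.one_kronecker (α := α)).right]
  congr 1
  rw [Fintype.sum_prod_type_right]
  refine Finset.sum_congr rfl fun k _ => ?_
  refine (Finset.mul_sum Finset.univ (fun a => ((((1 : Matrix α α ℂ) ⊗ₖ V)ᴴ * ρ *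
    ((1 : Matrix α α ℂ) ⊗ₖ V)) (a, k) (a, k)).re) (Real.log (q k + e))).symm.trans ?_
  rw [mul_comm]
  congr 1
  have h1 : ∑ a, (((1 : Matrix α α ℂ) ⊗ₖ V)ᴴ * ρ * ((1 : Matrix α α ℂ) ⊗ₖ V)) (a, k) (a, k) =
      (Vᴴ * traceFst ρ * V) k k := by
    simp only [mul_apply, conjTranspose_kronecker, conjTranspose_one, kroneckerMap_apply,
      Fintype.sum_prod_type, one_apply, ite_mul, mul_ite, one_mul, mul_zero, zero_mul,
      Finset.sum_ite_eq, Finset.sum_ite_eq', Finset.mem_univ, if_true, traceFst, Finset.sum_mul,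
      Finset.mul_sum, Finset.sum_ite_irrel, Finset.sum_const_zero]
    rw [Finset.sum_comm]
    refine Finset.sum_congr rfl fun l _ => ?_
    rw [Finset.sum_comm]
  have h2 : Vᴴ * traceFst ρ * V = diagonal (fun i => (q i : ℂ)) := by
    conv_lhs => rw [hV.eq]
    simp only [mul_assoc]
    rw [hV.left, mul_one, ← mul_assoc, hV.left, one_mul]
  rw [← Complex.re_sum, h1, h2, diagonal_apply_eq, Complex.ofReal_re]

theorem tendsto_sum_mul_log_add {q : κ → ℝ} (m : ℝ) :
    Filter.Tendsto (fun e : ℝ => ∑ k, q k * Real.log (q k + e * m)) (nhdsWithin 0 (Set.Ioi 0))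
      (nhds (-∑ k, Real.negMulLog (q k))) := by
  rw [← Finset.sum_neg_distrib]
  refine tendsto_finsetSum _ fun k _ => ?_
  by_cases h0 : q k = 0
  · simp [h0]
  have h1 : ContinuousAt (fun e : ℝ => q k * Real.log (q k + e * m)) 0 := by
    refine continuousAt_const.mul (ContinuousAt.log ?_ (by simpa using h0))
    fun_prop
  have h2 := h1.tendsto
  simp only [zero_mul, add_zero] at h2
  refine (h2.mono_left nhdsWithin_le_nhds).trans (le_of_eq ?_)
  rw [Real.negMulLog]
  ring_nf

/-- Strong subadditivity of the von Neumann entropy. -/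
theorem vnEntropy_strong_subadditivity {R : Matrix (α × β × γ) (α × β × γ) ℂ}
    (hR : R.PosSemidef) :
    vnEntropy R + vnEntropy (traceFst (traceLast R)) ≤
      vnEntropy (traceLast R) + vnEntropy (traceFst R) := by
  -- The dimension of γ multiplies the shift of the second reference, so it has to be positive.
  rcases isEmpty_or_nonempty γ with hγ | hγ
  · have h1 : R = 0 := Subsingleton.elim _ _
    have h2 : traceLast R = 0 := by ext; simp [traceLast]
    have h3 : traceFst R = 0 := Subsingleton.elim _ _
    have h4 : traceFst (0 : Matrix (α × β) (α × β) ℂ) = 0 := by ext; simp [traceFst]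
    rw [h3, h2, h4, h1]
    simp [vnEntropy_zero]
  have hAB := traceLast_posSemidef hR
  have hBC := traceFst_posSemidef hR
  have hB := traceFst_posSemidef hAB
  have hm : (0 : ℝ) < Fintype.card γ := by exact_mod_cast Fintype.card_pos
  have dR := hR.1.diagonalizes
  have dAB := hAB.1.diagonalizes
  have dBC := hBC.1.diagonalizes
  have dB := hB.1.diagonalizes
  -- Tracing out γ multiplies the shift by its dimension: the two regularized references stay
  -- compatible if ρ_B is shifted by `e * card γ`.
  have hsnd : ∀ e : ℝ, traceSnd (traceFst R + (e : ℂ) • 1) =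
      traceFst (traceLast R) + ((e * Fintype.card γ : ℝ) : ℂ) • 1 := by
    intro e
    ext b b'
    simp only [traceSnd, traceFst, traceLast, Matrix.add_apply, Matrix.smul_apply,
      Finset.sum_add_distrib]
    rw [Finset.sum_comm]
    congr 1
    by_cases hb : b = b'
    · subst hb
      simp [Matrix.one_apply_eq, mul_comm]
    · simp [hb]
  let ι : Matrix (α × β) (α × β) ℂ → Matrix (α × β × γ) (α × β × γ) ℂ := fun Y =>
    (Y ⊗ₖ (1 : Matrix γ γ ℂ)).submatrix (Equiv.prodAssoc α β γ).symm (Equiv.prodAssoc α β γ).symm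
  have htr : ∀ (S : Matrix (α × β × γ) (α × β × γ) ℂ) Y,
      (ι Y * S).trace = (Y * traceLast S).trace := by
    intro S Y
    simp only [trace, diag_apply, mul_apply, ι, submatrix_apply, kroneckerMap_apply,
      Fintype.sum_prod_type, Equiv.prodAssoc_symm_apply, one_apply, mul_ite, mul_one, mul_zero,
      ite_mul, zero_mul, Finset.sum_ite_eq, Finset.mem_univ, if_true, traceLast, Finset.mul_sum]
    refine Finset.sum_congr rfl fun a _ => Finset.sum_congr rfl fun b _ => ?_
    rw [Finset.sum_comm]
    refine Finset.sum_congr rfl fun a' _ => ?_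
    rw [Finset.sum_comm]
  have key : ∀ e : ℝ, 0 < e →
      -vnEntropy (traceLast R) -
        ∑ k, hB.1.eigenvalues k * Real.log (hB.1.eigenvalues k + e * Fintype.card γ) ≤
      -vnEntropy R - ∑ k, hBC.1.eigenvalues k * Real.log (hBC.1.eigenvalues k + e * 1) := by
    intro e he
    rw [mul_one, ← relEnt_one_kronecker dR dBC, ← relEnt_one_kronecker dAB dB]
    refine relEnt_le_of_restrict dR ((dBC.add_smul_one e).one_kronecker (α := α))
      hR.eigenvalues_nonneg (fun j => add_pos_of_nonneg_of_pos (hBC.eigenvalues_nonneg _) he)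
      dAB ((dB.add_smul_one _).one_kronecker (α := α)) hAB.eigenvalues_nonneg
      (fun j => add_pos_of_nonneg_of_pos (hB.eigenvalues_nonneg _) (mul_pos he hm)) ι
      ?_ ?_ ?_ (htr R) ?_
    · intro Y Z
      simp only [ι]
      rw [submatrix_mul_equiv, ← mul_kronecker_mul, one_mul]
    · intro Y
      simp only [ι]
      rw [conjTranspose_submatrix, conjTranspose_kronecker, conjTranspose_one]
    · simp [ι]
    · intro Y
      rw [htr]
      congr 2
      rw [← hsnd]
      ext x y
      simp only [traceLast, traceSnd, kroneckerMap_apply, Finset.mul_sum]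
  have l1 := (tendsto_sum_mul_log_add (q := hB.1.eigenvalues) (Fintype.card γ)).const_sub
    (-vnEntropy (traceLast R))
  have l2 := (tendsto_sum_mul_log_add (q := hBC.1.eigenvalues) 1).const_sub (-vnEntropy R)
  have := le_of_tendsto_of_tendsto l1 l2 (by
    filter_upwards [self_mem_nhdsWithin] with e he using key e he)
  rw [vnEntropy_eq_sum_eigenvalues hB.1, vnEntropy_eq_sum_eigenvalues hBC.1]
  linarith

end VonNeumann

/-! ### Entropies of regions: purity and strong subadditivity -/

section RegionEntropy

open Matrix
open scoped ComplexOrder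

variable {V : Type} [Fintype V] [DecidableEq V] {d : V → ℕ}

/-- The amplitudes of `ψ` as a matrix from the complement of `X` to `X`. -/
def ampMatrix (ψ : Hilb d) (X : Finset V) : Matrix (Conf d X) (CoConf d X) ℂ :=
  Matrix.of fun a b => ψ (glue X a b)

theorem reducedDensity_eq (ψ : Hilb d) (X : Finset V) :
    reducedDensity ψ X = ampMatrix ψ X * (ampMatrix ψ X)ᴴ := by
  ext a a'
  simp [reducedDensity, ampMatrix, mul_apply]

theorem entropy_eq_vnEntropy (ψ : Hilb d) (X : Finset V) :
    entropy ψ X = vnEntropy (reducedDensity ψ X) :=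
  (vnEntropy_eq_sum_eigenvalues _).symm

/-- Lets the amplitudes be regrouped along any splitting of the sites; in this way the four
entropies of strong subadditivity become those of partial traces of one matrix N Nᴴ. -/
theorem entropy_eq_of_equiv {μ ν : Type*} [Fintype μ] [DecidableEq μ] [Fintype ν] (ψ : Hilb d)
    (X : Finset V) (e₁ : μ ≃ Conf d X) (e₂ : ν ≃ CoConf d X) (N : Matrix μ ν ℂ)
    (hN : ∀ m n, N m n = ψ (glue X (e₁ m) (e₂ n))) : entropy ψ X = vnEntropy (N * Nᴴ) := by
  rw [entropy_eq_vnEntropy, reducedDensity_eq, ← vnEntropy_reindex e₁.symm]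
  congr 1
  ext m m'
  simp only [reindex_apply, Equiv.symm_symm, submatrix_apply, mul_apply, conjTranspose_apply,
    ampMatrix, of_apply, hN]
  exact (Equiv.sum_comp e₂ fun b => ψ (glue X (e₁ m) b) * star (ψ (glue X (e₁ m') b))).symm

theorem mem_of_eq_union {X Y Z : Finset V} (hZ : Z = X ∪ Y) {v : V} : v ∈ Z ↔ v ∈ X ∨ v ∈ Y := by
  rw [hZ, Finset.mem_union]

/-- Configurations of a disjoint union are pairs of configurations. -/
def unionEquiv {X Y Z : Finset V} (hZ : Z = X ∪ Y) (hd : Disjoint X Y) :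
    Conf d X × Conf d Y ≃ Conf d Z where
  toFun p v := if h : v.1 ∈ X then p.1 ⟨v, h⟩ else
    p.2 ⟨v, ((mem_of_eq_union hZ).1 v.2).resolve_left h⟩
  invFun z := (fun v => z ⟨v, (mem_of_eq_union hZ).2 (Or.inl v.2)⟩,
    fun v => z ⟨v, (mem_of_eq_union hZ).2 (Or.inr v.2)⟩)
  left_inv p := by
    refine Prod.ext ?_ ?_
    · funext v
      simp [v.2]
    · funext v
      have : v.1 ∉ X := fun h => (Finset.disjoint_left.1 hd) h v.2
      simp [this]
  right_inv z := by
    funext v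
    by_cases h : v.1 ∈ X <;> simp [h]

/-- Configurations of the complement of `X` are pairs of a configuration of a region disjoint from
`X` and a configuration of what remains. -/
def complEquiv {X Y Z : Finset V} (hZ : Z = X ∪ Y) (hd : Disjoint X Y) :
    Conf d Y × CoConf d Z ≃ CoConf d X where
  toFun p v := if h : v.1 ∈ Y then p.1 ⟨v, h⟩ else
    p.2 ⟨v, fun hz => ((mem_of_eq_union hZ).1 hz).elim v.2 h⟩
  invFun z := (fun v => z ⟨v, fun h => (Finset.disjoint_left.1 hd) h v.2⟩,
    fun v => z ⟨v, fun h => v.2 ((mem_of_eq_union hZ).2 (Or.inl h))⟩)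
  left_inv p := by
    refine Prod.ext ?_ ?_
    · funext v
      simp [v.2]
    · funext v
      have : v.1 ∉ Y := fun h => v.2 ((mem_of_eq_union hZ).2 (Or.inr h))
      simp [this]
  right_inv z := by
    funext v
    by_cases h : v.1 ∈ Y <;> simp [h]

theorem glue_complEquiv {X Y Z : Finset V} (hZ : Z = X ∪ Y) (hd : Disjoint X Y) (x : Conf d X)
    (y : Conf d Y) (z : CoConf d Z) :
    glue X x (complEquiv hZ hd (y, z)) = glue Z (unionEquiv hZ hd (x, y)) z := by
  subst hZ
  funext v
  by_cases hX : v ∈ X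
  · simp [glue, hX, unionEquiv]
  · by_cases hY : v ∈ Y <;> simp [glue, hX, hY, unionEquiv, complEquiv]

theorem unionEquiv_comm {X Y Z : Finset V} (hZ : Z = X ∪ Y) (hZ' : Z = Y ∪ X) (hd : Disjoint X Y)
    (hd' : Disjoint Y X) (x : Conf d X) (y : Conf d Y) :
    unionEquiv hZ hd (x, y) = unionEquiv hZ' hd' (y, x) := by
  funext v
  by_cases hX : v.1 ∈ X
  · have : v.1 ∉ Y := fun h => (Finset.disjoint_left.1 hd) hX h
    simp [unionEquiv, hX, this]
  · have : v.1 ∈ Y := ((mem_of_eq_union hZ).1 v.2).resolve_left hX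
    simp [unionEquiv, hX, this]

theorem unionEquiv_assoc {X Y W P Q Z : Finset V} (hP : P = X ∪ Y) (hPd : Disjoint X Y)
    (hQ : Q = Y ∪ W) (hQd : Disjoint Y W) (hZ : Z = P ∪ W) (hZd : Disjoint P W)
    (hZ' : Z = X ∪ Q) (hZd' : Disjoint X Q) (x : Conf d X) (y : Conf d Y) (w : Conf d W) :
    unionEquiv hZ hZd (unionEquiv hP hPd (x, y), w) =
      unionEquiv hZ' hZd' (x, unionEquiv hQ hQd (y, w)) := by
  subst hP
  funext v
  by_cases hX : v.1 ∈ X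
  · simp [unionEquiv, hX]
  · by_cases hY : v.1 ∈ Y <;> simp [unionEquiv, hX, hY]

/-- With M the amplitude matrix, the two reduced matrices are M Mᴴ and the transpose of Mᴴ M, which
have the same nonzero spectrum. -/
theorem entropy_compl (ψ : Hilb d) (X : Finset V) : entropy ψ Xᶜ = entropy ψ X := by
  let e₁ : CoConf d X ≃ Conf d Xᶜ :=
    { toFun := fun b v => b ⟨v, Finset.mem_compl.1 v.2⟩
      invFun := fun b v => b ⟨v, Finset.mem_compl.2 v.2⟩
      left_inv := fun _ => rfl
      right_inv := fun _ => rfl }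
  let e₂ : Conf d X ≃ CoConf d Xᶜ :=
    { toFun := fun b v => b ⟨v, by simpa using v.2⟩
      invFun := fun b v => b ⟨v, by simp⟩
      left_inv := fun _ => rfl
      right_inv := fun _ => rfl }
  rw [entropy_eq_of_equiv ψ Xᶜ e₁ e₂ (ampMatrix ψ X)ᵀ ?_, entropy_eq_vnEntropy, reducedDensity_eq,
    vnEntropy_mul_comm (ampMatrix ψ X), ← vnEntropy_transpose ((ampMatrix ψ X)ᴴ * _),
    transpose_mul]
  · rfl
  · intro b a
    simp only [transpose_apply, ampMatrix, of_apply]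
    refine congrArg ψ (funext fun v => ?_)
    by_cases h : v ∈ X <;> simp [glue, h, e₁, e₂]

theorem entropy_strong_subadditivity (ψ : Hilb d) {A B C : Finset V} (hAB : Disjoint A B)
    (hBC : Disjoint B C) (hAC : Disjoint A C) :
    entropy ψ (A ∪ B ∪ C) + entropy ψ B ≤ entropy ψ (A ∪ B) + entropy ψ (B ∪ C) := by
  have dAB_C : Disjoint (A ∪ B) C := Finset.disjoint_union_left.2 ⟨hAC, hBC⟩
  have dA_BC : Disjoint A (B ∪ C) := Finset.disjoint_union_right.2 ⟨hAB, hAC⟩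
  have hZ : A ∪ B ∪ C = B ∪ C ∪ A := by rw [Finset.union_assoc, Finset.union_comm]
  have hB : A ∪ B = B ∪ A := Finset.union_comm _ _
  let N : Matrix (Conf d A × Conf d B × Conf d C) (CoConf d (A ∪ B ∪ C)) ℂ :=
    Matrix.of fun x z => ψ (glue (A ∪ B ∪ C)
      (unionEquiv (Finset.union_assoc A B C) dA_BC (x.1, unionEquiv rfl hBC x.2)) z)
  have h1 : entropy ψ (A ∪ B ∪ C) = vnEntropy (N * Nᴴ) :=
    entropy_eq_of_equiv ψ _ (((Equiv.refl _).prodCongr (unionEquiv rfl hBC)).trans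
      (unionEquiv (Finset.union_assoc A B C) dA_BC)) (Equiv.refl _) N fun m n => rfl
  have h2 : entropy ψ (A ∪ B) = vnEntropy (traceLast (N * Nᴴ)) := by
    rw [entropy_eq_of_equiv ψ (A ∪ B) (unionEquiv rfl hAB) (complEquiv rfl dAB_C)
      (Matrix.of fun x z => N (x.1, x.2, z.1) z.2)]
    · congr 1
      ext x y
      simp [traceLast, mul_apply, Fintype.sum_prod_type]
    · rintro ⟨a, b⟩ ⟨c, z⟩
      rw [glue_complEquiv, unionEquiv_assoc rfl hAB rfl hBC rfl dAB_C
        (Finset.union_assoc A B C) dA_BC]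
      rfl
  have h3 : entropy ψ (B ∪ C) = vnEntropy (traceFst (N * Nᴴ)) := by
    rw [entropy_eq_of_equiv ψ (B ∪ C) (unionEquiv rfl hBC) (complEquiv hZ dA_BC.symm)
      (Matrix.of fun x z => N (z.1, x) z.2)]
    · congr 1
      ext x y
      simp [traceFst, mul_apply, Fintype.sum_prod_type]
    · rintro ⟨b, c⟩ ⟨a, z⟩
      rw [glue_complEquiv, unionEquiv_comm hZ (Finset.union_assoc A B C) dA_BC.symm dA_BC]
      rfl
  have h4 : entropy ψ B = vnEntropy (traceFst (traceLast (N * Nᴴ))) := by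
    rw [entropy_eq_of_equiv ψ B (Equiv.refl _)
      (((Equiv.refl _).prodCongr (complEquiv rfl dAB_C)).trans (complEquiv hB hAB.symm))
      (Matrix.of fun b z => N (z.1, b, z.2.1) z.2.2)]
    · congr 1
      ext x y
      simp [traceFst, traceLast, mul_apply, Fintype.sum_prod_type]
    · rintro b ⟨a, c, z⟩
      simp only [Equiv.trans_apply, Equiv.prodCongr_apply, Prod.map_apply, Equiv.refl_apply]
      rw [glue_complEquiv, glue_complEquiv, unionEquiv_comm hB rfl hAB.symm hAB,
        unionEquiv_assoc rfl hAB rfl hBC rfl dAB_C (Finset.union_assoc A B C) dA_BC]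
      rfl
  rw [h1, h2, h3, h4]
  exact vnEntropy_strong_subadditivity (posSemidef_self_mul_conjTranspose N)

end RegionEntropy

/-! ### First-order expansion of the entropy of M Mᴴ, kernels included -/

section EntropyPerturbation

open Matrix
open scoped ComplexOrder Matrix.Norms.Frobenius

variable {κ ν : Type*} [Fintype κ] [DecidableEq κ] [Fintype ν] [DecidableEq ν]

theorem frobenius_sq (A : Matrix κ ν ℂ) : ‖A‖ ^ 2 = ∑ i, ∑ j, ‖A i j‖ ^ 2 := by
  rw [frobenius_norm_def, ← Real.sqrt_eq_rpow, Real.sq_sqrt]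
  · simp
  · positivity

theorem frobenius_sq_eq_trace (A : Matrix κ ν ℂ) : ‖A‖ ^ 2 = (Aᴴ * A).trace.re := by
  rw [frobenius_sq, trace, Complex.re_sum, Finset.sum_comm]
  refine Finset.sum_congr rfl fun j _ => ?_
  rw [diag_apply, mul_apply, Complex.re_sum]
  refine Finset.sum_congr rfl fun i _ => ?_
  rw [conjTranspose_apply, RCLike.star_def, Complex.conj_mul']
  norm_cast

theorem frobenius_unitary_mul {U : Matrix κ κ ℂ} (hU : Uᴴ * U = 1) (A : Matrix κ ν ℂ) :
    ‖U * A‖ = ‖A‖ := by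
  have : ‖U * A‖ ^ 2 = ‖A‖ ^ 2 := by
    rw [frobenius_sq_eq_trace, frobenius_sq_eq_trace, conjTranspose_mul, Matrix.mul_assoc,
      ← Matrix.mul_assoc Uᴴ, hU, Matrix.one_mul]
  exact (pow_left_inj₀ (norm_nonneg _) (norm_nonneg _) two_ne_zero).1 this

theorem frobenius_mul_unitary {U : Matrix ν ν ℂ} (hU : U * Uᴴ = 1) (A : Matrix κ ν ℂ) :
    ‖A * U‖ = ‖A‖ := by
  rw [← frobenius_norm_conjTranspose, conjTranspose_mul, frobenius_unitary_mul,
    frobenius_norm_conjTranspose]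
  rwa [conjTranspose_conjTranspose]

theorem row_sq_le_frobenius_sq (A : Matrix κ ν ℂ) (i : κ) : ∑ j, ‖A i j‖ ^ 2 ≤ ‖A‖ ^ 2 := by
  rw [frobenius_sq]
  exact Finset.single_le_sum (f := fun i => ∑ j, ‖A i j‖ ^ 2)
    (fun i _ => Finset.sum_nonneg fun j _ => by positivity) (Finset.mem_univ i)

theorem col_sq_le_frobenius_sq (A : Matrix κ ν ℂ) (j : ν) : ∑ i, ‖A i j‖ ^ 2 ≤ ‖A‖ ^ 2 := by
  rw [frobenius_sq, Finset.sum_comm]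
  exact Finset.single_le_sum (f := fun j => ∑ i, ‖A i j‖ ^ 2)
    (fun i _ => Finset.sum_nonneg fun j _ => by positivity) (Finset.mem_univ j)

/-- Both directions come from log x ≤ x - 1, at q / p and at p / q. The quadratic remainder is
uniform in q, down to q = 0, so it can be averaged over all perturbed eigenvalues. -/
theorem abs_negMulLog_sub_le {p q : ℝ} (hp : 0 < p) (hq : 0 ≤ q) :
    |Real.negMulLog q - Real.negMulLog p - (-Real.log p - 1) * (q - p)| ≤ (q - p) ^ 2 / p := by
  rcases hq.eq_or_lt with rfl | hq
  · simp only [Real.negMulLog]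
    rw [abs_le]
    have : (0 - p) ^ 2 / p = p := by field_simp; ring
    rw [this]
    constructor <;> nlinarith
  have h1 := Real.log_le_sub_one_of_pos (div_pos hq hp)
  have h2 := Real.log_le_sub_one_of_pos (div_pos hp hq)
  rw [Real.log_div hq.ne' hp.ne'] at h1
  rw [Real.log_div hp.ne' hq.ne'] at h2
  have e1 : (q - p) ^ 2 / p = q * (q / p - 1) - q + p := by field_simp; ring
  have h1' := mul_le_mul_of_nonneg_left h1 hq.le
  have h2' := mul_le_mul_of_nonneg_left h2 hq.le
  have e2 : q * (p / q - 1) = p - q := by field_simp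
  have h3 : 0 ≤ (q - p) ^ 2 / p := by positivity
  rw [abs_le]
  simp only [Real.negMulLog]
  constructor <;> nlinarith

/-- A tangent-line bound from concavity, used with s = ‖N‖² for the weight that a perturbation puts
on the old kernel. -/
theorem negMulLog_le_tangent {s q : ℝ} (hs : 0 < s) (hq : 0 ≤ q) :
    Real.negMulLog q ≤ -q * Real.log s + s := by
  rcases hq.eq_or_lt with rfl | hq
  · simpa using hs.le
  have h2 := Real.log_le_sub_one_of_pos (div_pos hs hq)
  rw [Real.log_div hs.ne' hq.ne'] at h2
  have h2' := mul_le_mul_of_nonneg_left h2 hq.le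
  have e2 : q * (s / q - 1) = s - q := by field_simp
  simp only [Real.negMulLog]
  nlinarith

theorem neg_sq_le_negMulLog {q : ℝ} (hq : 0 ≤ q) : -q ^ 2 ≤ Real.negMulLog q := by
  rcases hq.eq_or_lt with rfl | hq
  · simp
  have h := mul_le_mul_of_nonneg_left (Real.log_le_sub_one_of_pos hq) hq.le
  simp only [Real.negMulLog]
  nlinarith

theorem Diagonalizes.apply_eq {U R : Matrix κ κ ℂ} {p : κ → ℝ} (h : Diagonalizes U p R) :
    Uᴴ * R * U = diagonal (fun i => (p i : ℂ)) := by
  rw [h.eq]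
  simp only [mul_assoc]
  rw [h.left, mul_one, ← mul_assoc, h.left, one_mul]

theorem mul_conjTranspose_diag_re (A : Matrix κ ν ℂ) (i : κ) :
    ((A * Aᴴ) i i).re = ∑ b, ‖A i b‖ ^ 2 := by
  rw [mul_apply, Complex.re_sum]
  refine Finset.sum_congr rfl fun b _ => ?_
  rw [conjTranspose_apply, RCLike.star_def, Complex.mul_conj']
  norm_cast

theorem Diagonalizes.eigenvalue_eq {U : Matrix κ κ ℂ} {M : Matrix κ ν ℂ} {p : κ → ℝ}
    (h : Diagonalizes U p (M * Mᴴ)) (i : κ) : p i = ∑ b, ‖(Uᴴ * M) i b‖ ^ 2 := by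
  rw [← mul_conjTranspose_diag_re, conjTranspose_mul, conjTranspose_conjTranspose,
    Matrix.mul_assoc, ← Matrix.mul_assoc M, ← Matrix.mul_assoc, h.apply_eq, diagonal_apply_eq, Complex.ofReal_re]

/-- The entry of R' - R between a new and an old eigenvector is (q j - p i) times their overlap.
Thus the spread of the new eigenvalues around an old one is bounded by the perturbation, without
matching eigenvalues. -/
theorem sum_overlap_sq_sub {U V R R' : Matrix κ κ ℂ} {p q : κ → ℝ} (h : Diagonalizes U p R)
    (h' : Diagonalizes V q R') (i : κ) :
    ∑ j, overlap V U j i * (q j - p i) ^ 2 = ∑ j, ‖(Vᴴ * (R' - R) * U) j i‖ ^ 2 := by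
  have e1 : Vᴴ * R' * U = diagonal (fun i => (q i : ℂ)) * (Vᴴ * U) := by
    rw [h'.eq]
    simp only [← mul_assoc]
    rw [h'.left, one_mul]
  have e2 : Vᴴ * R * U = (Vᴴ * U) * diagonal (fun i => (p i : ℂ)) := by
    rw [h.eq]
    simp only [mul_assoc]
    rw [h.left, mul_one]
  refine Finset.sum_congr rfl fun j _ => ?_
  rw [mul_sub, sub_mul, e1, e2, Matrix.sub_apply, diagonal_mul, mul_diagonal, overlap]
  generalize (Vᴴ * U) j i = w
  rw [mul_comm w, ← sub_mul, norm_mul, mul_pow, ← Complex.ofReal_sub, Complex.norm_real,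
    Real.norm_eq_abs, sq_abs]
  ring

/-- The first-order variation of the entropy of `M Mᴴ` under `M ↦ M + N`, where `U` and `p`
diagonalize `M Mᴴ`. -/
def entropyVariation (U : Matrix κ κ ℂ) (p : κ → ℝ) (M N : Matrix κ ν ℂ) : ℝ :=
  ∑ i, (-Real.log (p i) - 1) * (2 * (∑ b, (Uᴴ * M) i b * star ((Uᴴ * N) i b)).re)

/-- The squared overlaps are doubly stochastic weights, so the entropy change is an average of
differences of `Real.negMulLog`. The weighted mean of the new eigenvalues is known exactly, and
their second moment about the old one is O(‖N‖²). Only the kernel of M Mᴴ produces the term with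
‖N‖² log ‖N‖², which is still o(‖N‖). -/
theorem abs_vnEntropy_add_sub_le {U : Matrix κ κ ℂ} {p : κ → ℝ} {M : Matrix κ ν ℂ}
    (h : Diagonalizes U p (M * Mᴴ)) :
    ∃ C : ℝ, ∀ N : Matrix κ ν ℂ, ‖N‖ ≤ 1 →
      |vnEntropy ((M + N) * (M + N)ᴴ) - vnEntropy (M * Mᴴ) - entropyVariation U p M N| ≤
        C * ‖N‖ ^ 2 + Fintype.card κ * Real.negMulLog (‖N‖ ^ 2) := by
  set c : ℝ := (2 * ‖M‖ + 1) ^ 2 with hc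
  refine ⟨∑ i, (c / p i + |Real.log (p i) + 1| + 1 + c), fun N hN => ?_⟩
  rcases eq_or_ne N 0 with rfl | hN0
  · simp [entropyVariation]
  set s : ℝ := ‖N‖ ^ 2 with hs
  have hs0 : 0 < s := by have := norm_pos_iff.2 hN0; positivity
  have hs1 : s ≤ 1 := by rw [hs]; exact pow_le_one₀ (norm_nonneg _) hN
  have hps : (((M + N) * (M + N)ᴴ)).PosSemidef := posSemidef_self_mul_conjTranspose _
  have h' := hps.1.diagonalizes
  set V : Matrix κ κ ℂ := (hps.1.eigenvectorUnitary : Matrix κ κ ℂ)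
  set q := hps.1.eigenvalues
  have hq : ∀ j, 0 ≤ q j := hps.eigenvalues_nonneg
  have hp : ∀ i, 0 ≤ p i := fun i => by
    rw [h.eigenvalue_eq]; positivity
  have hw : ∀ i, ∑ j, overlap V U j i = 1 := overlap_sum_left h'.right h.left
  have hw' : ∀ j, ∑ i, overlap V U j i = 1 := overlap_sum_right h'.left h.right
  have hw0 : ∀ j i, 0 ≤ overlap V U j i := overlap_nonneg V U
  set a : κ → ℝ := fun i => ∑ b, ‖(Uᴴ * N) i b‖ ^ 2
  set D : κ → ℝ := fun i => 2 * (∑ b, (Uᴴ * M) i b * star ((Uᴴ * N) i b)).re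
  set Q : κ → ℝ := fun i => ∑ j, overlap V U j i * (q j - p i) ^ 2
  have ha0 : ∀ i, 0 ≤ a i := fun i => by positivity
  have ha : ∀ i, a i ≤ s := fun i => by
    refine (row_sq_le_frobenius_sq (Uᴴ * N) i).trans (le_of_eq ?_)
    rw [frobenius_unitary_mul (by rw [conjTranspose_conjTranspose, h.right])]
  have hQ : ∀ i, Q i ≤ c * s := fun i => by
    simp only [Q]
    rw [sum_overlap_sq_sub h h']
    refine (col_sq_le_frobenius_sq _ i).trans ?_
    rw [frobenius_mul_unitary h.right,
      frobenius_unitary_mul (by rw [conjTranspose_conjTranspose, h'.right])]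
    have e : (M + N) * (M + N)ᴴ - M * Mᴴ = M * Nᴴ + N * Mᴴ + N * Nᴴ := by
      rw [conjTranspose_add, Matrix.mul_add, Matrix.add_mul, Matrix.add_mul]
      abel
    have hb : ‖(M + N) * (M + N)ᴴ - M * Mᴴ‖ ≤ (2 * ‖M‖ + 1) * ‖N‖ := by
      rw [e]
      refine (norm_add₃_le).trans ?_
      have h1 := frobenius_norm_mul M Nᴴ
      have h2 := frobenius_norm_mul N Mᴴ
      have h3 := frobenius_norm_mul N Nᴴ
      rw [frobenius_norm_conjTranspose] at h1 h2 h3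
      nlinarith [norm_nonneg N, norm_nonneg M]
    calc _ ≤ ((2 * ‖M‖ + 1) * ‖N‖) ^ 2 := pow_le_pow_left₀ (norm_nonneg _) hb 2
      _ = c * s := by rw [mul_pow]
  have hmean : ∀ i, ∑ j, overlap V U j i * q j = p i + D i + a i := fun i => by
    rw [h'.sum_overlap_mul_left, h.eigenvalue_eq]
    have : Uᴴ * ((M + N) * (M + N)ᴴ) * U = (Uᴴ * M + Uᴴ * N) * (Uᴴ * M + Uᴴ * N)ᴴ := by
      rw [← Matrix.mul_add, conjTranspose_mul, conjTranspose_conjTranspose]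
      simp only [Matrix.mul_assoc]
    rw [this, mul_conjTranspose_diag_re]
    simp only [a, D]
    rw [Complex.re_sum, Finset.mul_sum, ← Finset.sum_add_distrib, ← Finset.sum_add_distrib]
    refine Finset.sum_congr rfl fun b _ => ?_
    rw [Matrix.add_apply]
    generalize (Uᴴ * M) i b = z
    generalize (Uᴴ * N) i b = w
    rw [Complex.sq_norm, Complex.sq_norm, Complex.sq_norm, Complex.normSq_add, RCLike.star_def]
    ring
  have hdiff : vnEntropy ((M + N) * (M + N)ᴴ) - vnEntropy (M * Mᴴ) =
      ∑ i, ∑ j, overlap V U j i * (Real.negMulLog (q j) - Real.negMulLog (p i)) := by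
    rw [h.vnEntropy_eq, h'.vnEntropy_eq]
    simp_rw [mul_sub, Finset.sum_sub_distrib, ← Finset.sum_mul, hw, one_mul]
    rw [Finset.sum_comm]
    simp_rw [← Finset.sum_mul, hw', one_mul]
  rw [hdiff, entropyVariation, ← Finset.sum_sub_distrib, Finset.sum_mul]
  have hcard : (Fintype.card κ : ℝ) * Real.negMulLog s = ∑ _i : κ, Real.negMulLog s := by simp
  rw [hcard, ← Finset.sum_add_distrib]
  refine (Finset.abs_sum_le_sum_abs _ _).trans (Finset.sum_le_sum fun i _ => ?_)
  have hk : 0 ≤ Real.negMulLog s := Real.negMulLog_nonneg hs0.le hs1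
  have hcs : 0 ≤ c * s := by positivity
  change |_ - (-Real.log (p i) - 1) * D i| ≤ _
  rcases (hp i).eq_or_lt with hpi | hpi
  -- On the kernel the row of Uᴴ M vanishes, so the mean of the new eigenvalues is quadratic in N
  -- and there is no linear term to compare with.
  · have hz : ∀ b, (Uᴴ * M) i b = 0 := by
      have h0 := h.eigenvalue_eq i
      rw [← hpi] at h0
      intro b
      have := (Finset.sum_eq_zero_iff_of_nonneg (fun b _ => by positivity)).1 h0.symm b
        (Finset.mem_univ b)
      simpa using this
    have hD : D i = 0 := by simp [D, hz]
    have hm := hmean i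
    rw [hD, ← hpi, zero_add, zero_add] at hm
    have hQi := hQ i
    simp only [Q, ← hpi, sub_zero] at hQi
    have up : ∑ j, overlap V U j i * Real.negMulLog (q j) ≤ -a i * Real.log s + s := by
      calc _ ≤ ∑ j, overlap V U j i * (-q j * Real.log s + s) :=
            Finset.sum_le_sum fun j _ =>
              mul_le_mul_of_nonneg_left (negMulLog_le_tangent hs0 (hq j)) (hw0 j i)
        _ = -(∑ j, overlap V U j i * q j) * Real.log s + (∑ j, overlap V U j i) * s := by
            rw [← Finset.sum_neg_distrib, Finset.sum_mul, Finset.sum_mul, ← Finset.sum_add_distrib]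
            exact Finset.sum_congr rfl fun j _ => by ring
        _ = _ := by rw [hm, hw, one_mul]
    have lo : -(c * s) ≤ ∑ j, overlap V U j i * Real.negMulLog (q j) := by
      refine (neg_le_neg hQi).trans ?_
      rw [← Finset.sum_neg_distrib]
      refine Finset.sum_le_sum fun j _ => ?_
      rw [← mul_neg]
      exact mul_le_mul_of_nonneg_left (neg_sq_le_negMulLog (hq j)) (hw0 j i)
    have hls : Real.log s ≤ 0 := Real.log_nonpos hs0.le hs1
    have hup : -a i * Real.log s ≤ Real.negMulLog s := by
      rw [Real.negMulLog]
      nlinarith [ha i]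
    rw [hD, ← hpi, Real.negMulLog_zero, mul_zero, sub_zero, abs_le]
    simp only [sub_zero, div_zero, Real.log_zero, zero_add, abs_one]
    constructor <;> nlinarith
  -- At a positive eigenvalue the tangent expansion applies; the mean differs from the linear term
  -- `D i` by the quadratic `a i`.
  · have e : ∑ j, overlap V U j i * (Real.negMulLog (q j) - Real.negMulLog (p i)) -
        (-Real.log (p i) - 1) * D i =
        ∑ j, overlap V U j i * (Real.negMulLog (q j) - Real.negMulLog (p i) -
          (-Real.log (p i) - 1) * (q j - p i)) + (-Real.log (p i) - 1) * a i := by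
      have : D i = ∑ j, overlap V U j i * (q j - p i) - a i := by
        simp_rw [mul_sub, Finset.sum_sub_distrib, ← Finset.sum_mul, hw, hmean]
        ring
      rw [this, mul_sub, Finset.mul_sum, sub_sub_eq_add_sub, add_sub_right_comm,
        ← Finset.sum_sub_distrib]
      congr 1
      exact Finset.sum_congr rfl fun j _ => by ring
    rw [e]
    have b1 : |∑ j, overlap V U j i * (Real.negMulLog (q j) - Real.negMulLog (p i) -
          (-Real.log (p i) - 1) * (q j - p i))| ≤ c / p i * s := by
      calc _ ≤ ∑ j, overlap V U j i * ((q j - p i) ^ 2 / p i) := by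
            refine (Finset.abs_sum_le_sum_abs _ _).trans (Finset.sum_le_sum fun j _ => ?_)
            rw [abs_mul, abs_of_nonneg (hw0 j i)]
            exact mul_le_mul_of_nonneg_left (abs_negMulLog_sub_le hpi (hq j)) (hw0 j i)
        _ = Q i / p i := by
            simp only [Q]
            rw [Finset.sum_div]
            exact Finset.sum_congr rfl fun j _ => by ring
        _ ≤ c * s / p i := div_le_div_of_nonneg_right (hQ i) hpi.le
        _ = _ := by ring
    have b2 : |(-Real.log (p i) - 1) * a i| ≤ |Real.log (p i) + 1| * s := by
      rw [abs_mul, abs_of_nonneg (ha0 i), ← abs_neg (Real.log (p i) + 1), neg_add']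
      exact mul_le_mul_of_nonneg_left (ha i) (abs_nonneg _)
    refine (abs_add_le _ _).trans ?_
    nlinarith

end EntropyPerturbation

/-! ### The derivative of the entropy and vector identities for K_X ψ -/

section EntropyDerivative

open Matrix
open scoped ComplexOrder Matrix.Norms.Frobenius

variable {V : Type} [Fintype V] [DecidableEq V] {d : V → ℕ}

/-- A configuration is a configuration of `X` together with one of its complement. -/
def glueEquiv (X : Finset V) : Conf d X × CoConf d X ≃ ∀ v, Fin (d v) where
  toFun p := glue X p.1 p.2
  invFun s := (fun v => s v, fun v => s v)
  left_inv p := by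
    refine Prod.ext (funext fun v => ?_) (funext fun v => ?_)
    · simp [glue, v.2]
    · simp [glue, v.2]
  right_inv s := by
    funext v
    simp [glue]

theorem inner_eq_trace (X : Finset V) (h φ : Hilb d) :
    inner ℂ h φ = ((ampMatrix h X)ᴴ * ampMatrix φ X).trace := by
  rw [PiLp.inner_apply, ← Equiv.sum_comp (glueEquiv X), Fintype.sum_prod_type, trace,
    Finset.sum_comm]
  refine Finset.sum_congr rfl fun b _ => ?_
  rw [diag_apply, mul_apply]
  refine Finset.sum_congr rfl fun a _ => ?_
  simp [ampMatrix, glueEquiv, mul_comm]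

theorem norm_ampMatrix (X : Finset V) (h : Hilb d) : ‖ampMatrix h X‖ = ‖h‖ := by
  have : ‖ampMatrix h X‖ ^ 2 = ‖h‖ ^ 2 := by
    rw [frobenius_sq_eq_trace, ← inner_eq_trace, inner_self_eq_norm_sq_to_K]
    norm_cast
  exact (pow_left_inj₀ (norm_nonneg _) (norm_nonneg _) two_ne_zero).1 this

theorem ampMatrix_entHamVec (ψ : Hilb d) (X : Finset V) :
    ampMatrix (entHamVec ψ X) X = entHam ψ X * ampMatrix ψ X := by
  ext a b
  have h1 : (fun v : {v // v ∈ X} => glue X a b v) = a := by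
    funext v; simp [glue, v.2]
  have h2 : (fun v : {v // v ∉ X} => glue X a b v) = b := by
    funext v; simp [glue, v.2]
  simp only [ampMatrix, of_apply, entHamVec, mul_apply]
  rw [h1]
  exact Finset.sum_congr rfl fun a' _ => by rw [h2]

theorem entHam_eq (ψ : Hilb d) (X : Finset V) :
    Diagonalizes ((reducedDensity_isHermitian ψ X).eigenvectorUnitary : Matrix _ _ ℂ)
      (fun i => -Real.log ((reducedDensity_isHermitian ψ X).eigenvalues i)) (entHam ψ X) where
  left := (reducedDensity_isHermitian ψ X).diagonalizes.left
  right := (reducedDensity_isHermitian ψ X).diagonalizes.right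
  eq := by
    rw [entHam, IsHermitian.cfc, Unitary.conjStarAlgAut_apply]
    rfl

theorem inner_entHamVec (ψ : Hilb d) (X : Finset V) :
    inner ℂ ψ (entHamVec ψ X) = (entropy ψ X : ℂ) := by
  have h := (reducedDensity_isHermitian ψ X).diagonalizes
  rw [inner_eq_trace X, ampMatrix_entHamVec, ← Matrix.mul_assoc, trace_mul_comm,
    ← Matrix.mul_assoc, ← reducedDensity_eq, h.trace_mul, entropy, Complex.ofReal_sum]
  refine Finset.sum_congr rfl fun i _ => ?_
  rw [(entHam_eq ψ X).apply_eq, diagonal_apply_eq, Real.negMulLog]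
  push_cast
  ring

theorem entropyVariation_eq (ψ h : Hilb d) (X : Finset V) :
    entropyVariation (reducedDensity_isHermitian ψ X).eigenvectorUnitary.1
      (reducedDensity_isHermitian ψ X).eigenvalues (ampMatrix ψ X) (ampMatrix h X) =
      2 * (inner ℂ (entHamVec ψ X - ψ) h).re := by
  have hK := entHam_eq ψ X
  set U : Matrix (Conf d X) (Conf d X) ℂ :=
    (reducedDensity_isHermitian ψ X).eigenvectorUnitary.1
  set p := (reducedDensity_isHermitian ψ X).eigenvalues
  have hre : (inner ℂ (entHamVec ψ X - ψ) h).re = (inner ℂ h (entHamVec ψ X - ψ)).re := by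
    rw [← inner_conj_symm, Complex.conj_re]
  rw [hre, inner_sub_right, Complex.sub_re, inner_eq_trace X, inner_eq_trace X,
    ampMatrix_entHamVec]
  have t1 : ∀ A : Matrix (Conf d X) (CoConf d X) ℂ,
      ((ampMatrix h X)ᴴ * A).trace = ∑ i, ∑ b, (Uᴴ * A) i b * star ((Uᴴ * ampMatrix h X) i b) := by
    intro A
    have : (ampMatrix h X)ᴴ * A = (Uᴴ * ampMatrix h X)ᴴ * (Uᴴ * A) := by
      rw [conjTranspose_mul, conjTranspose_conjTranspose, Matrix.mul_assoc, ← Matrix.mul_assoc U,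
        hK.right, Matrix.one_mul]
    rw [this, trace, Finset.sum_comm]
    refine Finset.sum_congr rfl fun b _ => ?_
    rw [diag_apply, mul_apply]
    exact Finset.sum_congr rfl fun i _ => by rw [conjTranspose_apply, mul_comm]
  have t2 : Uᴴ * (entHam ψ X * ampMatrix ψ X) =
      diagonal (fun i => ((-Real.log (p i) : ℝ) : ℂ)) * (Uᴴ * ampMatrix ψ X) := by
    rw [← hK.apply_eq]
    simp only [Matrix.mul_assoc]
    rw [← Matrix.mul_assoc U, hK.right, Matrix.one_mul]
  rw [t1, t1, t2]
  simp only [diagonal_mul, mul_assoc, ← Finset.mul_sum]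
  rw [Complex.re_sum, Complex.re_sum, ← Finset.sum_sub_distrib, Finset.mul_sum, entropyVariation]
  refine Finset.sum_congr rfl fun i _ => ?_
  rw [Complex.re_ofReal_mul]
  ring

/-- The real derivative of the entropy of `X` at `ψ`. -/
def entropyDeriv (ψ : Hilb d) (X : Finset V) : Hilb d →L[ℝ] ℝ :=
  (2 : ℝ) • Complex.reCLM.comp ((innerSL ℂ (entHamVec ψ X - ψ)).restrictScalars ℝ)

theorem entropyDeriv_apply (ψ h : Hilb d) (X : Finset V) :
    entropyDeriv ψ X h = 2 * (inner ℂ (entHamVec ψ X - ψ) h).re := by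
  simp [entropyDeriv]

/-- The derivative is taken on the whole real vector space, without normalization; the `- ψ` in it
is the derivative of Tr ρ. Relations between entropies valid at all vectors can therefore be
differentiated freely. -/
theorem hasFDerivAt_entropy (ψ : Hilb d) (X : Finset V) :
    HasFDerivAt (fun φ : Hilb d => entropy φ X) (entropyDeriv ψ X) ψ := by
  have hdiag := (reducedDensity_isHermitian ψ X).diagonalizes
  conv at hdiag => rhs; rw [reducedDensity_eq]
  obtain ⟨C, hC⟩ := abs_vnEntropy_add_sub_le hdiag
  rw [hasFDerivAt_iff_isLittleO_nhds_zero]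
  have hbound : ∀ h : Hilb d, ‖h‖ ≤ 1 →
      ‖entropy (ψ + h) X - entropy ψ X - entropyDeriv ψ X h‖ ≤
        ‖C * ‖h‖ ^ 2 + Fintype.card (Conf d X) * Real.negMulLog (‖h‖ ^ 2)‖ := by
    intro h hh
    have := hC (ampMatrix h X) (by rwa [norm_ampMatrix])
    rw [norm_ampMatrix, entropyVariation_eq] at this
    rw [entropyDeriv_apply, entropy_eq_vnEntropy, entropy_eq_vnEntropy, reducedDensity_eq,
      reducedDensity_eq]
    have e : ampMatrix (ψ + h) X = ampMatrix ψ X + ampMatrix h X := by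
      ext a b; simp [ampMatrix]
    rw [e]
    exact this.trans (le_abs_self _)
  refine Asymptotics.IsBigO.trans_isLittleO (Asymptotics.IsBigO.of_bound 1 ?_) ?_
    (g := fun h : Hilb d => C * ‖h‖ ^ 2 + Fintype.card (Conf d X) * Real.negMulLog (‖h‖ ^ 2))
  · filter_upwards [Metric.closedBall_mem_nhds (0 : Hilb d) one_pos] with h hh
    rw [one_mul]
    exact hbound h (by simpa using hh)
  · have e : (fun h : Hilb d => C * ‖h‖ ^ 2 + Fintype.card (Conf d X) * Real.negMulLog (‖h‖ ^ 2)) =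
        fun h => (C * ‖h‖ + 2 * Fintype.card (Conf d X) * Real.negMulLog ‖h‖) * ‖h‖ := by
      funext h
      simp only [Real.negMulLog, Real.log_pow]
      push_cast
      ring
    rw [e]
    refine Asymptotics.IsLittleO.of_norm_right ?_
    have : Filter.Tendsto (fun h : Hilb d => C * ‖h‖ + 2 * Fintype.card (Conf d X) *
        Real.negMulLog ‖h‖) (nhds 0) (nhds 0) := by
      have hc : Continuous (fun h : Hilb d => C * ‖h‖ + 2 * Fintype.card (Conf d X) *
        Real.negMulLog ‖h‖) := by
        have := Real.continuous_negMulLog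
        fun_prop
      simpa using hc.tendsto 0
    have h1 := ((Asymptotics.isLittleO_one_iff ℝ).2 this).mul_isBigO
      (Asymptotics.isBigO_refl (fun h : Hilb d => ‖h‖) (nhds 0))
    simpa using h1

theorem eq_of_forall_re_inner_eq {v w : Hilb d}
    (h : ∀ x : Hilb d, (inner ℂ v x).re = (inner ℂ w x).re) : v = w := by
  have h1 := h (v - w)
  rw [← sub_eq_zero, ← Complex.sub_re, ← inner_sub_left] at h1
  have : ‖v - w‖ ^ 2 = 0 := by
    rw [← inner_self_eq_norm_sq (𝕜 := ℂ)]
    exact h1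
  exact sub_eq_zero.1 (norm_eq_zero.1 (pow_eq_zero_iff two_ne_zero |>.1 this))

/-- Both sides give the derivative of the same function, since complementary entropies agree at
every vector. -/
theorem entHamVec_compl (ψ : Hilb d) (X : Finset V) : entHamVec ψ Xᶜ = entHamVec ψ X := by
  have h1 := hasFDerivAt_entropy ψ Xᶜ
  simp only [entropy_compl] at h1
  have h2 := h1.unique (hasFDerivAt_entropy ψ X)
  have : entHamVec ψ Xᶜ - ψ = entHamVec ψ X - ψ := by
    refine eq_of_forall_re_inner_eq fun x => ?_
    have := DFunLike.congr_fun h2 x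
    rw [entropyDeriv_apply, entropyDeriv_apply] at this
    linarith
  exact sub_left_injective this

/-- If the conditional mutual information of `A` and `C` given `B` vanishes, so does the action of
its operator version on the state. -/
theorem entHamVec_markov (ψ : Hilb d) {A B C : Finset V} (hAB : Disjoint A B)
    (hBC : Disjoint B C) (hAC : Disjoint A C)
    (h : entropy ψ (A ∪ B) + entropy ψ (B ∪ C) ≤ entropy ψ (A ∪ B ∪ C) + entropy ψ B) :
    entHamVec ψ (A ∪ B) + entHamVec ψ (B ∪ C) = entHamVec ψ (A ∪ B ∪ C) + entHamVec ψ B := by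
  -- Strong subadditivity makes this function nonnegative at every vector, and the assumption makes
  -- it at most 0 at ψ, so ψ is a minimum. In the vanishing derivative the normalization terms
  -- cancel, two against two.
  have hmin : IsLocalMin (fun φ : Hilb d => entropy φ (A ∪ B) + entropy φ (B ∪ C) -
      (entropy φ (A ∪ B ∪ C) + entropy φ B)) ψ := by
    refine Filter.Eventually.of_forall fun φ => ?_
    have := entropy_strong_subadditivity φ hAB hBC hAC
    linarith
  have hd := ((hasFDerivAt_entropy ψ (A ∪ B)).add (hasFDerivAt_entropy ψ (B ∪ C))).sub
    ((hasFDerivAt_entropy ψ (A ∪ B ∪ C)).add (hasFDerivAt_entropy ψ B))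
  have h0 := hmin.hasFDerivAt_eq_zero hd
  refine eq_of_forall_re_inner_eq fun x => ?_
  have := DFunLike.congr_fun h0 x
  simp only [_root_.sub_apply, _root_.add_apply, entropyDeriv_apply,
    _root_.zero_apply, inner_sub_left, Complex.sub_re] at this
  simp only [inner_add_left, Complex.add_re]
  linarith

end EntropyDerivative

/-! ### Locality of K_U ψ from Axiom A1 -/

section CellRegions

variable (W : PolarLattice) (ψ : W.H)

theorem sites_union (X Y : Finset (Cell W.n)) : sites W (X ∪ Y) = sites W X ∪ sites W Y := by
  ext v; simp [sites]

theorem sites_compl (X : Finset (Cell W.n)) : sites W Xᶜ = (sites W X)ᶜ := by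
  ext v; simp [sites]

theorem sites_disjoint {X Y : Finset (Cell W.n)} (h : Disjoint X Y) :
    Disjoint (sites W X) (sites W Y) := by
  rw [Finset.disjoint_left] at h ⊢
  intro v hv hv'
  simp only [sites, Finset.mem_filter, Finset.mem_univ, true_and] at hv hv'
  exact h hv hv'

theorem S_compl (X : Finset (Cell W.n)) : S W ψ Xᶜ = S W ψ X := by
  rw [S, sites_compl, entropy_compl, S]

theorem K_compl (X : Finset (Cell W.n)) : K W ψ Xᶜ = K W ψ X := by
  rw [K, sites_compl, entHamVec_compl, K]

theorem inner_K (X : Finset (Cell W.n)) : inner ℂ ψ (K W ψ X) = (S W ψ X : ℂ) :=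
  inner_entHamVec ψ _

theorem S_strong_subadditivity {A B C : Finset (Cell W.n)} (hAB : Disjoint A B)
    (hBC : Disjoint B C) (hAC : Disjoint A C) :
    S W ψ (A ∪ B ∪ C) + S W ψ B ≤ S W ψ (A ∪ B) + S W ψ (B ∪ C) := by
  simp only [S, sites_union]
  exact entropy_strong_subadditivity ψ (sites_disjoint W hAB) (sites_disjoint W hBC)
    (sites_disjoint W hAC)

theorem K_markov {A B C : Finset (Cell W.n)} (hAB : Disjoint A B)
    (hBC : Disjoint B C) (hAC : Disjoint A C)
    (h : S W ψ (A ∪ B) + S W ψ (B ∪ C) ≤ S W ψ (A ∪ B ∪ C) + S W ψ B) :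
    K W ψ (A ∪ B) + K W ψ (B ∪ C) = K W ψ (A ∪ B ∪ C) + K W ψ B := by
  simp only [S, K, sites_union] at h ⊢
  exact entHamVec_markov ψ (sites_disjoint W hAB) (sites_disjoint W hBC) (sites_disjoint W hAC) h

/-- Axiom A1 makes the change of `K_U ψ` under adding the center of the partition local. -/
theorem K_local {ψ : W.H} (hA1 : AxiomA1 W ψ) {β Y δ U : Finset (Cell W.n)}
    (hP : A1Partition β Y δ) (hβ : β ⊆ U) (hY : Disjoint Y U) (hδ : Disjoint δ U) :
    K W ψ (Y ∪ U) - K W ψ U = K W ψ (Y ∪ β) - K W ψ β := by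
  have h1 := hA1 β Y δ hP
  have hYβ : Disjoint Y β := hP.disjoint_BC.symm
  have hTU : Disjoint U ((Y ∪ δ)ᶜ \ U) := Finset.disjoint_sdiff
  have hYT : Disjoint Y ((Y ∪ δ)ᶜ \ U) := by
    rw [Finset.disjoint_left]; intro v hv; simp [hv]
  have e1 : U ∪ ((Y ∪ δ)ᶜ \ U) = (Y ∪ δ)ᶜ := by
    refine Finset.union_sdiff_of_subset fun v hv => ?_
    rw [Finset.mem_compl, Finset.mem_union]
    rintro (h | h)
    · exact Finset.disjoint_left.1 hY h hv
    · exact Finset.disjoint_left.1 hδ h hv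
  have e2 : Y ∪ U ∪ ((Y ∪ δ)ᶜ \ U) = δᶜ := by
    rw [Finset.union_assoc, e1]
    ext v
    simp only [Finset.mem_union, Finset.mem_compl]
    have : v ∈ Y → v ∉ δ := fun h => Finset.disjoint_left.1 hP.disjoint_CD h
    tauto
  -- Enlarging `U` to the complement of `Y ∪ δ` turns, by purity, the two outer entropies into S_δ
  -- and S_{Yδ}, which A1 exchanges for those of β and Yβ. The mutual information of `Y` and `U \ β`
  -- given `β` is thereby at most 0.
  have h2 := S_strong_subadditivity W ψ hY hTU hYT
  rw [e1, e2, S_compl, S_compl] at h2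
  have e3 : β ∪ U \ β = U := Finset.union_sdiff_of_subset hβ
  have e4 : Y ∪ β ∪ U \ β = Y ∪ U := by rw [Finset.union_assoc, e3]
  have h3 := K_markov W ψ hYβ (Finset.disjoint_sdiff (s := β) (t := U))
    (hY.mono_right Finset.sdiff_subset) (by
      rw [e3, e4, Finset.union_comm Y β]; linarith)
  rw [e3, e4] at h3
  rw [sub_eq_sub_iff_add_eq_add, ← h3, add_comm]

end CellRegions

/-! ### Connectivity of cell regions and the hexagon around a bulk cell -/

section CellGraph

variable {n : ℕ}

/-- The cell of slice `x` at layer `r`, if there is one. -/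
def cellAt (n x r : ℕ) : Cell n :=
  if h : x < n + 2 ∧ r < 5 then some (⟨x, h.1⟩, ⟨r, h.2⟩) else none

theorem cellAt_eq {x r : ℕ} (hx : x < n + 2) (hr : r < 5) :
    cellAt n x r = some (⟨x, hx⟩, ⟨r, hr⟩) := dif_pos ⟨hx, hr⟩

theorem cellAt_inj {x r y q : ℕ} (hx : x < n + 2) (hr : r < 5) (hy : y < n + 2) (hq : q < 5) :
    cellAt n x r = cellAt n y q ↔ x = y ∧ r = q := by
  simp [cellAt_eq hx hr, cellAt_eq hy hq]

theorem cellAt_ne_none {x r : ℕ} (hx : x < n + 2) (hr : r < 5) : cellAt n x r ≠ none := by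
  simp [cellAt_eq hx hr]

theorem cell_cases (c : Cell n) : c = none ∨ ∃ x r, x < n + 2 ∧ r < 5 ∧ c = cellAt n x r := by
  rcases c with _ | ⟨x, r⟩
  · exact Or.inl rfl
  · exact Or.inr ⟨x, r, x.2, r.2, by rw [cellAt_eq x.2 r.2]⟩

/-- Adjacency of cells in coordinates. -/
def CoordAdj (x r y q : ℕ) : Prop :=
  (q = r ∧ y = x + 1) ∨ (q = r ∧ x = y + 1) ∨ (q = r + 1 ∧ (y = x ∨ y + 1 = x)) ∨
    (r = q + 1 ∧ (x = y ∨ x + 1 = y))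

theorem adj_cellAt {x r y q : ℕ} (hx : x < n + 2) (hr : r < 5) (hy : y < n + 2) (hq : q < 5) :
    (cellGraph n).Adj (cellAt n x r) (cellAt n y q) ↔ CoordAdj x r y q := by
  rw [cellGraph, SimpleGraph.fromRel_adj, ne_eq, cellAt_inj hx hr hy hq, cellAt_eq hx hr,
    cellAt_eq hy hq]
  simp only [borders, CoordAdj]
  omega

theorem adj_none_cellAt {x r : ℕ} (hx : x < n + 2) (hr : r < 5) :
    (cellGraph n).Adj (cellAt n x r) none ↔ x = 0 ∨ x = n + 1 ∨ r = 4 := by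
  rw [cellGraph, SimpleGraph.fromRel_adj, cellAt_eq hx hr]
  simp [borders]

/-- Two cells are linked in `s` if there is a path between them inside `s`. -/
def Linked (s : Set (Cell n)) (a b : Cell n) : Prop :=
  ∃ (ha : a ∈ s) (hb : b ∈ s), ((cellGraph n).induce s).Reachable ⟨a, ha⟩ ⟨b, hb⟩

theorem Linked.refl {s : Set (Cell n)} {a : Cell n} (ha : a ∈ s) : Linked s a a :=
  ⟨ha, ha, SimpleGraph.Reachable.refl _⟩

theorem Linked.symm {s : Set (Cell n)} {a b : Cell n} (h : Linked s a b) : Linked s b a :=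
  ⟨h.2.1, h.1, h.2.2.symm⟩

theorem Linked.trans {s : Set (Cell n)} {a b c : Cell n} (h : Linked s a b) (h' : Linked s b c) :
    Linked s a c :=
  ⟨h.1, h'.2.1, h.2.2.trans h'.2.2⟩

theorem Linked.of_adj {s : Set (Cell n)} {a b : Cell n} (ha : a ∈ s) (hb : b ∈ s)
    (h : (cellGraph n).Adj a b) : Linked s a b :=
  ⟨ha, hb, SimpleGraph.Adj.reachable (by simpa using h)⟩

theorem Linked.mono {s t : Set (Cell n)} (hst : s ⊆ t) {a b : Cell n} (h : Linked s a b) :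
    Linked t a b :=
  ⟨hst h.1, hst h.2.1, h.2.2.map (SimpleGraph.induceHomOfLE _ hst).toHom⟩

theorem connected_iff_linked {s : Set (Cell n)} :
    ((cellGraph n).induce s).Connected ↔ ∃ b ∈ s, ∀ a ∈ s, Linked s a b := by
  constructor
  · intro h
    obtain ⟨⟨b, hb⟩⟩ := h.nonempty
    exact ⟨b, hb, fun a ha => ⟨ha, hb, h.preconnected _ _⟩⟩
  · rintro ⟨b, hb, h⟩
    have : Nonempty s := ⟨⟨b, hb⟩⟩
    refine ⟨fun u v => ?_⟩
    obtain ⟨_, _, hu⟩ := h u u.2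
    obtain ⟨_, _, hv⟩ := h v v.2
    exact hu.trans hv.symm

theorem connected_insert {s : Set (Cell n)} {a b : Cell n}
    (hs : ((cellGraph n).induce s).Connected) (hb : b ∈ s) (hab : (cellGraph n).Adj a b) :
    ((cellGraph n).induce (insert a s)).Connected := by
  rw [connected_iff_linked] at hs ⊢
  obtain ⟨c, hc, h⟩ := hs
  have hsub : s ⊆ insert a s := Set.subset_insert a s
  refine ⟨c, hsub hc, fun e he => ?_⟩
  rcases he with rfl | he
  · exact (Linked.of_adj (Set.mem_insert _ _) (hsub hb) hab).trans ((h b hb).mono hsub)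
  · exact (h e he).mono hsub

theorem connected_singleton (a : Cell n) : ((cellGraph n).induce {a}).Connected :=
  connected_iff_linked.2 ⟨a, rfl, fun _ hb => hb ▸ Linked.refl rfl⟩

theorem linked_none_of_left {s : Set (Cell n)} (hnone : none ∈ s) {r : ℕ} (hr : r < 5) {x : ℕ}
    (hx : x < n + 2) (h : ∀ y ≤ x, cellAt n y r ∈ s) : Linked s (cellAt n x r) none := by
  induction x with
  | zero => exact Linked.of_adj (h 0 le_rfl) hnone ((adj_none_cellAt hx hr).2 (Or.inl rfl))
  | succ x ih =>
    refine (Linked.of_adj (h _ le_rfl) (h x (Nat.le_succ x)) ?_).trans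
      (ih (by omega) fun y hy => h y (by omega))
    rw [adj_cellAt hx hr (by omega) hr, CoordAdj]
    omega

theorem linked_none_of_right {s : Set (Cell n)} (hnone : none ∈ s) {r : ℕ} (hr : r < 5) {x : ℕ}
    (hx : x < n + 2) (h : ∀ y, x ≤ y → y < n + 2 → cellAt n y r ∈ s) :
    Linked s (cellAt n x r) none := by
  obtain ⟨k, hk⟩ : ∃ k, x + k = n + 1 := ⟨n + 1 - x, by omega⟩
  induction k generalizing x with
  | zero =>
    exact Linked.of_adj (h x le_rfl hx) hnone ((adj_none_cellAt hx hr).2 (Or.inr (Or.inl hk)))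
  | succ k ih =>
    refine (Linked.of_adj (h _ le_rfl hx) (h (x + 1) (Nat.le_succ x) (by omega)) ?_).trans
      (ih (by omega) (fun y hy => h y (by omega)) (by omega))
    rw [adj_cellAt hx hr (by omega) hr, CoordAdj]
    omega

/-- A set of cells containing `none` is connected if from each of its cells it contains all cells
of the same layer in one of the two angular directions. -/
theorem connected_of_rows {s : Set (Cell n)} (hnone : none ∈ s)
    (h : ∀ x r, x < n + 2 → r < 5 → cellAt n x r ∈ s →
      (∀ y ≤ x, cellAt n y r ∈ s) ∨ ∀ y, x ≤ y → y < n + 2 → cellAt n y r ∈ s) :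
    ((cellGraph n).induce s).Connected := by
  refine connected_iff_linked.2 ⟨none, hnone, fun a ha => ?_⟩
  rcases cell_cases a with rfl | ⟨x, r, hx, hr, rfl⟩
  · exact Linked.refl hnone
  · rcases h x r hx hr ha with h | h
    · exact linked_none_of_left hnone hr hx h
    · exact linked_none_of_right hnone hr hx h

/-- `c` is a cell whose neighbors, in cyclic order, are the six bulk cells `N k`. -/
structure Hexagon (c : Cell n) (N : Fin 6 → Cell n) : Prop where
  inj : Function.Injective N
  adj_center : ∀ k, (cellGraph n).Adj c (N k)
  adj_succ : ∀ k, (cellGraph n).Adj (N k) (N (k + 1))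
  of_adj : ∀ e, (cellGraph n).Adj c e → ∃ k, e = N k
  bulk_center : ∃ x : Fin (n + 2), ∃ r : Fin 5, c = some (x, r) ∧ 1 ≤ r.val
  bulk : ∀ k, ∃ x : Fin (n + 2), ∃ r : Fin 5, N k = some (x, r) ∧ 1 ≤ r.val
  outer : ∀ k, ∃ e, e ≠ c ∧ (∀ l, e ≠ N l) ∧ (cellGraph n).Adj (N k) e
  outside : ((cellGraph n).induce {e | e ≠ c ∧ ∀ l, e ≠ N l}).Connected

/-- The six neighbors of the cell `(x + 1, r + 2)` in cyclic order. -/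
def ring (n x r : ℕ) : Fin 6 → Cell n :=
  ![cellAt n x (r + 2), cellAt n x (r + 3), cellAt n (x + 1) (r + 3), cellAt n (x + 2) (r + 2),
    cellAt n (x + 2) (r + 1), cellAt n (x + 1) (r + 1)]

/-- The angular coordinates of the neighbors. -/
def ringX (x : ℕ) : Fin 6 → ℕ := ![x, x, x + 1, x + 2, x + 2, x + 1]

/-- The radial coordinates of the neighbors. -/
def ringR (r : ℕ) : Fin 6 → ℕ := ![r + 2, r + 3, r + 3, r + 2, r + 1, r + 1]

theorem ring_eq (x r : ℕ) (k : Fin 6) : ring n x r k = cellAt n (ringX x k) (ringR r k) := by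
  fin_cases k <;> rfl

theorem ringX_lt {x : ℕ} (hx : x < n) (k : Fin 6) : ringX x k < n + 2 := by
  fin_cases k <;> simp [ringX] <;> omega

theorem ringR_lt {r : ℕ} (hr : r < 2) (k : Fin 6) : ringR r k < 5 := by
  fin_cases k <;> simp [ringR] <;> omega

/-- The coordinates of the cells of the hexagon around `(x + 1, r + 2)`. -/
def InStar (x r y q : ℕ) : Prop :=
  (q = r + 3 ∧ (y = x ∨ y = x + 1)) ∨ (q = r + 2 ∧ (y = x ∨ y = x + 1 ∨ y = x + 2)) ∨
    (q = r + 1 ∧ (y = x + 1 ∨ y = x + 2))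

theorem mem_star_iff {x r : ℕ} (hx : x < n) (hr : r < 2) {y q : ℕ} (hy : y < n + 2) (hq : q < 5) :
    (cellAt n y q ≠ cellAt n (x + 1) (r + 2) ∧ ∀ l, cellAt n y q ≠ ring n x r l) ↔
      ¬ InStar x r y q := by
  rw [ne_eq, cellAt_inj hy hq (by omega) (by omega)]
  simp only [ring_eq, ne_eq, cellAt_inj hy hq (ringX_lt hx _) (ringR_lt hr _)]
  constructor
  · rintro ⟨h0, h⟩
    have h0' := h 0
    have h1 := h 1
    have h2 := h 2
    have h3 := h 3
    have h4 := h 4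
    have h5 := h 5
    simp [ringX, ringR] at h0' h1 h2 h3 h4 h5
    unfold InStar
    omega
  · intro h
    unfold InStar at h
    refine ⟨by omega, fun l => ?_⟩
    fin_cases l <;> simp [ringX, ringR] <;> omega

/-- The centers are the cells of layers 2 and 3 in the slices 1, …, n: those whose six neighbors all
exist and keep away from layer 0. -/
theorem hexagon_ring {x r : ℕ} (hx : x < n) (hr : r < 2) :
    Hexagon (cellAt n (x + 1) (r + 2)) (ring n x r) where
  inj k l h := by
    rw [ring_eq, ring_eq, cellAt_inj (ringX_lt hx _) (ringR_lt hr _) (ringX_lt hx _)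
      (ringR_lt hr _)] at h
    revert h
    fin_cases k <;> fin_cases l <;> simp [ringX, ringR]
  adj_center k := by
    rw [ring_eq, adj_cellAt (by omega) (by omega) (ringX_lt hx _) (ringR_lt hr _)]
    fin_cases k <;> simp [ringX, ringR, CoordAdj]
  adj_succ k := by
    rw [ring_eq, ring_eq, adj_cellAt (ringX_lt hx _) (ringR_lt hr _) (ringX_lt hx _)
      (ringR_lt hr _)]
    fin_cases k <;> simp [ringX, ringR, CoordAdj]
  of_adj e he := by
    by_contra hne
    push Not at hne
    rcases cell_cases e with rfl | ⟨y, q, hy, hq, rfl⟩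
    · rw [adj_none_cellAt (by omega) (by omega)] at he
      omega
    · have hs := (mem_star_iff hx hr hy hq).1 ⟨he.ne', hne⟩
      rw [adj_cellAt (by omega) (by omega) hy hq, CoordAdj] at he
      unfold InStar at hs
      omega
  bulk_center := ⟨⟨x + 1, by omega⟩, ⟨r + 2, by omega⟩, cellAt_eq _ _, by simp⟩
  bulk k := ⟨⟨ringX x k, ringX_lt hx k⟩, ⟨ringR r k, ringR_lt hr k⟩, by
    rw [ring_eq]; exact cellAt_eq _ _, by fin_cases k <;> simp [ringR]⟩
  outer k := by
    have key : ∀ y q, y < n + 2 → q < 5 → CoordAdj (ringX x k) (ringR r k) y q →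
        ¬ InStar x r y q → ∃ e, e ≠ cellAt n (x + 1) (r + 2) ∧ (∀ l, e ≠ ring n x r l) ∧
          (cellGraph n).Adj (ring n x r k) e := by
      intro y q hy hq h1 h2
      obtain ⟨h3, h4⟩ := (mem_star_iff hx hr hy hq).2 h2
      refine ⟨_, h3, h4, ?_⟩
      rw [ring_eq, adj_cellAt (ringX_lt hx _) (ringR_lt hr _) hy hq]
      exact h1
    have key' : (ringX x k = 0 ∨ ringX x k = n + 1 ∨ ringR r k = 4) →
        ∃ e, e ≠ cellAt n (x + 1) (r + 2) ∧ (∀ l, e ≠ ring n x r l) ∧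
          (cellGraph n).Adj (ring n x r k) e := by
      intro h
      refine ⟨none, (cellAt_ne_none (by omega) (by omega)).symm, fun l => ?_, ?_⟩
      · rw [ring_eq]; exact (cellAt_ne_none (ringX_lt hx _) (ringR_lt hr _)).symm
      · rw [ring_eq, adj_none_cellAt (ringX_lt hx _) (ringR_lt hr _)]; exact h
    by_cases h4 : ringR r k = 4
    · exact key' (Or.inr (Or.inr h4))
    -- In slice 0 the two left neighbors border `none`, as does every cell of layer 4; in the other
    -- cases an explicit cell outside the hexagon is exhibited.
    by_cases hx0 : x = 0 ∧ (k = 0 ∨ k = 1)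
    · refine key' (Or.inl ?_)
      obtain ⟨rfl, rfl | rfl⟩ := hx0 <;> rfl
    fin_cases k
    · have : x ≠ 0 := by simpa using hx0
      refine key (x - 1) (r + 2) (by omega) (by omega) ?_ ?_ <;>
        simp [ringX, ringR, CoordAdj, InStar] <;> omega
    · have : r + 3 ≠ 4 := h4
      refine key x (r + 4) (by omega) (by omega) ?_ ?_ <;>
        simp [ringX, ringR, CoordAdj, InStar]
    · have : r + 3 ≠ 4 := h4
      refine key x (r + 4) (by omega) (by omega) ?_ ?_ <;>
        simp [ringX, ringR, CoordAdj, InStar]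
    · refine key (x + 2) (r + 3) (by omega) (by omega) ?_ ?_ <;>
        simp [ringX, ringR, CoordAdj, InStar]
    · refine key (x + 2) r (by omega) (by omega) ?_ ?_ <;>
        simp [ringX, ringR, CoordAdj, InStar]
    · refine key (x + 1) r (by omega) (by omega) ?_ ?_ <;>
        simp [ringX, ringR, CoordAdj, InStar]
  outside := by
    refine connected_of_rows ⟨(cellAt_ne_none (by omega) (by omega)).symm, fun l => ?_⟩ ?_
    · rw [ring_eq]; exact (cellAt_ne_none (ringX_lt hx _) (ringR_lt hr _)).symm
    · intro y q hy hq h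
      have h' := (mem_star_iff hx hr hy hq).1 h
      by_cases hyx : y ≤ x
      · refine Or.inl fun z hz => (mem_star_iff hx hr (by omega) hq).2 ?_
        unfold InStar at h' ⊢
        omega
      · refine Or.inr fun z hz hz' => (mem_star_iff hx hr hz' hq).2 ?_
        unfold InStar at h' ⊢
        omega

end CellGraph

/-! ### A1 partitions formed by complementary arcs of a hexagon -/

section Arcs

variable {n : ℕ} {c : Cell n} {N : Fin 6 → Cell n}

/-- The arc of `l` consecutive positions on a hexagon, starting at `k`. -/
def arc (k : Fin 6) : ℕ → Finset (Fin 6)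
  | 0 => ∅
  | l + 1 => insert (k + Fin.ofNat 6 l) (arc k l)

/-- A nonempty proper set of consecutive positions on a hexagon. -/
def IsArc (J : Finset (Fin 6)) : Prop := ∃ k : Fin 6, ∃ l : Fin 5, J = arc k (l + 1)

instance (J : Finset (Fin 6)) : Decidable (IsArc J) := by unfold IsArc; infer_instance

theorem IsArc.compl {J : Finset (Fin 6)} (hJ : IsArc J) : IsArc Jᶜ := by
  obtain ⟨k, l, rfl⟩ := hJ
  revert k l
  decide

theorem IsArc.nonempty {J : Finset (Fin 6)} (hJ : IsArc J) : J.Nonempty := by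
  obtain ⟨k, l, rfl⟩ := hJ
  exact ⟨_, Finset.mem_insert_self _ _⟩

theorem Hexagon.connected_arc (h : Hexagon c N) (k : Fin 6) (l : ℕ) :
    ((cellGraph n).induce (N '' (arc k (l + 1) : Set (Fin 6)))).Connected := by
  induction l with
  | zero =>
    have : N '' (arc k (0 + 1) : Set (Fin 6)) = {N k} := by simp [arc]
    rw [this]
    exact connected_singleton _
  | succ l ih =>
    have hk : k + Fin.ofNat 6 (l + 1) = k + Fin.ofNat 6 l + 1 := by
      rw [add_assoc]
      congr 1
      ext
      simp [Fin.val_add]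
    have e : N '' (arc k (l + 1 + 1) : Set (Fin 6)) =
        insert (N (k + Fin.ofNat 6 l + 1)) (N '' (arc k (l + 1) : Set (Fin 6))) := by
      rw [arc, Finset.coe_insert, Set.image_insert_eq, hk]
    rw [e]
    exact connected_insert ih (Set.mem_image_of_mem N (Finset.mem_insert_self _ _))
      (h.adj_succ _).symm

theorem Hexagon.connected_image (h : Hexagon c N) {J : Finset (Fin 6)} (hJ : IsArc J) :
    ((cellGraph n).induce (N '' (J : Set (Fin 6)))).Connected := by
  obtain ⟨k, l, rfl⟩ := hJ
  exact h.connected_arc k l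

theorem Hexagon.connected_insert_image (h : Hexagon c N) {J : Finset (Fin 6)} (hJ : IsArc J) :
    ((cellGraph n).induce (insert c (N '' (J : Set (Fin 6))))).Connected := by
  obtain ⟨k, hk⟩ := hJ.nonempty
  exact connected_insert (h.connected_image hJ) (Set.mem_image_of_mem N hk) (h.adj_center k)

theorem Hexagon.connected_star (h : Hexagon c N) :
    ((cellGraph n).induce (insert c (Set.range N))).Connected := by
  have : Set.range N = N '' (arc 0 6 : Set (Fin 6)) := by
    rw [← Set.image_univ, show arc 0 6 = Finset.univ by decide, Finset.coe_univ]
  rw [this]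
  exact connected_insert (h.connected_arc 0 5) (Set.mem_image_of_mem N
    (show (0 : Fin 6) ∈ arc 0 6 by decide)) (h.adj_center 0)

/-- Every ring cell touches the connected outside, so the center is the only cell that could be
isolated, and `hc` excludes that. -/
theorem Hexagon.connected_of_outside_subset (h : Hexagon c N) {s : Set (Cell n)}
    (hs : {e | e ≠ c ∧ ∀ l, e ≠ N l} ⊆ s) (hc : c ∈ s → ∃ k, N k ∈ s) :
    ((cellGraph n).induce s).Connected := by
  obtain ⟨b, hb, hconn⟩ := connected_iff_linked.1 h.outside
  refine connected_iff_linked.2 ⟨b, hs hb, ?_⟩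
  have hN : ∀ k, N k ∈ s → Linked s (N k) b := by
    intro k hk
    obtain ⟨e, he, he', hadj⟩ := h.outer k
    exact (Linked.of_adj hk (hs ⟨he, he'⟩) hadj).trans ((hconn e ⟨he, he'⟩).mono hs)
  intro a ha
  by_cases hac : a = c
  · subst hac
    obtain ⟨k, hk⟩ := hc ha
    exact (Linked.of_adj ha hk (h.adj_center k)).trans (hN k hk)
  by_cases hk : ∃ k, a = N k
  · obtain ⟨k, rfl⟩ := hk
    exact hN k ha
  · push Not at hk
    exact (hconn a ⟨hac, hk⟩).mono hs

theorem Hexagon.center_ne (h : Hexagon c N) (k : Fin 6) : c ≠ N k := (h.adj_center k).ne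

/-- Complementary arcs cut the annulus around one cell radially, so A1 is available for every way in
which a region can meet the ring in an arc. -/
theorem Hexagon.a1Partition (h : Hexagon c N) {J : Finset (Fin 6)} (hJ : IsArc J) :
    A1Partition (J.image N) {c} (Jᶜ.image N) := by
  have hall : J.image N ∪ {c} ∪ Jᶜ.image N = insert c (Finset.univ.image N) := by
    ext e
    simp only [Finset.mem_union, Finset.mem_image, Finset.mem_singleton, Finset.mem_compl,
      Finset.mem_insert, Finset.mem_univ, true_and]
    constructor
    · rintro ((⟨k, _, hk⟩ | rfl) | ⟨k, _, hk⟩)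
      · exact Or.inr ⟨k, hk⟩
      · exact Or.inl rfl
      · exact Or.inr ⟨k, hk⟩
    · rintro (rfl | ⟨k, hk⟩)
      · exact Or.inl (Or.inr rfl)
      · by_cases hkJ : k ∈ J
        · exact Or.inl (Or.inl ⟨k, hkJ, hk⟩)
        · exact Or.inr ⟨k, hkJ, hk⟩
  have himg : ∀ {L : Finset (Fin 6)}, IsArc L → DiskLike (L.image N) := by
    intro L hL
    obtain ⟨k, hk⟩ := hL.compl.nonempty
    refine ⟨by rw [Finset.coe_image]; exact h.connected_image hL,
      h.connected_of_outside_subset ?_ fun _ => ⟨k, ?_⟩⟩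
    · rintro e ⟨_, he⟩
      simp only [Finset.coe_image, Set.mem_compl_iff, Set.mem_image, not_exists, not_and]
      exact fun l _ hl => he l hl.symm
    · simp only [Finset.coe_image, Set.mem_compl_iff, Set.mem_image, not_exists, not_and]
      intro l hl hlk
      rw [h.inj hlk] at hl
      exact (Finset.mem_compl.1 hk) hl
  have hins : ∀ {L : Finset (Fin 6)}, IsArc L → DiskLike (insert c (L.image N)) := by
    intro L hL
    refine ⟨by rw [Finset.coe_insert, Finset.coe_image]; exact h.connected_insert_image hL,
      h.connected_of_outside_subset ?_ fun hc => (hc (by simp)).elim⟩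
    rintro e ⟨hec, he⟩
    simp only [Finset.coe_insert, Finset.coe_image, Set.mem_compl_iff, Set.mem_insert_iff,
      Set.mem_image, not_or, not_exists, not_and]
    exact ⟨hec, fun l _ hl => he l hl.symm⟩
  refine ⟨?_, ?_, ?_, ?_, ?_, himg hJ, himg hJ.compl, ?_, ?_, ?_, ?_⟩
  · rw [hall]
    intro e he
    simp only [Finset.mem_insert, Finset.mem_image, Finset.mem_univ, true_and] at he
    rcases he with rfl | ⟨k, rfl⟩
    · exact h.bulk_center
    · exact h.bulk k
  · rw [Finset.disjoint_singleton_right, Finset.mem_image]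
    rintro ⟨k, _, hk⟩
    exact h.center_ne k hk.symm
  · rw [Finset.disjoint_singleton_left, Finset.mem_image]
    rintro ⟨k, _, hk⟩
    exact h.center_ne k hk.symm
  · exact (Finset.disjoint_image h.inj).2 disjoint_compl_right
  · refine ⟨by rw [Finset.coe_singleton]; exact connected_singleton c,
      h.connected_of_outside_subset ?_ fun hc => (hc (by simp)).elim⟩
    rintro e ⟨hec, _⟩
    simpa using hec
  · rw [Finset.union_comm, ← Finset.insert_eq]
    exact hins hJ
  · rw [← Finset.insert_eq]
    exact hins hJ.compl
  · rw [hall]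
    refine ⟨by
      rw [Finset.coe_insert, Finset.coe_image, Finset.coe_univ, Set.image_univ]
      exact h.connected_star,
      h.connected_of_outside_subset ?_ fun hc => (hc (by simp)).elim⟩
    rintro e ⟨hec, he⟩
    simp only [Finset.coe_insert, Finset.coe_image, Finset.coe_univ, Set.image_univ,
      Set.mem_compl_iff, Set.mem_insert_iff, Set.mem_range, not_or, not_exists]
    exact ⟨hec, fun l hl => he l hl.symm⟩
  · rw [hall]
    intro e he f hf hadj
    rw [Finset.mem_singleton] at he
    subst he
    obtain ⟨k, rfl⟩ := h.of_adj f hadj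
    exact hf (by simp)

end Arcs

/-! ### Adding one cell: dependence on its neighbors and the slide identity -/

section Slide

variable {W : PolarLattice} {ψ : W.H}

/-- The change of `K_U ψ` under adding the cell `c` to `U`. -/
def KDiff (W : PolarLattice) (ψ : W.H) (c : Cell W.n) (U : Finset (Cell W.n)) : W.H :=
  K W ψ (insert c U) - K W ψ U

/-- `U` contains exactly the neighbors of `c` at the positions `J`, and not `c` itself. -/
def Pattern {n : ℕ} (c : Cell n) (N : Fin 6 → Cell n) (U : Finset (Cell n))
    (J : Finset (Fin 6)) : Prop :=
  c ∉ U ∧ ∀ k, N k ∈ U ↔ k ∈ J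

variable {c c' : Cell W.n} {N N' : Fin 6 → Cell W.n}

theorem Hexagon.pattern_image (h : Hexagon c N) (J : Finset (Fin 6)) :
    Pattern c N (J.image N) J := by
  refine ⟨fun hc => ?_, fun k => ?_⟩
  · obtain ⟨k, _, hk⟩ := Finset.mem_image.1 hc
    exact h.center_ne k hk.symm
  · exact h.inj.mem_finset_image

/-- `K_local` with the occupied arc as β and the empty arc as δ: everything farther away drops out.
-/
theorem KDiff_eq_image (hA1 : AxiomA1 W ψ) (h : Hexagon c N) {J : Finset (Fin 6)} (hJ : IsArc J)
    {U : Finset (Cell W.n)} (hU : Pattern c N U J) :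
    KDiff W ψ c U = KDiff W ψ c (J.image N) := by
  have := K_local W hA1 (h.a1Partition hJ) (U := U) ?_ ?_ ?_
  · rwa [← Finset.insert_eq, ← Finset.insert_eq] at this
  · intro e he
    obtain ⟨k, hk, rfl⟩ := Finset.mem_image.1 he
    exact (hU.2 k).2 hk
  · exact Finset.disjoint_singleton_left.2 hU.1
  · rw [Finset.disjoint_left]
    intro e he heU
    obtain ⟨k, hk, rfl⟩ := Finset.mem_image.1 he
    exact (Finset.mem_compl.1 hk) ((hU.2 k).1 heU)

theorem KDiff_eq_of_pattern (hA1 : AxiomA1 W ψ) (h : Hexagon c N) {J : Finset (Fin 6)}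
    (hJ : IsArc J) {U V : Finset (Cell W.n)} (hU : Pattern c N U J) (hV : Pattern c N V J) :
    KDiff W ψ c U = KDiff W ψ c V := by
  rw [KDiff_eq_image hA1 h hJ hU, KDiff_eq_image hA1 h hJ hV]

/-- By purity, adding `c` to one region is removing it from the complementary one. -/
theorem KDiff_compl {U : Finset (Cell W.n)} (hc : c ∉ U) :
    KDiff W ψ c (insert c U)ᶜ = -KDiff W ψ c U := by
  have : insert c (insert c U)ᶜ = Uᶜ := by
    ext e
    simp only [Finset.mem_insert, Finset.mem_compl]
    by_cases he : e = c
    · simp [he, hc]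
    · simp [he]
  rw [KDiff, this, K_compl, K_compl, KDiff]
  abel

theorem KDiff_image_compl (hA1 : AxiomA1 W ψ) (h : Hexagon c N) {J : Finset (Fin 6)}
    (hJ : IsArc J) : KDiff W ψ c (Jᶜ.image N) = -KDiff W ψ c (J.image N) := by
  have hp := h.pattern_image J
  rw [← KDiff_compl hp.1]
  refine (KDiff_eq_image hA1 h hJ.compl ⟨by simp, fun k => ?_⟩).symm
  rw [Finset.mem_compl, Finset.mem_insert, Finset.mem_compl, hp.2 k]
  simp [(h.center_ne k).symm]

/-- The mutual information between a cell `c` and its neighbor `N k`, conditioned on the neighbors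
of `c` on one side of `N k` or on those on the other side, is the same. -/
theorem KDiff_slide (hA1 : AxiomA1 W ψ) (h : Hexagon c N) {k : Fin 6} (h' : Hexagon (N k) N')
    {J L : Finset (Fin 6)} (hkJ : k ∉ J) (hkL : k ∉ L)
    (hJ : IsArc J) (hJk : IsArc (insert k J)) (hL : IsArc L) (hLk : IsArc (insert k L))
    {P Q : Finset (Fin 6)} (hP : IsArc P) (hQ : IsArc Q)
    (hPL : ∀ m, N' m ∈ L.image N ↔ m ∈ P)
    (hPJ : ∀ m, N' m ∈ (insert k J)ᶜ.image N ↔ m ∈ P)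
    (hQc : ∀ m, N' m = c ∨ m ∈ P ↔ m ∈ Q) {U₁ U₂ V₁ V₂ : Finset (Cell W.n)}
    (hU₁ : Pattern c N U₁ J) (hU₂ : Pattern c N U₂ (insert k J)) (hV₁ : Pattern c N V₁ L)
    (hV₂ : Pattern c N V₂ (insert k L)) :
    KDiff W ψ c U₁ - KDiff W ψ c U₂ = KDiff W ψ c V₁ - KDiff W ψ c V₂ := by
  rw [KDiff_eq_image hA1 h hJ hU₁, KDiff_eq_image hA1 h hJk hU₂, KDiff_eq_image hA1 h hL hV₁,
    KDiff_eq_image hA1 h hLk hV₂]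
  -- Purity replaces conditioning on `J` by conditioning on the neighbors on the other side, the
  -- complement of `insert k J`.
  have e1 := KDiff_image_compl hA1 h hJ
  have e2 := KDiff_image_compl hA1 h hJk
  have hcompl : Jᶜ = insert k (insert k J)ᶜ := by
    ext m
    by_cases hm : m = k
    · simp [hm, hkJ]
    · simp [hm]
  rw [hcompl] at e1
  set O := (insert k J)ᶜ
  have hkO : k ∉ O := by simp [O]
  have hmem : ∀ {T : Finset (Fin 6)}, k ∉ T → N k ∉ T.image N := fun hT hk =>
    hT (h.inj.mem_finset_image.1 hk)
  have hpat : ∀ {T : Finset (Fin 6)}, k ∉ T → (∀ m, N' m ∈ T.image N ↔ m ∈ P) →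
      KDiff W ψ (N k) (T.image N) = KDiff W ψ (N k) (P.image N') ∧
      KDiff W ψ (N k) (insert c (T.image N)) = KDiff W ψ (N k) (Q.image N') := by
    intro T hkT hT
    refine ⟨KDiff_eq_image hA1 h' hP ⟨hmem hkT, hT⟩, KDiff_eq_image hA1 h' hQ ⟨?_, fun m => ?_⟩⟩
    · rw [Finset.mem_insert, not_or]
      exact ⟨(h.center_ne k).symm, hmem hkT⟩
    · rw [Finset.mem_insert, hT, hQc]
  -- The mixed second difference is symmetric in `c` and `N k`. Seen from the hexagon of `N k`, the
  -- two conditioning sets leave the same pattern `P`, or `Q` once `c` is added, so their second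
  -- differences agree.
  have swap : ∀ T : Finset (Fin 6), KDiff W ψ c ((insert k T).image N) - KDiff W ψ c (T.image N) =
      KDiff W ψ (N k) (insert c (T.image N)) - KDiff W ψ (N k) (T.image N) := by
    intro T
    simp only [KDiff, Finset.image_insert]
    rw [Finset.insert_comm]
    abel
  have s1 := swap O
  have s2 := swap L
  rw [(hpat hkO hPJ).1, (hpat hkO hPJ).2] at s1
  rw [(hpat hkL hPL).1, (hpat hkL hPL).2] at s2
  have s3 := s1.trans s2.symm
  rw [e1, e2] at s3
  rw [← neg_inj, neg_sub, neg_sub, ← s3]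
  abel

end Slide

/-! ### Sectors with outer blocks; independence of Δ̂ψ from the outer regions -/

section SectorRelations

/-- The sector on the slices `[i, j)` together with the cells `[s, t)` of layer `3`. -/
def sectorBlocks (n i j s t : ℕ) : Finset (Cell n) := sector n i j ∪ blocks n s t

theorem none_notMem_sectorBlocks {n i j s t : ℕ} : none ∉ sectorBlocks n i j s t := by
  simp [sectorBlocks, sector, blocks]

theorem mem_sectorBlocks {n i j s t y q : ℕ} (hy : y < n + 2) (hq : q < 5) :
    cellAt n y q ∈ sectorBlocks n i j s t ↔
      (i ≤ y ∧ y < j ∧ q ≤ 2) ∨ (s ≤ y ∧ y < t ∧ q = 3) := by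
  simp [cellAt_eq hy hq, sectorBlocks, sector, blocks, Fin.ext_iff, Fin.exists_iff]
  tauto

theorem finset_cell_ext {n : ℕ} {X Y : Finset (Cell n)} (h₀ : none ∉ X) (h₀' : none ∉ Y)
    (h : ∀ y q, y < n + 2 → q < 5 → (cellAt n y q ∈ X ↔ cellAt n y q ∈ Y)) : X = Y := by
  ext c
  rcases cell_cases c with rfl | ⟨y, q, hy, hq, rfl⟩
  · simp [h₀, h₀']
  · exact h y q hy hq

theorem sectorBlocks_self (n i j s : ℕ) : sectorBlocks n i j s s = sector n i j := by
  have : blocks n s s = ∅ := by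
    ext c
    simp only [blocks, Finset.mem_filter, Finset.mem_univ, true_and, Finset.notMem_empty,
      iff_false]
    rintro ⟨x, r, _, h1, h2, _⟩
    omega
  rw [sectorBlocks, this, Finset.union_empty]

theorem insert_sectorBlocks_right {n i j s y : ℕ} (hsy : s ≤ y) (hy : y < n + 2) :
    insert (cellAt n y 3) (sectorBlocks n i j s y) = sectorBlocks n i j s (y + 1) := by
  refine finset_cell_ext ?_ none_notMem_sectorBlocks fun z q hz hq => ?_
  · rw [Finset.mem_insert, not_or]
    exact ⟨(cellAt_ne_none hy (by omega)).symm, none_notMem_sectorBlocks⟩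
  · rw [Finset.mem_insert, mem_sectorBlocks hz hq, mem_sectorBlocks hz hq,
      cellAt_inj hz hq hy (by omega)]
    omega

theorem insert_sectorBlocks_left {n i j t y : ℕ} (hyt : y < t) (hy : y < n + 2) :
    insert (cellAt n y 3) (sectorBlocks n i j (y + 1) t) = sectorBlocks n i j y t := by
  refine finset_cell_ext ?_ none_notMem_sectorBlocks fun z q hz hq => ?_
  · rw [Finset.mem_insert, not_or]
    exact ⟨(cellAt_ne_none hy (by omega)).symm, none_notMem_sectorBlocks⟩
  · rw [Finset.mem_insert, mem_sectorBlocks hz hq, mem_sectorBlocks hz hq,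
      cellAt_inj hz hq hy (by omega)]
    omega

/-- The pattern of a sector with blocks around a cell of layer `3`. -/
theorem pattern_sectorBlocks {n i j s t x : ℕ} (hx : x < n) {J : Finset (Fin 6)}
    (hc : ¬ (s ≤ x + 1 ∧ x + 1 < t)) (h0 : 0 ∈ J ↔ s ≤ x ∧ x < t) (h1 : 1 ∉ J) (h2 : 2 ∉ J)
    (h3 : 3 ∈ J ↔ s ≤ x + 2 ∧ x + 2 < t) (h4 : 4 ∈ J ↔ i ≤ x + 2 ∧ x + 2 < j)
    (h5 : 5 ∈ J ↔ i ≤ x + 1 ∧ x + 1 < j) :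
    Pattern (cellAt n (x + 1) 3) (ring n x 1) (sectorBlocks n i j s t) J := by
  refine ⟨fun h => ?_, fun k => ?_⟩
  · rw [mem_sectorBlocks (by omega) (by omega)] at h
    omega
  · rw [ring_eq, mem_sectorBlocks (ringX_lt hx k) (ringR_lt (by omega) k)]
    fin_cases k
    · simp [ringX, ringR, h0]
    · simp [ringX, ringR, h1]
    · simp [ringX, ringR, h2]
    · simp [ringX, ringR, h3]
    · simp [ringX, ringR, h4]
    · simp [ringX, ringR, h5]

theorem ring_mem_image_ring {n x r x' r' : ℕ} (hx : x < n) (hr : r < 2) (hx' : x' < n)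
    (hr' : r' < 2) (m : Fin 6) (L : Finset (Fin 6)) :
    ring n x r m ∈ L.image (ring n x' r') ↔
      ∃ l ∈ L, ringX x' l = ringX x m ∧ ringR r' l = ringR r m := by
  simp only [Finset.mem_image, ring_eq, cellAt_inj (ringX_lt hx' _) (ringR_lt hr' _)
    (ringX_lt hx _) (ringR_lt hr _)]

variable (W : PolarLattice) (ψ : W.H)

/-- `K_X ψ` for a sector with blocks. -/
def KSB (i j s t : ℕ) : W.H := K W ψ (sectorBlocks W.n i j s t)

/-- The change of `K_U ψ` under adding the cell `(y, 3)`. -/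
def KD (y i j s t : ℕ) : W.H := KDiff W ψ (cellAt W.n y 3) (sectorBlocks W.n i j s t)

variable {W ψ}

theorem KSB_add_right {i j s y : ℕ} (hsy : s ≤ y) (hy : y < W.n + 2) :
    KSB W ψ i j s (y + 1) - KSB W ψ i j s y = KD W ψ y i j s y := by
  rw [KD, KDiff, insert_sectorBlocks_right hsy hy, KSB, KSB]

theorem KSB_add_left {i j t y : ℕ} (hyt : y < t) (hy : y < W.n + 2) :
    KSB W ψ i j y t - KSB W ψ i j (y + 1) t = KD W ψ y i j (y + 1) t := by
  rw [KD, KDiff, insert_sectorBlocks_left hyt hy, KSB, KSB]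

theorem KSB_self (i j s : ℕ) : KSB W ψ i j s s = K W ψ (sector W.n i j) := by
  rw [KSB, sectorBlocks_self]

theorem KD_eq (hA1 : AxiomA1 W ψ) {x i j s t i' j' s' t' : ℕ} (hx : x < W.n) (J : Finset (Fin 6))
    (hJ : IsArc J)
    (hU : Pattern (cellAt W.n (x + 1) 3) (ring W.n x 1) (sectorBlocks W.n i j s t) J)
    (hV : Pattern (cellAt W.n (x + 1) 3) (ring W.n x 1) (sectorBlocks W.n i' j' s' t') J) :
    KD W ψ (x + 1) i j s t = KD W ψ (x + 1) i' j' s' t' :=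
  KDiff_eq_of_pattern hA1 (hexagon_ring hx (by omega)) hJ hU hV

/-- Sliding past the cell below on the right, the left side being `J`. -/
theorem KDiff_slide_right (hA1 : AxiomA1 W ψ) {x : ℕ} (hx : x + 1 < W.n) {J : Finset (Fin 6)}
    (hJ : J = {5} ∨ J = {0, 5}) {U₁ U₂ V₁ V₂ : Finset (Cell W.n)}
    (hU₁ : Pattern (cellAt W.n (x + 1) 3) (ring W.n x 1) U₁ J)
    (hU₂ : Pattern (cellAt W.n (x + 1) 3) (ring W.n x 1) U₂ (insert 4 J))
    (hV₁ : Pattern (cellAt W.n (x + 1) 3) (ring W.n x 1) V₁ {3})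
    (hV₂ : Pattern (cellAt W.n (x + 1) 3) (ring W.n x 1) V₂ {4, 3}) :
    KDiff W ψ (cellAt W.n (x + 1) 3) U₁ - KDiff W ψ (cellAt W.n (x + 1) 3) U₂ =
      KDiff W ψ (cellAt W.n (x + 1) 3) V₁ - KDiff W ψ (cellAt W.n (x + 1) 3) V₂ := by
  have h := hexagon_ring (n := W.n) (x := x) (r := 1) (by omega) (by omega)
  have h' : Hexagon (ring W.n x 1 4) (ring W.n (x + 1) 0) := hexagon_ring hx (by omega)
  have hk : (4 : Fin 6) ∉ J := by rcases hJ with rfl | rfl <;> decide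
  have a1 : IsArc J := by rcases hJ with rfl | rfl <;> decide
  have a2 : IsArc (insert 4 J) := by rcases hJ with rfl | rfl <;> decide
  -- Seen from the cell at position 4, the center sits at position 1 and the center's neighbor 3 at
  -- position 2. Neighbor 3 is the only cell of either conditioning set that it touches, hence `P`
  -- and `Q`.
  refine KDiff_slide hA1 h h' hk (by decide) a1 a2 (by decide) (by decide) (P := {2})
    (Q := {1, 2}) (by decide) (by decide) (fun m => ?_) (fun m => ?_) (fun m => ?_) hU₁ hU₂ hV₁ hV₂
  · rw [ring_mem_image_ring hx (by omega) (by omega) (by omega)]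
    fin_cases m <;> simp [ringX, ringR]
  · rw [ring_mem_image_ring hx (by omega) (by omega) (by omega)]
    have : (insert 4 J)ᶜ = {0, 1, 2, 3} ∨ (insert 4 J)ᶜ = {1, 2, 3} := by
      rcases hJ with rfl | rfl
      · exact Or.inl (by decide)
      · exact Or.inr (by decide)
    rcases this with e | e <;> rw [e] <;> fin_cases m <;> simp [ringX, ringR]
  · rw [ring_eq, cellAt_inj (ringX_lt hx _) (ringR_lt (by omega) _) (by omega) (by omega)]
    fin_cases m <;> simp [ringX, ringR]

/-- Sliding past the cell below on the left. -/
theorem KDiff_slide_left (hA1 : AxiomA1 W ψ) {x : ℕ} (hx : x < W.n)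
    {U₁ U₂ V₁ V₂ : Finset (Cell W.n)}
    (hU₁ : Pattern (cellAt W.n (x + 1) 3) (ring W.n x 1) U₁ {0})
    (hU₂ : Pattern (cellAt W.n (x + 1) 3) (ring W.n x 1) U₂ {5, 0})
    (hV₁ : Pattern (cellAt W.n (x + 1) 3) (ring W.n x 1) V₁ {3, 4})
    (hV₂ : Pattern (cellAt W.n (x + 1) 3) (ring W.n x 1) V₂ {5, 3, 4}) :
    KDiff W ψ (cellAt W.n (x + 1) 3) U₁ - KDiff W ψ (cellAt W.n (x + 1) 3) U₂ =
      KDiff W ψ (cellAt W.n (x + 1) 3) V₁ - KDiff W ψ (cellAt W.n (x + 1) 3) V₂ := by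
  have h := hexagon_ring (n := W.n) (x := x) (r := 1) hx (by omega)
  have h' : Hexagon (ring W.n x 1 5) (ring W.n x 0) := hexagon_ring hx (by omega)
  refine KDiff_slide hA1 h h' (by decide) (by decide) (by decide) (by decide) (by decide)
    (by decide) (P := {3}) (Q := {2, 3}) (by decide) (by decide) (fun m => ?_) (fun m => ?_)
    (fun m => ?_) hU₁ hU₂ hV₁ hV₂
  · rw [ring_mem_image_ring hx (by omega) (by omega) (by omega)]
    fin_cases m <;> simp [ringX, ringR]
  · rw [ring_mem_image_ring hx (by omega) (by omega) (by omega),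
      show (insert 5 {0} : Finset (Fin 6))ᶜ = {1, 2, 3, 4} by decide]
    fin_cases m <;> simp [ringX, ringR]
  · rw [ring_eq, cellAt_inj (ringX_lt hx _) (ringR_lt (by omega) _) (by omega) (by omega)]
    fin_cases m <;> simp [ringX, ringR]

/-- `Δ̂ ψ` in terms of the slices. -/
def dVec (W : PolarLattice) (ψ : W.H) (i₀ i₁ i₂ i₃ s m t : ℕ) : W.H :=
  KSB W ψ i₀ i₂ s m + KSB W ψ i₁ i₃ m t - KSB W ψ i₀ i₁ s m - KSB W ψ i₂ i₃ m t

/-- `Î ψ` in terms of the slices. -/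
def iVec (W : PolarLattice) (ψ : W.H) (i₀ i₁ i₂ i₃ : ℕ) : W.H :=
  K W ψ (sector W.n i₀ i₂) + K W ψ (sector W.n i₁ i₃) - K W ψ (sector W.n i₀ i₃) -
    K W ψ (sector W.n i₁ i₂)

theorem sector_union {n i j k : ℕ} (hij : i ≤ j) (hjk : j ≤ k) :
    sector n i j ∪ sector n j k = sector n i k := by
  rw [← sectorBlocks_self n i j 0, ← sectorBlocks_self n j k 0, ← sectorBlocks_self n i k 0]
  refine finset_cell_ext (by simp [none_notMem_sectorBlocks]) none_notMem_sectorBlocks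
    fun z q hz hq => ?_
  rw [Finset.mem_union, mem_sectorBlocks hz hq, mem_sectorBlocks hz hq, mem_sectorBlocks hz hq]
  omega

namespace Ruler

variable {n : ℕ} (D : Ruler n)

theorem A_union_B : D.A ∪ D.B = sector n D.i₀ D.i₂ := by
  have := D.i₀_le_s; have := D.s_lt_i₁; have := D.i₁_le_m; have := D.m_lt_i₂
  exact sector_union (by omega) (by omega)

theorem B_union_C : D.B ∪ D.C = sector n D.i₁ D.i₃ := by
  have := D.i₁_le_m; have := D.m_lt_i₂; have := D.i₂_le_t; have := D.t_lt_i₃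
  exact sector_union (by omega) (by omega)

theorem A_union_B_union_C : D.A ∪ D.B ∪ D.C = sector n D.i₀ D.i₃ := by
  have := D.i₀_le_s; have := D.s_lt_i₁; have := D.i₁_le_m; have := D.m_lt_i₂
  have := D.i₂_le_t; have := D.t_lt_i₃
  rw [A_union_B]
  exact sector_union (by omega) (by omega)

theorem A_union_A' : D.A ∪ D.A' = sectorBlocks n D.i₀ D.i₁ D.s D.m := rfl

theorem C_union_C' : D.C ∪ D.C' = sectorBlocks n D.i₂ D.i₃ D.m D.t := rfl

theorem A_union_A'_union_B : D.A ∪ D.A' ∪ D.B = sectorBlocks n D.i₀ D.i₂ D.s D.m := by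
  rw [Finset.union_right_comm, A_union_B]
  rfl

theorem C_union_C'_union_B : D.C ∪ D.C' ∪ D.B = sectorBlocks n D.i₁ D.i₃ D.m D.t := by
  rw [Finset.union_right_comm, Finset.union_comm D.C, B_union_C]
  rfl

end Ruler

theorem ΔVec_eq (D : Ruler W.n) :
    ΔVec W ψ D = dVec W ψ D.i₀ D.i₁ D.i₂ D.i₃ D.s D.m D.t := by
  rw [ΔVec, D.A_union_A'_union_B, D.C_union_C'_union_B, D.A_union_A', D.C_union_C']
  rfl

/-- The cell removed from A' has both cells below it in A, so it sees the same neighbors in AA'B and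
in AA', and the changes cancel. `dVec_succ_t` is the mirror image. -/
theorem dVec_succ_s (hA1 : AxiomA1 W ψ) {i₀ i₁ i₂ i₃ s m t : ℕ} (h0 : 1 ≤ i₀) (hs : i₀ ≤ s)
    (hs' : s + 1 < i₁) (hm : i₁ ≤ m) (hm' : m < i₂) (hn : i₂ ≤ W.n + 1) :
    dVec W ψ i₀ i₁ i₂ i₃ s m t = dVec W ψ i₀ i₁ i₂ i₃ (s + 1) m t := by
  have e1 := KSB_add_left (ψ := ψ) (i := i₀) (j := i₂) (t := m) (y := s) (by omega) (by omega)
  have e2 := KSB_add_left (ψ := ψ) (i := i₀) (j := i₁) (t := m) (y := s) (by omega) (by omega)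
  obtain ⟨x, rfl⟩ : ∃ x, s = x + 1 := ⟨s - 1, by omega⟩
  have e3 := KD_eq hA1 (x := x) (i := i₀) (j := i₂) (s := x + 1 + 1) (t := m)
    (i' := i₀) (j' := i₁) (s' := x + 1 + 1) (t' := m) (by omega) {3, 4, 5} (by decide)
    (by apply pattern_sectorBlocks <;> (try simp) <;> omega)
    (by apply pattern_sectorBlocks <;> (try simp) <;> omega)
  rw [← e1, ← e2] at e3
  simp only [dVec]
  linear_combination (norm := module) e3

theorem dVec_succ_t (hA1 : AxiomA1 W ψ) {i₀ i₁ i₂ i₃ s m t : ℕ} (h1 : 1 ≤ i₁)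
    (hm : i₁ ≤ m) (hm' : m < i₂) (ht : i₂ ≤ t) (ht' : t + 1 < i₃) (hn : i₃ ≤ W.n + 1) :
    dVec W ψ i₀ i₁ i₂ i₃ s m (t + 1) = dVec W ψ i₀ i₁ i₂ i₃ s m t := by
  have e1 := KSB_add_right (ψ := ψ) (i := i₁) (j := i₃) (s := m) (y := t) (by omega) (by omega)
  have e2 := KSB_add_right (ψ := ψ) (i := i₂) (j := i₃) (s := m) (y := t) (by omega) (by omega)
  obtain ⟨x, rfl⟩ : ∃ x, t = x + 1 := ⟨t - 1, by omega⟩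
  have e3 := KD_eq hA1 (x := x) (i := i₁) (j := i₃) (s := m) (t := x + 1)
    (i' := i₂) (j' := i₃) (s' := m) (t' := x + 1) (by omega) {0, 4, 5} (by decide)
    (by apply pattern_sectorBlocks <;> (try simp) <;> omega)
    (by apply pattern_sectorBlocks <;> (try simp) <;> omega)
  rw [← e1, ← e2] at e3
  simp only [dVec]
  linear_combination (norm := module) e3

/-- A cell above B passes from C' to A'. Its conditional mutual information with the two cells of B
below it has to be the same when computed from the A side and from the C side, and this is what the
slide identities provide. -/
theorem dVec_succ_m (hA1 : AxiomA1 W ψ) {i₀ i₁ i₂ i₃ s m t : ℕ} (h0 : 1 ≤ i₀) (hs : i₀ ≤ s)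
    (hs' : s < i₁) (hm : i₁ ≤ m) (hm' : m + 1 < i₂) (ht : i₂ ≤ t) (ht' : t < i₃)
    (hn : i₃ ≤ W.n + 1) :
    dVec W ψ i₀ i₁ i₂ i₃ s (m + 1) t = dVec W ψ i₀ i₁ i₂ i₃ s m t := by
  have e1 := KSB_add_right (ψ := ψ) (i := i₀) (j := i₂) (s := s) (y := m) (by omega) (by omega)
  have e2 := KSB_add_right (ψ := ψ) (i := i₀) (j := i₁) (s := s) (y := m) (by omega) (by omega)
  have e3 := KSB_add_left (ψ := ψ) (i := i₁) (j := i₃) (t := t) (y := m) (by omega) (by omega)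
  have e4 := KSB_add_left (ψ := ψ) (i := i₂) (j := i₃) (t := t) (y := m) (by omega) (by omega)
  obtain ⟨x, rfl⟩ : ∃ x, m = x + 1 := ⟨m - 1, by omega⟩
  have p1 : Pattern (cellAt W.n (x + 1) 3) (ring W.n x 1) (sectorBlocks W.n i₀ i₁ s (x + 1)) {0} := by
    apply pattern_sectorBlocks <;> (try simp) <;> omega
  -- An auxiliary sector that ends at the line under the moved cell; `q2` is its counterpart on the
  -- other side. They split the passage over two cells into two single-cell slides and cancel in the
  -- sum.
  have p2 : Pattern (cellAt W.n (x + 1) 3) (ring W.n x 1)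
      (sectorBlocks W.n i₀ (x + 2) s (x + 1)) {5, 0} := by
    apply pattern_sectorBlocks <;> (try simp) <;> omega
  have p3 : Pattern (cellAt W.n (x + 1) 3) (ring W.n x 1)
      (sectorBlocks W.n i₀ i₂ s (x + 1)) {4, 0, 5} := by
    apply pattern_sectorBlocks <;> (try simp) <;> omega
  have q1 : Pattern (cellAt W.n (x + 1) 3) (ring W.n x 1)
      (sectorBlocks W.n i₂ i₃ (x + 1 + 1) t) {3} := by
    apply pattern_sectorBlocks <;> (try simp) <;> omega
  have q2 : Pattern (cellAt W.n (x + 1) 3) (ring W.n x 1)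
      (sectorBlocks W.n (x + 2) i₃ (x + 1 + 1) t) {3, 4} := by
    apply pattern_sectorBlocks <;> (try simp) <;> omega
  have q3 : Pattern (cellAt W.n (x + 1) 3) (ring W.n x 1)
      (sectorBlocks W.n i₁ i₃ (x + 1 + 1) t) {5, 3, 4} := by
    apply pattern_sectorBlocks <;> (try simp) <;> omega
  have s1 := KDiff_slide_left hA1 (by omega) p1 p2 q2 q3
  have s2 := KDiff_slide_right hA1 (by omega) (Or.inr rfl) (J := {0, 5})
    (by rwa [Finset.pair_comm]) p3 q1 (by rwa [Finset.pair_comm])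
  simp only [KD] at e1 e2 e3 e4
  rw [← e2, ← e3] at s1
  rw [← e1, ← e4] at s2
  simp only [dVec]
  linear_combination (norm := module) -s1 - s2

/-- `Δ̂ ψ` does not depend on the choice of the outer regions. -/
theorem dVec_eq (hA1 : AxiomA1 W ψ) {i₀ i₁ i₂ i₃ s m t s' m' t' : ℕ} (h0 : 1 ≤ i₀)
    (hs : i₀ ≤ s) (hs₁ : s < i₁) (hm : i₁ ≤ m) (hm₂ : m < i₂) (ht : i₂ ≤ t) (ht₃ : t < i₃)
    (hs' : i₀ ≤ s') (hs₁' : s' < i₁) (hm' : i₁ ≤ m') (hm₂' : m' < i₂) (ht' : i₂ ≤ t')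
    (ht₃' : t' < i₃) (hn : i₃ ≤ W.n + 1) :
    dVec W ψ i₀ i₁ i₂ i₃ s m t = dVec W ψ i₀ i₁ i₂ i₃ s' m' t' := by
  have norm : ∀ s m t : ℕ, i₀ ≤ s → s < i₁ → i₁ ≤ m → m < i₂ → i₂ ≤ t → t < i₃ →
      dVec W ψ i₀ i₁ i₂ i₃ s m t = dVec W ψ i₀ i₁ i₂ i₃ i₀ i₁ i₂ := by
    intro s m t hs hs₁ hm hm₂ ht ht₃
    have n1 : ∀ k, i₀ + k < i₁ →
        dVec W ψ i₀ i₁ i₂ i₃ (i₀ + k) m t = dVec W ψ i₀ i₁ i₂ i₃ i₀ m t := by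
      intro k
      induction k with
      | zero => intro _; rfl
      | succ k ih =>
        intro hk
        rw [← ih (by omega), dVec_succ_s hA1 h0 (s := i₀ + k) (by omega) (by omega) hm hm₂ (by omega)]
        rfl
    have n2 : ∀ k, i₁ + k < i₂ →
        dVec W ψ i₀ i₁ i₂ i₃ i₀ (i₁ + k) t = dVec W ψ i₀ i₁ i₂ i₃ i₀ i₁ t := by
      intro k
      induction k with
      | zero => intro _; rfl
      | succ k ih =>
        intro hk
        rw [← ih (by omega)]
        exact dVec_succ_m (m := i₁ + k) hA1 h0 le_rfl (by omega) (by omega) hk ht ht₃ hn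
    have n3 : ∀ k, i₂ + k < i₃ →
        dVec W ψ i₀ i₁ i₂ i₃ i₀ i₁ (i₂ + k) = dVec W ψ i₀ i₁ i₂ i₃ i₀ i₁ i₂ := by
      intro k
      induction k with
      | zero => intro _; rfl
      | succ k ih =>
        intro hk
        rw [← ih (by omega)]
        exact dVec_succ_t (t := i₂ + k) hA1 (by omega) le_rfl (by omega) (by omega) hk hn
    obtain ⟨a, rfl⟩ := Nat.exists_eq_add_of_le hs
    obtain ⟨b, rfl⟩ := Nat.exists_eq_add_of_le hm
    obtain ⟨c, rfl⟩ := Nat.exists_eq_add_of_le ht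
    rw [n1 a hs₁, n2 b hm₂, n3 c ht₃]
  rw [norm s m t hs hs₁ hm hm₂ ht ht₃, norm s' m' t' hs' hs₁' hm' hm₂' ht' ht₃']

end SectorRelations

/-! ### Linear relations among the five rulers on five division points -/

section FivePoints

variable {W : PolarLattice} {ψ : W.H}

/-- `Δ̂ ψ` with a standard choice of the outer regions. -/
def dStd (W : PolarLattice) (ψ : W.H) (i₀ i₁ i₂ i₃ : ℕ) : W.H := dVec W ψ i₀ i₁ i₂ i₃ i₀ i₁ i₂

theorem dVec_eq_dStd (hA1 : AxiomA1 W ψ) {i₀ i₁ i₂ i₃ s m t : ℕ} (h0 : 1 ≤ i₀)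
    (hs : i₀ ≤ s) (hs₁ : s < i₁) (hm : i₁ ≤ m) (hm₂ : m < i₂) (ht : i₂ ≤ t) (ht₃ : t < i₃)
    (hn : i₃ ≤ W.n + 1) : dVec W ψ i₀ i₁ i₂ i₃ s m t = dStd W ψ i₀ i₁ i₂ i₃ :=
  dVec_eq hA1 h0 hs hs₁ hm hm₂ ht ht₃ le_rfl (by omega) le_rfl (by omega) le_rfl (by omega) hn

variable {p₀ p₁ p₂ p₃ p₄ : ℕ}

/-- `Δ̂(A, B, CD) = Δ̂(A, B, C) - Î(B, C, D)`. -/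
theorem dStd_extend_right (hA1 : AxiomA1 W ψ) (h0 : 1 ≤ p₀) (h01 : p₀ < p₁) (h12 : p₁ < p₂)
    (h23 : p₂ < p₃) (h34 : p₃ < p₄) (hn : p₄ ≤ W.n + 1) :
    dStd W ψ p₀ p₁ p₂ p₄ = dStd W ψ p₀ p₁ p₂ p₃ - iVec W ψ p₁ p₂ p₃ p₄ := by
  obtain ⟨x, rfl⟩ : ∃ x, p₂ = x + 2 := ⟨p₂ - 2, by omega⟩
  -- C' is taken to be the single cell over the line between B and C. Adding it then costs the same
  -- whether the right sector ends at p₃ or at p₄, so the two Δ̂ differ by bare sectors only.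
  rw [← dVec_eq_dStd hA1 (s := p₀) (m := x + 1) (t := x + 2) h0 (by omega) (by omega) (by omega)
      (by omega) (by omega) (by omega) (by omega),
    ← dVec_eq_dStd hA1 (s := p₀) (m := x + 1) (t := x + 2) h0 (by omega) (by omega) (by omega)
      (by omega) (by omega) (by omega) (by omega)]
  have add : ∀ i j : ℕ, KSB W ψ i j (x + 1) (x + 2) - K W ψ (sector W.n i j) =
      KD W ψ (x + 1) i j (x + 1) (x + 1) := fun i j => by
    rw [← KSB_self i j (x + 1)]
    exact KSB_add_right (y := x + 1) le_rfl (by omega)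
  have e1 := KD_eq hA1 (x := x) (i := p₁) (j := p₄) (s := x + 1) (t := x + 1)
    (i' := p₁) (j' := p₃) (s' := x + 1) (t' := x + 1) (by omega) {4, 5} (by decide)
    (by apply pattern_sectorBlocks <;> (try simp) <;> omega)
    (by apply pattern_sectorBlocks <;> (try simp) <;> omega)
  have e2 := KD_eq hA1 (x := x) (i := x + 2) (j := p₄) (s := x + 1) (t := x + 1)
    (i' := x + 2) (j' := p₃) (s' := x + 1) (t' := x + 1) (by omega) {4} (by decide)
    (by apply pattern_sectorBlocks <;> (try simp) <;> omega)
    (by apply pattern_sectorBlocks <;> (try simp) <;> omega)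
  rw [← add, ← add] at e1 e2
  simp only [dVec, iVec]
  linear_combination (norm := module) e1 - e2

/-- `Δ̂(AB, C, D) = Δ̂(B, C, D) - Î(A, B, C)`. -/
theorem dStd_extend_left (hA1 : AxiomA1 W ψ) (h0 : 1 ≤ p₀) (h01 : p₀ < p₁) (h12 : p₁ < p₂)
    (h23 : p₂ < p₃) (h34 : p₃ < p₄) (hn : p₄ ≤ W.n + 1) :
    dStd W ψ p₀ p₂ p₃ p₄ = dStd W ψ p₁ p₂ p₃ p₄ - iVec W ψ p₀ p₁ p₂ p₃ := by
  obtain ⟨x, rfl⟩ : ∃ x, p₂ = x + 2 := ⟨p₂ - 2, by omega⟩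
  -- Mirror choice: A' is the single cell over the line at p₂.
  rw [← dVec_eq_dStd hA1 (s := x + 1) (m := x + 2) (t := p₃) h0 (by omega) (by omega) (by omega)
      (by omega) (by omega) (by omega) (by omega),
    ← dVec_eq_dStd hA1 (s := x + 1) (m := x + 2) (t := p₃) (by omega) (by omega) (by omega)
      (by omega) (by omega) (by omega) (by omega) (by omega)]
  have add : ∀ i j : ℕ, KSB W ψ i j (x + 1) (x + 2) - K W ψ (sector W.n i j) =
      KD W ψ (x + 1) i j (x + 1) (x + 1) := fun i j => by
    rw [← KSB_self i j (x + 1)]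
    exact KSB_add_right (y := x + 1) le_rfl (by omega)
  have e1 := KD_eq hA1 (x := x) (i := p₀) (j := p₃) (s := x + 1) (t := x + 1)
    (i' := p₁) (j' := p₃) (s' := x + 1) (t' := x + 1) (by omega) {4, 5} (by decide)
    (by apply pattern_sectorBlocks <;> (try simp) <;> omega)
    (by apply pattern_sectorBlocks <;> (try simp) <;> omega)
  have e2 := KD_eq hA1 (x := x) (i := p₀) (j := x + 2) (s := x + 1) (t := x + 1)
    (i' := p₁) (j' := x + 2) (s' := x + 1) (t' := x + 1) (by omega) {5} (by decide)
    (by apply pattern_sectorBlocks <;> (try simp) <;> omega)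
    (by apply pattern_sectorBlocks <;> (try simp) <;> omega)
  rw [← add, ← add] at e1 e2
  simp only [dVec, iVec]
  linear_combination (norm := module) e1 - e2

/-- Removing the blocks `[m, m + k)` from the left changes `K` on two sectors in the same way. -/
theorem KSB_sub_left (hA1 : AxiomA1 W ψ) {i j j' m : ℕ} (hi : 1 ≤ i) (hj : m < j)
    (hj' : m < j') (hn : j ≤ W.n + 1) (k s : ℕ) (hs : i ≤ s) (hk : s + k = m) :
    KSB W ψ i j s m - KSB W ψ i j' s m =
      K W ψ (sector W.n i j) - K W ψ (sector W.n i j') := by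
  induction k generalizing s with
  | zero =>
    obtain rfl : s = m := by omega
    rw [KSB_self, KSB_self]
  | succ k ih =>
    rw [← ih (s + 1) (by omega) (by omega)]
    have e1 := KSB_add_left (ψ := ψ) (i := i) (j := j) (t := m) (y := s) (by omega) (by omega)
    have e2 := KSB_add_left (ψ := ψ) (i := i) (j := j') (t := m) (y := s) (by omega) (by omega)
    obtain ⟨x, rfl⟩ : ∃ x, s = x + 1 := ⟨s - 1, by omega⟩
    have e3 : KD W ψ (x + 1) i j (x + 1 + 1) m = KD W ψ (x + 1) i j' (x + 1 + 1) m := by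
      rcases Nat.eq_zero_or_pos k with rfl | hk0
      · exact KD_eq hA1 (by omega) {4, 5} (by decide)
          (by apply pattern_sectorBlocks <;> (try simp) <;> omega)
          (by apply pattern_sectorBlocks <;> (try simp) <;> omega)
      · exact KD_eq hA1 (by omega) {3, 4, 5} (by decide)
          (by apply pattern_sectorBlocks <;> (try simp) <;> omega)
          (by apply pattern_sectorBlocks <;> (try simp) <;> omega)
    rw [← e1, ← e2] at e3
    linear_combination (norm := module) e3

/-- Removing the blocks `[t, t + k)` from the right changes `K` on two sectors in the same way. -/
theorem KSB_sub_right (hA1 : AxiomA1 W ψ) {i i' j m t : ℕ} (hi' : i' ≤ t) (hit : i ≤ t)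
    (hm : m < t) (hn : j ≤ W.n + 1) (k : ℕ) (hk : t + k < j) :
    KSB W ψ i j m (t + k) - KSB W ψ i' j m (t + k) =
      KSB W ψ i j m t - KSB W ψ i' j m t := by
  induction k with
  | zero => rfl
  | succ k ih =>
    rw [← ih (by omega), ← Nat.add_assoc]
    have e1 := KSB_add_right (ψ := ψ) (i := i) (j := j) (s := m) (y := t + k) (by omega) (by omega)
    have e2 := KSB_add_right (ψ := ψ) (i := i') (j := j) (s := m) (y := t + k) (by omega) (by omega)
    obtain ⟨x, hx⟩ : ∃ x, t + k = x + 1 := ⟨t + k - 1, by omega⟩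
    rw [hx] at e1 e2 ⊢
    have e3 : KD W ψ (x + 1) i j m (x + 1) = KD W ψ (x + 1) i' j m (x + 1) :=
      KD_eq hA1 (by omega) {0, 4, 5} (by decide)
          (by apply pattern_sectorBlocks <;> (try simp) <;> omega)
          (by apply pattern_sectorBlocks <;> (try simp) <;> omega)
    rw [← e1, ← e2] at e3
    linear_combination (norm := module) e3

/-- `Δ̂(A, BC, D) = Δ̂(A, B, CD) + Δ̂(AB, C, D)`. -/
theorem dStd_add (hA1 : AxiomA1 W ψ) (h0 : 1 ≤ p₀) (h01 : p₀ < p₁) (h12 : p₁ < p₂)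
    (h23 : p₂ < p₃) (h34 : p₃ < p₄) (hn : p₄ ≤ W.n + 1) :
    dStd W ψ p₀ p₁ p₃ p₄ = dStd W ψ p₀ p₁ p₂ p₄ + dStd W ψ p₀ p₂ p₃ p₄ := by
  obtain ⟨x, rfl⟩ : ∃ x, p₂ = x + 2 := ⟨p₂ - 2, by omega⟩
  -- The cell over the line at p₂ belongs to C' in the first two rulers and is all of A' in the
  -- third. After the other blocks are stripped, its second difference seen from the left is matched
  -- with the one seen from the right by a slide.
  rw [← dVec_eq_dStd hA1 (s := p₀) (m := x + 1) (t := p₃) h0 (by omega) (by omega) (by omega)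
      (by omega) (by omega) (by omega) (by omega),
    ← dVec_eq_dStd hA1 (s := p₀) (m := x + 1) (t := x + 2) h0 (by omega) (by omega) (by omega)
      (by omega) (by omega) (by omega) (by omega),
    ← dVec_eq_dStd hA1 (s := x + 1) (m := x + 2) (t := p₃) h0 (by omega) (by omega) (by omega)
      (by omega) (by omega) (by omega) (by omega)]
  have l1 := KSB_sub_left hA1 (ψ := ψ) (i := p₀) (j := p₃) (j' := x + 2) (m := x + 1) h0
    (by omega) (by omega) (by omega) (x + 1 - p₀) p₀ le_rfl (by omega)
  obtain ⟨k, rfl⟩ := Nat.exists_eq_add_of_lt h23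
  have l2 := KSB_sub_right hA1 (ψ := ψ) (i := p₁) (i' := x + 2) (j := p₄) (m := x + 1)
    (t := x + 2) (by omega) (by omega) (by omega) hn (k + 1) (by omega)
  rw [← Nat.add_assoc] at l2
  have add : ∀ i j : ℕ, KSB W ψ i j (x + 1) (x + 2) - K W ψ (sector W.n i j) =
      KD W ψ (x + 1) i j (x + 1) (x + 1) := fun i j => by
    rw [← KSB_self i j (x + 1)]
    exact KSB_add_right (y := x + 1) le_rfl (by omega)
  have addl : ∀ i : ℕ, KSB W ψ i p₄ (x + 1) (x + 2 + k + 1) - KSB W ψ i p₄ (x + 2) (x + 2 + k + 1) =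
      KD W ψ (x + 1) i p₄ (x + 1 + 1) (x + 2 + k + 1) := fun i =>
    KSB_add_left (y := x + 1) (by omega) (by omega)
  have u1 : Pattern (cellAt W.n (x + 1) 3) (ring W.n x 1)
      (sectorBlocks W.n p₀ (x + 2) (x + 1) (x + 1)) {5} := by
    apply pattern_sectorBlocks <;> (try simp) <;> omega
  have u2 : Pattern (cellAt W.n (x + 1) 3) (ring W.n x 1)
      (sectorBlocks W.n p₀ (x + 2 + k + 1) (x + 1) (x + 1)) {4, 5} := by
    apply pattern_sectorBlocks <;> (try simp) <;> omega
  have v1 : Pattern (cellAt W.n (x + 1) 3) (ring W.n x 1)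
      (sectorBlocks W.n (x + 2 + k + 1) p₄ (x + 1 + 1) (x + 2 + k + 1)) {3} := by
    apply pattern_sectorBlocks <;> (try simp) <;> omega
  have v2 : Pattern (cellAt W.n (x + 1) 3) (ring W.n x 1)
      (sectorBlocks W.n (x + 2) p₄ (x + 1 + 1) (x + 2 + k + 1)) {4, 3} := by
    apply pattern_sectorBlocks <;> (try simp) <;> omega
  have sl := KDiff_slide_right hA1 (by omega) (Or.inl rfl) u1 u2 v1 v2
  simp only [KD] at add addl
  rw [← add, ← add, ← addl, ← addl] at sl
  simp only [dVec]
  linear_combination (norm := module) l1 + l2 + sl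

/-- `Î(A, B, CD) = Î(A, B, C) + Î(A, BC, D)`. -/
theorem iVec_extend_right : iVec W ψ p₀ p₁ p₂ p₄ = iVec W ψ p₀ p₁ p₂ p₃ + iVec W ψ p₀ p₁ p₃ p₄ := by
  simp only [iVec]
  abel

/-- `Î(AB, C, D) = Î(B, C, D) + Î(A, BC, D)`. -/
theorem iVec_extend_left : iVec W ψ p₀ p₂ p₃ p₄ = iVec W ψ p₁ p₂ p₃ p₄ + iVec W ψ p₀ p₁ p₃ p₄ := by
  simp only [iVec]
  abel

end FivePoints

/-! ### The defining equation of the constant -/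

section SolveC

variable {δ ι : ℝ}

theorem solveC_spec (h : solveC δ ι ≠ 0) : 0 < solveC δ ι ∧
    Real.exp (-6 * δ / solveC δ ι) + Real.exp (-6 * ι / solveC δ ι) = 1 := by
  unfold solveC at h ⊢
  split_ifs at h ⊢ with hc
  · exact hc.choose_spec
  · exact absurd rfl h

end SolveC

/-! ### The vector fixed-point equation -/

section Stationarity

variable {W : PolarLattice} {ψ : W.H}

/-- The normalized perturbation of a unit vector in an orthogonal direction. -/
theorem hasDerivAt_normalized {ψ ψ' : W.H} (hψ : ‖ψ‖ = 1) (h : inner ℂ ψ ψ' = 0) :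
    HasDerivAt (fun ε : ℝ => ((‖ψ + (ε : ℂ) • ψ'‖⁻¹ : ℝ) : ℂ) • (ψ + (ε : ℂ) • ψ')) ψ' 0 := by
  have hn : ∀ ε : ℝ, ‖ψ + (ε : ℂ) • ψ'‖ = Real.sqrt (1 + ε ^ 2 * ‖ψ'‖ ^ 2) := fun ε => by
    have := norm_add_sq_eq_norm_sq_add_norm_sq_of_inner_eq_zero (𝕜 := ℂ) ψ ((ε : ℂ) • ψ')
      (by rw [inner_smul_right, h, mul_zero])
    refine (Real.sqrt_mul_self (norm_nonneg _)).symm.trans (congrArg Real.sqrt ?_)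
    rw [this, norm_smul, hψ, Complex.norm_real, Real.norm_eq_abs]
    linear_combination ‖ψ'‖ ^ 2 * abs_mul_abs_self ε
  have h1 : HasDerivAt (fun ε : ℝ => ‖ψ + (ε : ℂ) • ψ'‖⁻¹) 0 0 := by
    simp_rw [hn]
    have a : HasDerivAt (fun ε : ℝ => 1 + ε ^ 2 * ‖ψ'‖ ^ 2) 0 0 := by
      simpa using ((((hasDerivAt_id (0 : ℝ)).pow 2).mul_const (‖ψ'‖ ^ 2)).const_add 1)
    simpa using (a.sqrt (by simp)).fun_inv (by simp)
  have h2 : HasDerivAt (fun ε : ℝ => ψ + (ε : ℂ) • ψ') ψ' 0 := by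
    have : HasDerivAt (fun ε : ℝ => (ε : ℂ) • ψ') ψ' 0 := by
      simpa using ((hasDerivAt_id (0 : ℝ)).ofReal_comp).smul_const ψ'
    simpa using this.const_add ψ
  refine (h1.ofReal_comp.smul h2).congr_deriv ?_
  simp [hψ]

/-- The first-order variation of the entropy of a union of cells. -/
theorem hasDerivAt_S {ψ' : W.H} (hψ : ‖ψ‖ = 1) (h : inner ℂ ψ ψ' = 0)
    (X : Finset (Cell W.n)) :
    HasDerivAt (fun ε : ℝ =>
      S W (((‖ψ + (ε : ℂ) • ψ'‖⁻¹ : ℝ) : ℂ) • (ψ + (ε : ℂ) • ψ')) X)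
      (2 * (inner ℂ (K W ψ X) ψ').re) 0 := by
  have h1 := hasDerivAt_normalized hψ h
  have h2 := hasFDerivAt_entropy ψ (sites W X)
  have h3 : HasFDerivAt (fun φ => entropy φ (sites W X)) (entropyDeriv ψ (sites W X))
      (((‖ψ + ((0 : ℝ) : ℂ) • ψ'‖⁻¹ : ℝ) : ℂ) • (ψ + ((0 : ℝ) : ℂ) • ψ')) := by
    simpa [hψ] using h2
  have h4 := h3.comp_hasDerivAt (0 : ℝ) h1
  rw [entropyDeriv_apply, inner_sub_left, h, sub_zero] at h4
  exact h4

theorem I_eq (ψ : W.H) (D : Ruler W.n) : I W ψ D = S W ψ (sector W.n D.i₀ D.i₂) +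
    S W ψ (sector W.n D.i₁ D.i₃) - S W ψ (sector W.n D.i₀ D.i₃) - S W ψ (sector W.n D.i₁ D.i₂) := by
  rw [I, D.A_union_B_union_C, D.A_union_B, D.B_union_C, Ruler.B]

theorem inner_ΔVec (D : Ruler W.n) : inner ℂ ψ (ΔVec W ψ D) = (Δ W ψ D : ℂ) := by
  simp only [ΔVec, Δ, inner_sub_right, inner_add_right, inner_K]
  push_cast
  ring

theorem inner_iVec (D : Ruler W.n) :
    inner ℂ ψ (iVec W ψ D.i₀ D.i₁ D.i₂ D.i₃) = (I W ψ D : ℂ) := by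
  simp only [iVec, I_eq, inner_sub_right, inner_add_right, inner_K]
  push_cast
  ring

theorem hasDerivAt_Δ {ψ' : W.H} (hψ : ‖ψ‖ = 1) (h : inner ℂ ψ ψ' = 0) (D : Ruler W.n) :
    HasDerivAt (fun ε : ℝ =>
      Δ W (((‖ψ + (ε : ℂ) • ψ'‖⁻¹ : ℝ) : ℂ) • (ψ + (ε : ℂ) • ψ')) D)
      (2 * (inner ℂ (ΔVec W ψ D) ψ').re) 0 := by
  refine ((((hasDerivAt_S hψ h (D.A ∪ D.A' ∪ D.B)).add
    (hasDerivAt_S hψ h (D.C ∪ D.C' ∪ D.B))).sub (hasDerivAt_S hψ h (D.A ∪ D.A'))).sub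
    (hasDerivAt_S hψ h (D.C ∪ D.C'))).congr_deriv ?_
  simp only [ΔVec, inner_sub_left, inner_add_left, Complex.sub_re, Complex.add_re]
  ring

theorem hasDerivAt_I {ψ' : W.H} (hψ : ‖ψ‖ = 1) (h : inner ℂ ψ ψ' = 0) (D : Ruler W.n) :
    HasDerivAt (fun ε : ℝ =>
      I W (((‖ψ + (ε : ℂ) • ψ'‖⁻¹ : ℝ) : ℂ) • (ψ + (ε : ℂ) • ψ')) D)
      (2 * (inner ℂ (iVec W ψ D.i₀ D.i₁ D.i₂ D.i₃) ψ').re) 0 := by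
  simp only [I_eq]
  refine ((((hasDerivAt_S hψ h (sector W.n D.i₀ D.i₂)).add
    (hasDerivAt_S hψ h (sector W.n D.i₁ D.i₃))).sub (hasDerivAt_S hψ h (sector W.n D.i₀ D.i₃))).sub
    (hasDerivAt_S hψ h (sector W.n D.i₁ D.i₂))).congr_deriv ?_
  simp only [iVec, inner_sub_left, inner_add_left, Complex.sub_re, Complex.add_re]
  ring

theorem ctot_spec {D : Ruler W.n} (hc : ctot W ψ D ≠ 0) : 0 < ctot W ψ D ∧
    η W ψ D + Real.exp (-6 * I W ψ D / ctot W ψ D) = 1 :=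
  solveC_spec hc

/-- The vector fixed-point equation: stationarity of `𝔠_tot` makes `ψ` an eigenvector of
`η Δ̂ + (1 - η) Î`. -/
theorem vector_fixed_point (hψ : ‖ψ‖ = 1) (hstat : Stationary W ψ) {D : Ruler W.n}
    (hc : ctot W ψ D ≠ 0) :
    ∃ l : ℂ, (η W ψ D : ℂ) • ΔVec W ψ D + ((1 - η W ψ D : ℝ) : ℂ) • iVec W ψ D.i₀ D.i₁ D.i₂ D.i₃ =
      l • ψ := by
  set v := (η W ψ D : ℂ) • ΔVec W ψ D +
    ((1 - η W ψ D : ℝ) : ℂ) • iVec W ψ D.i₀ D.i₁ D.i₂ D.i₃ with hv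
  obtain ⟨hpos, heq⟩ := ctot_spec hc
  have key : ∀ ψ' : W.H, inner ℂ ψ ψ' = 0 → (inner ℂ v ψ').re = 0 := by
    intro ψ' h
    have d1 := hasDerivAt_Δ hψ h D
    have d2 := hasDerivAt_I hψ h D
    have d3 := hstat D ψ' h
    set φ : ℝ → W.H := fun ε => ((‖ψ + (ε : ℂ) • ψ'‖⁻¹ : ℝ) : ℂ) • (ψ + (ε : ℂ) • ψ') with hφ
    have h0 : φ 0 = ψ := by simp [hφ, hψ]
    change HasDerivAt (fun ε => Δ W (φ ε) D) _ 0 at d1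
    change HasDerivAt (fun ε => I W (φ ε) D) _ 0 at d2
    change HasDerivAt (fun ε => ctot W (φ ε) D) _ 0 at d3
    have hne : ctot W (φ 0) D ≠ 0 := by rwa [h0]
    have e1 := ((d1.const_mul (-6)).div d3 hne).exp
    have e2 := ((d2.const_mul (-6)).div d3 hne).exp
    -- 𝔠_tot is differentiable along the path, hence stays nonzero near 0. Its defining equation
    -- then holds along the path and can be differentiated, with the derivative of 𝔠_tot equal to 0.
    have hev : ∀ᶠ ε in nhds (0 : ℝ), Real.exp (-6 * Δ W (φ ε) D / ctot W (φ ε) D) +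
        Real.exp (-6 * I W (φ ε) D / ctot W (φ ε) D) = 1 := by
      filter_upwards [d3.continuousAt.eventually_ne hne] with ε hε
      exact (ctot_spec hε).2
    have e3 := ((hasDerivAt_const (0 : ℝ) (1 : ℝ)).congr_of_eventuallyEq hev).unique (e1.add e2)
    simp only [Pi.div_apply, h0, mul_zero, sub_zero] at e3
    rw [← η, show Real.exp (-6 * I W ψ D / ctot W ψ D) = 1 - η W ψ D by linarith] at e3
    rw [hv, inner_add_left, inner_smul_left, inner_smul_left, Complex.conj_ofReal,
      Complex.conj_ofReal, Complex.add_re, Complex.re_ofReal_mul, Complex.re_ofReal_mul]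
    field_simp at e3
    linarith
  have hvψ : inner ℂ v ψ = ((η W ψ D * Δ W ψ D + (1 - η W ψ D) * I W ψ D : ℝ) : ℂ) := by
    rw [← inner_conj_symm, hv, inner_add_right, inner_smul_right, inner_smul_right, inner_ΔVec,
      inner_iVec, ← Complex.ofReal_mul, ← Complex.ofReal_mul, ← Complex.ofReal_add,
      Complex.conj_ofReal]
  -- The eigenvalue is the expectation value of the vector, which is real; `key` covers the
  -- directions orthogonal to ψ, so an arbitrary `x` is tested after projecting out ψ.
  refine ⟨((η W ψ D * Δ W ψ D + (1 - η W ψ D) * I W ψ D : ℝ) : ℂ), ?_⟩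
  refine eq_of_forall_re_inner_eq fun x => ?_
  have hψψ : inner ℂ ψ ψ = (1 : ℂ) := by rw [inner_self_eq_norm_sq_to_K, hψ]; simp
  have h1 := key (x - (inner ℂ ψ x : ℂ) • ψ) (by
    rw [inner_sub_right, inner_smul_right, hψψ, mul_one, sub_self])
  rw [inner_sub_right, inner_smul_right, hvψ, Complex.sub_re, sub_eq_zero] at h1
  rw [h1, inner_smul_left, Complex.conj_ofReal, mul_comm]

end Stationarity

/-! ### Five-point systems, and the system defined by a stationary generic state -/

/-- Constants `c` and ratios `r = η / (1 - η)` attached to the divisions `i < j < k < l` of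
`{1, …, N}`, with the relations that hold among the five rulers on five points. -/
structure FivePointSystem (N : ℕ) (c r : ℕ → ℕ → ℕ → ℕ → ℝ) : Prop where
  r_pos : ∀ {i j k l : ℕ}, 1 ≤ i → i < j → j < k → k < l → l ≤ N → 0 < r i j k l
  ratio_right : ∀ {p₀ p₁ p₂ p₃ p₄ : ℕ}, 1 ≤ p₀ → p₀ < p₁ → p₁ < p₂ → p₂ < p₃ → p₃ < p₄ → p₄ ≤ N →
    r p₀ p₁ p₂ p₄ = r p₀ p₁ p₂ p₃ + r p₀ p₁ p₃ p₄ * (1 + r p₀ p₁ p₂ p₃) ∧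
    r p₀ p₁ p₃ p₄ * (1 + r p₁ p₂ p₃ p₄) = r p₀ p₁ p₂ p₄ * r p₁ p₂ p₃ p₄
  ratio_left : ∀ {p₀ p₁ p₂ p₃ p₄ : ℕ}, 1 ≤ p₀ → p₀ < p₁ → p₁ < p₂ → p₂ < p₃ → p₃ < p₄ → p₄ ≤ N →
    r p₀ p₂ p₃ p₄ = r p₁ p₂ p₃ p₄ + r p₀ p₁ p₃ p₄ * (1 + r p₁ p₂ p₃ p₄) ∧
    r p₀ p₁ p₃ p₄ * (1 + r p₀ p₁ p₂ p₃) = r p₀ p₂ p₃ p₄ * r p₀ p₁ p₂ p₃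
  log_right : ∀ {p₀ p₁ p₂ p₃ p₄ : ℕ}, 1 ≤ p₀ → p₀ < p₁ → p₁ < p₂ → p₂ < p₃ → p₃ < p₄ → p₄ ≤ N →
    c p₀ p₁ p₂ p₄ * Real.log (1 + r p₀ p₁ p₂ p₄) = c p₀ p₁ p₂ p₃ * Real.log (1 + r p₀ p₁ p₂ p₃) +
      c p₀ p₁ p₃ p₄ * Real.log (1 + r p₀ p₁ p₃ p₄) ∧
    c p₀ p₁ p₂ p₄ * Real.log (1 + (r p₀ p₁ p₂ p₄)⁻¹) =
      c p₀ p₁ p₂ p₃ * Real.log (1 + (r p₀ p₁ p₂ p₃)⁻¹) -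
      c p₁ p₂ p₃ p₄ * Real.log (1 + r p₁ p₂ p₃ p₄)
  log_left : ∀ {p₀ p₁ p₂ p₃ p₄ : ℕ}, 1 ≤ p₀ → p₀ < p₁ → p₁ < p₂ → p₂ < p₃ → p₃ < p₄ → p₄ ≤ N →
    c p₀ p₂ p₃ p₄ * Real.log (1 + r p₀ p₂ p₃ p₄) = c p₁ p₂ p₃ p₄ * Real.log (1 + r p₁ p₂ p₃ p₄) +
      c p₀ p₁ p₃ p₄ * Real.log (1 + r p₀ p₁ p₃ p₄) ∧
    c p₀ p₂ p₃ p₄ * Real.log (1 + (r p₀ p₂ p₃ p₄)⁻¹) =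
      c p₁ p₂ p₃ p₄ * Real.log (1 + (r p₁ p₂ p₃ p₄)⁻¹) -
      c p₀ p₁ p₂ p₃ * Real.log (1 + r p₀ p₁ p₂ p₃)
  log_middle : ∀ {p₀ p₁ p₂ p₃ p₄ : ℕ}, 1 ≤ p₀ → p₀ < p₁ → p₁ < p₂ → p₂ < p₃ → p₃ < p₄ → p₄ ≤ N →
    c p₀ p₁ p₃ p₄ * Real.log (1 + (r p₀ p₁ p₃ p₄)⁻¹) =
      c p₀ p₁ p₂ p₄ * Real.log (1 + (r p₀ p₁ p₂ p₄)⁻¹) +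
      c p₀ p₂ p₃ p₄ * Real.log (1 + (r p₀ p₂ p₃ p₄)⁻¹)

section RulerValues

variable (W : PolarLattice) (ψ : W.H)

/-- The value of `Δ` on the rulers with the given slices. -/
def dVal (i j k l : ℕ) : ℝ := (inner ℂ ψ (dStd W ψ i j k l)).re

/-- The value of `I` on the rulers with the given slices. -/
def iVal (i j k l : ℕ) : ℝ := (inner ℂ ψ (iVec W ψ i j k l)).re

/-- The value of `𝔠_tot` on the rulers with the given slices. -/
def cVal (i j k l : ℕ) : ℝ := solveC (dVal W ψ i j k l) (iVal W ψ i j k l)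

/-- The value of `η` on the rulers with the given slices. -/
def eVal (i j k l : ℕ) : ℝ := Real.exp (-6 * dVal W ψ i j k l / cVal W ψ i j k l)

/-- The value of `η / (1 - η)` on the rulers with the given slices. -/
def rVal (i j k l : ℕ) : ℝ := eVal W ψ i j k l / (1 - eVal W ψ i j k l)

variable {W ψ}

theorem Ruler.lt₀₁ {n : ℕ} (D : Ruler n) : D.i₀ < D.i₁ := D.i₀_le_s.trans_lt D.s_lt_i₁

theorem Ruler.lt₁₂ {n : ℕ} (D : Ruler n) : D.i₁ < D.i₂ := D.i₁_le_m.trans_lt D.m_lt_i₂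

theorem Ruler.lt₂₃ {n : ℕ} (D : Ruler n) : D.i₂ < D.i₃ := D.i₂_le_t.trans_lt D.t_lt_i₃

theorem ΔVec_eq_dStd (hA1 : AxiomA1 W ψ) (D : Ruler W.n) :
    ΔVec W ψ D = dStd W ψ D.i₀ D.i₁ D.i₂ D.i₃ := by
  rw [ΔVec_eq, dVec_eq_dStd hA1 D.one_le_i₀ D.i₀_le_s D.s_lt_i₁ D.i₁_le_m D.m_lt_i₂ D.i₂_le_t
    D.t_lt_i₃ D.i₃_le]

theorem Δ_eq_dVal (hA1 : AxiomA1 W ψ) (D : Ruler W.n) :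
    Δ W ψ D = dVal W ψ D.i₀ D.i₁ D.i₂ D.i₃ := by
  rw [dVal, ← ΔVec_eq_dStd hA1, inner_ΔVec, Complex.ofReal_re]

theorem I_eq_iVal (D : Ruler W.n) : I W ψ D = iVal W ψ D.i₀ D.i₁ D.i₂ D.i₃ := by
  rw [iVal, inner_iVec, Complex.ofReal_re]

theorem ctot_eq_cVal (hA1 : AxiomA1 W ψ) (D : Ruler W.n) :
    ctot W ψ D = cVal W ψ D.i₀ D.i₁ D.i₂ D.i₃ := by
  rw [ctot, Δ_eq_dVal hA1, I_eq_iVal, cVal]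

theorem η_eq_eVal (hA1 : AxiomA1 W ψ) (D : Ruler W.n) :
    η W ψ D = eVal W ψ D.i₀ D.i₁ D.i₂ D.i₃ := by
  rw [η, ctot_eq_cVal hA1, Δ_eq_dVal hA1, eVal]

/-- The ruler with the given slices and a standard choice of the outer regions. -/
def stdRuler {n i j k l : ℕ} (hi : 1 ≤ i) (hij : i < j) (hjk : j < k) (hkl : k < l)
    (hl : l ≤ n + 1) : Ruler n where
  i₀ := i
  i₁ := j
  i₂ := k
  i₃ := l
  s := i
  m := j
  t := k
  one_le_i₀ := hi
  i₀_le_s := le_rfl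
  s_lt_i₁ := hij
  i₁_le_m := le_rfl
  m_lt_i₂ := hjk
  i₂_le_t := le_rfl
  t_lt_i₃ := hkl
  i₃_le := hl

section Values

variable {i j k l : ℕ}

theorem cVal_spec (hA1 : AxiomA1 W ψ) (hc : ∀ D : Ruler W.n, ctot W ψ D ≠ 0)
    (hi : 1 ≤ i) (hij : i < j) (hjk : j < k) (hkl : k < l) (hl : l ≤ W.n + 1) :
    0 < cVal W ψ i j k l ∧
      eVal W ψ i j k l + Real.exp (-6 * iVal W ψ i j k l / cVal W ψ i j k l) = 1 := by
  have h := ctot_spec (hc (stdRuler hi hij hjk hkl hl))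
  rwa [η_eq_eVal hA1, ctot_eq_cVal hA1, I_eq_iVal] at h

theorem eVal_pos : 0 < eVal W ψ i j k l := Real.exp_pos _

theorem eVal_lt_one (h : 0 < cVal W ψ i j k l ∧
    eVal W ψ i j k l + Real.exp (-6 * iVal W ψ i j k l / cVal W ψ i j k l) = 1) :
    eVal W ψ i j k l < 1 := by
  have := Real.exp_pos (-6 * iVal W ψ i j k l / cVal W ψ i j k l)
  linarith [h.2]

theorem rVal_pos (h : eVal W ψ i j k l < 1) : 0 < rVal W ψ i j k l :=
  div_pos eVal_pos (by linarith)

theorem eVal_eq (h : eVal W ψ i j k l < 1) :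
    eVal W ψ i j k l = rVal W ψ i j k l / (1 + rVal W ψ i j k l) := by
  have : 1 - eVal W ψ i j k l ≠ 0 := by linarith
  rw [rVal]
  field_simp
  ring

/-- By the defining equation 1 + r = 1/(1 - η) = exp(6 I / 𝔠). Likewise 1 + 1/r = 1/η = exp(6 Δ / 𝔠)
below. Thus I and Δ both become logarithms in r. -/
theorem cVal_mul_log_one_add (h : 0 < cVal W ψ i j k l ∧
    eVal W ψ i j k l + Real.exp (-6 * iVal W ψ i j k l / cVal W ψ i j k l) = 1) :
    cVal W ψ i j k l * Real.log (1 + rVal W ψ i j k l) = 6 * iVal W ψ i j k l := by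
  have h1 : 1 - eVal W ψ i j k l ≠ 0 := by linarith [eVal_lt_one h]
  have h2 : 1 + rVal W ψ i j k l =
      (Real.exp (-6 * iVal W ψ i j k l / cVal W ψ i j k l))⁻¹ := by
    rw [eq_sub_iff_add_eq'.2 h.2, rVal]
    field_simp
    ring
  have h3 := h.1.ne'
  rw [h2, Real.log_inv, Real.log_exp]
  field_simp

theorem cVal_mul_log_one_add_inv (h : 0 < cVal W ψ i j k l) (h1 : eVal W ψ i j k l < 1) :
    cVal W ψ i j k l * Real.log (1 + (rVal W ψ i j k l)⁻¹) = 6 * dVal W ψ i j k l := by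
  have h2 : 1 + (rVal W ψ i j k l)⁻¹ = (eVal W ψ i j k l)⁻¹ := by
    have := eVal_pos (W := W) (ψ := ψ) (i := i) (j := j) (k := k) (l := l)
    have : 1 - eVal W ψ i j k l ≠ 0 := by linarith
    rw [rVal]
    field_simp
    ring
  have h3 := h.ne'
  rw [h2, Real.log_inv, eVal, Real.log_exp]
  field_simp

/-- Modulo `ψ`, the vector `Î ψ` is `-η / (1 - η)` times `Δ̂ ψ`. -/
theorem exists_iVec_eq (hA1 : AxiomA1 W ψ) (hc : ∀ D : Ruler W.n, ctot W ψ D ≠ 0)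
    (hψ : ‖ψ‖ = 1) (hstat : Stationary W ψ)
    (hi : 1 ≤ i) (hij : i < j) (hjk : j < k) (hkl : k < l) (hl : l ≤ W.n + 1) :
    ∃ a : ℂ, iVec W ψ i j k l = a • ψ - (rVal W ψ i j k l : ℂ) • dStd W ψ i j k l := by
  have h1 := eVal_lt_one (cVal_spec hA1 hc hi hij hjk hkl hl)
  obtain ⟨a, ha⟩ := vector_fixed_point hψ hstat (hc (stdRuler hi hij hjk hkl hl))
  rw [η_eq_eVal hA1, ΔVec_eq_dStd hA1] at ha
  change (eVal W ψ i j k l : ℂ) • dStd W ψ i j k l +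
    ((1 - eVal W ψ i j k l : ℝ) : ℂ) • iVec W ψ i j k l = a • ψ at ha
  have h2 : ((1 - eVal W ψ i j k l : ℝ) : ℂ) ≠ 0 :=
    Complex.ofReal_ne_zero.2 (by linarith)
  refine ⟨((1 - eVal W ψ i j k l : ℝ) : ℂ)⁻¹ * a, ?_⟩
  rw [mul_smul, ← ha, smul_add, smul_smul, smul_smul, inv_mul_cancel₀ h2, one_smul, rVal,
    Complex.ofReal_div, div_eq_inv_mul, add_sub_cancel_left]

end Values

theorem dStd_linearIndependent (hA1 : AxiomA1 W ψ) (hgen : Generic W ψ) {p₀ p₁ p₂ p₃ p₄ : ℕ}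
    (h0 : 1 ≤ p₀) (h01 : p₀ < p₁) (h12 : p₁ < p₂) (h23 : p₂ < p₃) (h34 : p₃ < p₄)
    (hn : p₄ ≤ W.n + 1) {x y z : ℂ}
    (h : x • dStd W ψ p₀ p₁ p₂ p₃ + y • dStd W ψ p₁ p₂ p₃ p₄ + z • ψ = 0) : x = 0 ∧ y = 0 := by
  have hl := hgen (stdRuler h0 h01 h12 h23 (h34.le.trans hn))
    (stdRuler (h0.trans h01.le) h12 h23 h34 hn) ⟨rfl, rfl, rfl, rfl, rfl⟩
  rw [ΔVec_eq_dStd hA1, ΔVec_eq_dStd hA1, Fintype.linearIndependent_iff] at hl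
  have := hl ![x, y, z] (by rw [Fin.sum_univ_three]; exact h)
  exact ⟨this 0, this 1⟩

theorem dVal_extend_right (hA1 : AxiomA1 W ψ) {p₀ p₁ p₂ p₃ p₄ : ℕ} (h0 : 1 ≤ p₀) (h01 : p₀ < p₁)
    (h12 : p₁ < p₂) (h23 : p₂ < p₃) (h34 : p₃ < p₄) (hn : p₄ ≤ W.n + 1) :
    dVal W ψ p₀ p₁ p₂ p₄ = dVal W ψ p₀ p₁ p₂ p₃ - iVal W ψ p₁ p₂ p₃ p₄ := by
  rw [dVal, dStd_extend_right hA1 h0 h01 h12 h23 h34 hn, inner_sub_right, Complex.sub_re]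
  rfl

theorem dVal_extend_left (hA1 : AxiomA1 W ψ) {p₀ p₁ p₂ p₃ p₄ : ℕ} (h0 : 1 ≤ p₀) (h01 : p₀ < p₁)
    (h12 : p₁ < p₂) (h23 : p₂ < p₃) (h34 : p₃ < p₄) (hn : p₄ ≤ W.n + 1) :
    dVal W ψ p₀ p₂ p₃ p₄ = dVal W ψ p₁ p₂ p₃ p₄ - iVal W ψ p₀ p₁ p₂ p₃ := by
  rw [dVal, dStd_extend_left hA1 h0 h01 h12 h23 h34 hn, inner_sub_right, Complex.sub_re]
  rfl

theorem dVal_add (hA1 : AxiomA1 W ψ) {p₀ p₁ p₂ p₃ p₄ : ℕ} (h0 : 1 ≤ p₀) (h01 : p₀ < p₁)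
    (h12 : p₁ < p₂) (h23 : p₂ < p₃) (h34 : p₃ < p₄) (hn : p₄ ≤ W.n + 1) :
    dVal W ψ p₀ p₁ p₃ p₄ = dVal W ψ p₀ p₁ p₂ p₄ + dVal W ψ p₀ p₂ p₃ p₄ := by
  rw [dVal, dStd_add hA1 h0 h01 h12 h23 h34 hn, inner_add_right, Complex.add_re]
  rfl

theorem iVal_extend_right {p₀ p₁ p₂ p₃ p₄ : ℕ} :
    iVal W ψ p₀ p₁ p₂ p₄ = iVal W ψ p₀ p₁ p₂ p₃ + iVal W ψ p₀ p₁ p₃ p₄ := by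
  rw [iVal, iVec_extend_right, inner_add_right, Complex.add_re]
  rfl

theorem iVal_extend_left {p₀ p₁ p₂ p₃ p₄ : ℕ} :
    iVal W ψ p₀ p₂ p₃ p₄ = iVal W ψ p₁ p₂ p₃ p₄ + iVal W ψ p₀ p₁ p₃ p₄ := by
  rw [iVal, iVec_extend_left, inner_add_right, Complex.add_re]
  rfl

/-- Write δ₁, δ₂ for Δ̂ψ on the two overlapping rulers and work modulo ψ. Substituting Î = -r Δ̂ in
the extension relations gives δ₁ + r₂ δ₂ and δ₂ + r₁ δ₁ for the extended rulers, and their sum for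
the ruler with middle sector BC. The two additivity relations for Î become vector equations in the
independent δ₁, δ₂, with two coefficients each. -/
theorem ratio_relations (hA1 : AxiomA1 W ψ) (hc : ∀ D : Ruler W.n, ctot W ψ D ≠ 0)
    (hψ : ‖ψ‖ = 1) (hstat : Stationary W ψ) (hgen : Generic W ψ) {p₀ p₁ p₂ p₃ p₄ : ℕ}
    (h0 : 1 ≤ p₀) (h01 : p₀ < p₁) (h12 : p₁ < p₂) (h23 : p₂ < p₃) (h34 : p₃ < p₄)
    (hn : p₄ ≤ W.n + 1) :
    (rVal W ψ p₀ p₁ p₂ p₄ = rVal W ψ p₀ p₁ p₂ p₃ +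
        rVal W ψ p₀ p₁ p₃ p₄ * (1 + rVal W ψ p₀ p₁ p₂ p₃) ∧
      rVal W ψ p₀ p₁ p₃ p₄ * (1 + rVal W ψ p₁ p₂ p₃ p₄) =
        rVal W ψ p₀ p₁ p₂ p₄ * rVal W ψ p₁ p₂ p₃ p₄) ∧
    (rVal W ψ p₀ p₂ p₃ p₄ = rVal W ψ p₁ p₂ p₃ p₄ +
        rVal W ψ p₀ p₁ p₃ p₄ * (1 + rVal W ψ p₁ p₂ p₃ p₄) ∧
      rVal W ψ p₀ p₁ p₃ p₄ * (1 + rVal W ψ p₀ p₁ p₂ p₃) =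
        rVal W ψ p₀ p₂ p₃ p₄ * rVal W ψ p₀ p₁ p₂ p₃) := by
  have ex := fun {i j k l : ℕ} => exists_iVec_eq (i := i) (j := j) (k := k) (l := l)
    hA1 hc hψ hstat
  obtain ⟨a1, e1⟩ := ex h0 h01 h12 h23 (h34.le.trans hn)
  obtain ⟨a2, e2⟩ := ex (h0.trans h01.le) h12 h23 h34 hn
  obtain ⟨a3, e3⟩ := ex h0 h01 (h12.trans h23) h34 hn
  obtain ⟨a4, e4⟩ := ex h0 h01 h12 (h23.trans h34) hn
  obtain ⟨a5, e5⟩ := ex h0 (h01.trans h12) h23 h34 hn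
  have d4 := dStd_extend_right hA1 h0 h01 h12 h23 h34 hn
  have d5 := dStd_extend_left hA1 h0 h01 h12 h23 h34 hn
  have d3 := dStd_add hA1 h0 h01 h12 h23 h34 hn
  have i4 := iVec_extend_right (W := W) (ψ := ψ) (p₀ := p₀) (p₁ := p₁) (p₂ := p₂) (p₃ := p₃)
    (p₄ := p₄)
  have i5 := iVec_extend_left (W := W) (ψ := ψ) (p₀ := p₀) (p₁ := p₁) (p₂ := p₂) (p₃ := p₃)
    (p₄ := p₄)
  have li := fun {x y z : ℂ} => dStd_linearIndependent hA1 hgen (x := x) (y := y) (z := z)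
    h0 h01 h12 h23 h34 hn
  generalize rVal W ψ p₀ p₁ p₂ p₃ = r1 at *
  generalize rVal W ψ p₁ p₂ p₃ p₄ = r2 at *
  generalize rVal W ψ p₀ p₁ p₃ p₄ = r3 at *
  generalize rVal W ψ p₀ p₁ p₂ p₄ = r4 at *
  generalize rVal W ψ p₀ p₂ p₃ p₄ = r5 at *
  generalize dStd W ψ p₀ p₁ p₂ p₃ = δ1 at *
  generalize dStd W ψ p₁ p₂ p₃ p₄ = δ2 at *
  rw [e2] at d4
  rw [e1] at d5
  rw [d4, d5] at d3
  rw [e1, e3, e4, d3, d4] at i4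
  rw [e2, e3, e5, d3, d5] at i5
  have k4 := li (x := r4 - (r1 + r3 * (1 + r1))) (y := r4 * r2 - r3 * (1 + r2))
    (z := -a4 - r4 * a2 + a1 + a3 + r3 * (a1 + a2)) (by
      linear_combination (norm := module) -i4)
  have k5 := li (x := r5 * r1 - r3 * (1 + r1)) (y := r5 - (r2 + r3 * (1 + r2)))
    (z := -a5 - r5 * a1 + a2 + a3 + r3 * (a1 + a2)) (by
      linear_combination (norm := module) -i5)
  obtain ⟨u1, u2⟩ := k4
  obtain ⟨u3, u4⟩ := k5
  norm_cast at u1 u2 u3 u4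
  exact ⟨⟨by linarith, by linarith⟩, by linarith, by linarith⟩

/-- A stationary generic state defines a five-point system. -/
theorem fivePointSystem (hA1 : AxiomA1 W ψ) (hc : ∀ D : Ruler W.n, ctot W ψ D ≠ 0)
    (hψ : ‖ψ‖ = 1) (hstat : Stationary W ψ) (hgen : Generic W ψ) :
    FivePointSystem (W.n + 1) (cVal W ψ) (rVal W ψ) := by
  have sp := fun {i j k l : ℕ} => cVal_spec (i := i) (j := j) (k := k) (l := l) hA1 hc
  have li := fun {i j k l : ℕ} (h1 : 1 ≤ i) (h2 : i < j) (h3 : j < k) (h4 : k < l)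
    (h5 : l ≤ W.n + 1) => cVal_mul_log_one_add (sp h1 h2 h3 h4 h5)
  have ld := fun {i j k l : ℕ} (h1 : 1 ≤ i) (h2 : i < j) (h3 : j < k) (h4 : k < l)
    (h5 : l ≤ W.n + 1) => cVal_mul_log_one_add_inv (sp h1 h2 h3 h4 h5).1
      (eVal_lt_one (sp h1 h2 h3 h4 h5))
  constructor
  · intro i j k l h1 h2 h3 h4 h5
    exact rVal_pos (eVal_lt_one (sp h1 h2 h3 h4 h5))
  · intro p₀ p₁ p₂ p₃ p₄ h0 h01 h12 h23 h34 hn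
    exact (ratio_relations hA1 hc hψ hstat hgen h0 h01 h12 h23 h34 hn).1
  · intro p₀ p₁ p₂ p₃ p₄ h0 h01 h12 h23 h34 hn
    exact (ratio_relations hA1 hc hψ hstat hgen h0 h01 h12 h23 h34 hn).2
  · intro p₀ p₁ p₂ p₃ p₄ h0 h01 h12 h23 h34 hn
    rw [li h0 h01 h12 (h23.trans h34) hn, li h0 h01 h12 h23 (h34.le.trans hn),
      li h0 h01 (h12.trans h23) h34 hn, ld h0 h01 h12 (h23.trans h34) hn,
      ld h0 h01 h12 h23 (h34.le.trans hn), li (h0.trans h01.le) h12 h23 h34 hn,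
      dVal_extend_right hA1 h0 h01 h12 h23 h34 hn,
      iVal_extend_right (p₀ := p₀) (p₁ := p₁) (p₂ := p₂) (p₃ := p₃) (p₄ := p₄)]
    constructor <;> ring
  · intro p₀ p₁ p₂ p₃ p₄ h0 h01 h12 h23 h34 hn
    rw [li h0 (h01.trans h12) h23 h34 hn, li (h0.trans h01.le) h12 h23 h34 hn,
      li h0 h01 (h12.trans h23) h34 hn, ld h0 (h01.trans h12) h23 h34 hn,
      ld (h0.trans h01.le) h12 h23 h34 hn, li h0 h01 h12 h23 (h34.le.trans hn),
      dVal_extend_left hA1 h0 h01 h12 h23 h34 hn,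
      iVal_extend_left (p₀ := p₀) (p₁ := p₁) (p₂ := p₂) (p₃ := p₃) (p₄ := p₄)]
    constructor <;> ring
  · intro p₀ p₁ p₂ p₃ p₄ h0 h01 h12 h23 h34 hn
    rw [ld h0 h01 (h12.trans h23) h34 hn, ld h0 h01 h12 (h23.trans h34) hn,
      ld h0 (h01.trans h12) h23 h34 hn, dVal_add hA1 h0 h01 h12 h23 h34 hn]
    ring

end RulerValues

/-! ### The five constants agree -/

section LogRelations

/-- A linear system whose only solution is zero. -/
theorem eq_zero_of_log_relations {L₁ L₂ L₃ M₁ n₁ n₂ d₁ d₂ d₄ : ℝ} (hL₁ : 0 < L₁) (hL₂ : 0 < L₂)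
    (hL₃ : 0 < L₃) (hM : L₂ < M₁) (hn₂ : n₂ < 0) (hn : n₁ + n₂ < 0)
    (ha : d₄ * (L₁ + L₃) = d₁ * L₁) (hb : d₄ * (M₁ - L₂) = d₁ * M₁ - d₂ * L₂)
    (he : d₁ * n₁ + d₂ * n₂ = 0) : d₁ = 0 := by
  -- Elimination of d₂ and d₄; the remaining factor is the determinant, and each of its terms is
  -- negative.
  have key : d₁ * (L₁ * L₂ * (n₁ + n₂) + L₃ * (L₂ * (n₁ + n₂) + n₂ * (M₁ - L₂))) = 0 := by
    linear_combination (L₂ * (L₁ + L₃)) * he + n₂ * (M₁ - L₂) * ha - n₂ * (L₁ + L₃) * hb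
  refine (mul_eq_zero.1 key).resolve_right (ne_of_lt ?_)
  have h1 : L₁ * L₂ * (n₁ + n₂) < 0 := mul_neg_of_pos_of_neg (mul_pos hL₁ hL₂) hn
  have h2 : L₂ * (n₁ + n₂) < 0 := mul_neg_of_pos_of_neg hL₂ hn
  have h3 : n₂ * (M₁ - L₂) < 0 := mul_neg_of_neg_of_pos hn₂ (by linarith)
  have h4 : L₃ * (L₂ * (n₁ + n₂) + n₂ * (M₁ - L₂)) < 0 :=
    mul_neg_of_pos_of_neg hL₃ (by linarith)
  linarith

theorem log_one_add_inv {r : ℝ} (hr : 0 < r) :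
    Real.log (1 + r⁻¹) = Real.log (1 + r) - Real.log r := by
  rw [← Real.log_div (by positivity) hr.ne']
  congr 1
  field_simp
  ring

/-- The constants of the five rulers on five points agree. -/
theorem eq_of_five_relations {c₁ c₂ c₃ c₄ c₅ r₁ r₂ r₃ r₄ r₅ : ℝ} (h₁ : 0 < r₁) (h₂ : 0 < r₂)
    (h₃ : 0 < r₃) (h₄ : 0 < r₄) (h₅ : 0 < r₅)
    (e₄ : r₄ = r₁ + r₃ * (1 + r₁)) (e₄' : r₃ * (1 + r₂) = r₄ * r₂)
    (e₅ : r₅ = r₂ + r₃ * (1 + r₂)) (e₅' : r₃ * (1 + r₁) = r₅ * r₁)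
    (i₄ : c₄ * Real.log (1 + r₄) = c₁ * Real.log (1 + r₁) + c₃ * Real.log (1 + r₃))
    (d₄ : c₄ * Real.log (1 + r₄⁻¹) = c₁ * Real.log (1 + r₁⁻¹) - c₂ * Real.log (1 + r₂))
    (i₅ : c₅ * Real.log (1 + r₅) = c₂ * Real.log (1 + r₂) + c₃ * Real.log (1 + r₃))
    (d₅ : c₅ * Real.log (1 + r₅⁻¹) = c₂ * Real.log (1 + r₂⁻¹) - c₁ * Real.log (1 + r₁))
    (d₃ : c₃ * Real.log (1 + r₃⁻¹) = c₄ * Real.log (1 + r₄⁻¹) + c₅ * Real.log (1 + r₅⁻¹)) :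
    c₁ = c₃ ∧ c₂ = c₃ ∧ c₄ = c₃ ∧ c₅ = c₃ := by
  -- That is, r₃ = r₁ r₂ / (1 - r₁ r₂); positivity of r₃ forces r₁ r₂ < 1, the source of all signs
  -- below.
  have e₃ : r₃ * (1 - r₁ * r₂) = r₁ * r₂ := by rw [e₄] at e₄'; linarith
  have h12 : r₁ * r₂ < 1 := by
    by_contra h
    have : r₃ * (1 - r₁ * r₂) ≤ 0 := mul_nonpos_of_nonneg_of_nonpos h₃.le (by linarith)
    have : 0 < r₁ * r₂ := mul_pos h₁ h₂
    linarith
  -- The ratio relations alone give all logarithmic relations with every constant equal to 1.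
  -- Subtracting c₃ times these leaves a homogeneous system for the differences of constants.
  have l₄ : Real.log (1 + r₄) = Real.log (1 + r₁) + Real.log (1 + r₃) := by
    rw [← Real.log_mul (by positivity) (by positivity), e₄]
    congr 1; ring
  have l₅ : Real.log (1 + r₅) = Real.log (1 + r₂) + Real.log (1 + r₃) := by
    rw [← Real.log_mul (by positivity) (by positivity), e₅]
    congr 1; ring
  have m₄ : Real.log (1 + r₄⁻¹) = Real.log (1 + r₁⁻¹) - Real.log (1 + r₂) := by
    rw [← Real.log_div (by positivity) (by positivity)]
    congr 1
    rw [show r₄ = r₃ * (1 + r₂) / r₂ by rw [e₄']; field_simp]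
    field_simp
    linear_combination -e₃
  have m₅ : Real.log (1 + r₅⁻¹) = Real.log (1 + r₂⁻¹) - Real.log (1 + r₁) := by
    rw [← Real.log_div (by positivity) (by positivity)]
    congr 1
    rw [show r₅ = r₃ * (1 + r₁) / r₁ by rw [e₅']; field_simp]
    field_simp
    linear_combination -e₃
  have m₃ : Real.log (1 + r₃⁻¹) = Real.log (1 + r₄⁻¹) + Real.log (1 + r₅⁻¹) := by
    rw [m₄, m₅, log_one_add_inv h₁, log_one_add_inv h₂]
    have : 1 + r₃⁻¹ = (r₁ * r₂)⁻¹ := by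
      field_simp
      linarith
    rw [this, Real.log_inv, Real.log_mul h₁.ne' h₂.ne']
    ring
  have L : ∀ {r : ℝ}, 0 < r → 0 < Real.log (1 + r) := fun h => Real.log_pos (by linarith)
  have p₄ := L (inv_pos.2 h₄)
  have p₅ := L (inv_pos.2 h₅)
  rw [m₄] at p₄
  rw [m₅] at p₅
  have n12 : Real.log r₁ + Real.log r₂ < 0 := by
    rw [← Real.log_mul h₁.ne' h₂.ne']
    exact Real.log_neg (mul_pos h₁ h₂) h12
  rw [m₃, m₄, m₅] at d₃
  rw [l₄] at i₄
  rw [l₅] at i₅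
  rw [m₄] at d₄
  rw [m₅] at d₅
  have q₁ := log_one_add_inv h₁
  have q₂ := log_one_add_inv h₂
  have he : (c₁ - c₃) * Real.log r₁ + (c₂ - c₃) * Real.log r₂ = 0 := by
    linear_combination d₃ + d₄ + d₅ + (c₁ - c₃) * q₁ + (c₂ - c₃) * q₂
  have ha : (c₄ - c₃) * (Real.log (1 + r₁) + Real.log (1 + r₃)) = (c₁ - c₃) * Real.log (1 + r₁) := by
    linear_combination i₄
  have ha' : (c₅ - c₃) * (Real.log (1 + r₂) + Real.log (1 + r₃)) =
      (c₂ - c₃) * Real.log (1 + r₂) := by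
    linear_combination i₅
  have hb : (c₄ - c₃) * (Real.log (1 + r₁⁻¹) - Real.log (1 + r₂)) =
      (c₁ - c₃) * Real.log (1 + r₁⁻¹) - (c₂ - c₃) * Real.log (1 + r₂) := by
    linear_combination d₄
  have hb' : (c₅ - c₃) * (Real.log (1 + r₂⁻¹) - Real.log (1 + r₁)) =
      (c₂ - c₃) * Real.log (1 + r₂⁻¹) - (c₁ - c₃) * Real.log (1 + r₁) := by
    linear_combination d₅
  -- Since r₁ r₂ < 1, at least one of log r₁, log r₂ is negative; the system is symmetric under
  -- exchanging 1 and 2.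
  have both : c₁ - c₃ = 0 ∧ c₂ - c₃ = 0 := by
    rcases lt_or_ge (Real.log r₂) 0 with hn | hn
    · have z := eq_zero_of_log_relations (L h₁) (L h₂) (L h₃) (by linarith) hn n12 ha hb he
      rw [z, zero_mul, zero_add] at he
      exact ⟨z, (mul_eq_zero.1 he).resolve_right hn.ne⟩
    · have hn' : Real.log r₁ < 0 := by linarith
      have z := eq_zero_of_log_relations (L h₂) (L h₁) (L h₃) (by linarith) hn' (by linarith) ha' hb'
        (by linarith)
      rw [z, zero_mul, add_zero] at he
      exact ⟨(mul_eq_zero.1 he).resolve_right hn'.ne, z⟩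
  rw [both.1, zero_mul] at ha
  rw [both.2, zero_mul] at ha'
  have s₄ := (mul_eq_zero.1 ha).resolve_right (by have := L h₁; have := L h₃; positivity)
  have s₅ := (mul_eq_zero.1 ha').resolve_right (by have := L h₂; have := L h₃; positivity)
  exact ⟨by linarith, by linarith, by linarith, by linarith⟩

end LogRelations

/-! ### One constant for all divisions -/

namespace FivePointSystem

variable {N : ℕ} {c r : ℕ → ℕ → ℕ → ℕ → ℝ}

theorem five_eq (h : FivePointSystem N c r) {p₀ p₁ p₂ p₃ p₄ : ℕ} (h0 : 1 ≤ p₀) (h01 : p₀ < p₁)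
    (h12 : p₁ < p₂) (h23 : p₂ < p₃) (h34 : p₃ < p₄) (hN : p₄ ≤ N) :
    c p₁ p₂ p₃ p₄ = c p₀ p₁ p₂ p₃ ∧ c p₀ p₁ p₃ p₄ = c p₀ p₁ p₂ p₃ ∧
      c p₀ p₁ p₂ p₄ = c p₀ p₁ p₂ p₃ ∧ c p₀ p₂ p₃ p₄ = c p₀ p₁ p₂ p₃ := by
  obtain ⟨e1, e2, e4, e5⟩ := eq_of_five_relations (h.r_pos h0 h01 h12 h23 (h34.le.trans hN))
    (h.r_pos (h0.trans h01.le) h12 h23 h34 hN) (h.r_pos h0 h01 (h12.trans h23) h34 hN)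
    (h.r_pos h0 h01 h12 (h23.trans h34) hN) (h.r_pos h0 (h01.trans h12) h23 h34 hN)
    (h.ratio_right h0 h01 h12 h23 h34 hN).1 (h.ratio_right h0 h01 h12 h23 h34 hN).2
    (h.ratio_left h0 h01 h12 h23 h34 hN).1 (h.ratio_left h0 h01 h12 h23 h34 hN).2
    (h.log_right h0 h01 h12 h23 h34 hN).1 (h.log_right h0 h01 h12 h23 h34 hN).2
    (h.log_left h0 h01 h12 h23 h34 hN).1 (h.log_left h0 h01 h12 h23 h34 hN).2
    (h.log_middle h0 h01 h12 h23 h34 hN)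
  rw [e1, e2, e4, e5]
  exact ⟨rfl, rfl, rfl, rfl⟩

/-- The constant is the same for all divisions. -/
theorem c_eq (h : FivePointSystem N c r) {i j k l : ℕ} (hi : 1 ≤ i) (hij : i < j) (hjk : j < k)
    (hkl : k < l) (hl : l ≤ N) : c i j k l = c 1 2 3 4 := by
  -- Each five-point coincidence changes one division point. The third, second and first sectors are
  -- shrunk to single slices in turn, and then the triple is translated to the start.
  have s1 : c i j k l = c i j k (k + 1) := by
    rcases (show k + 1 ≤ l from hkl).eq_or_lt with rfl | hlt
    · rfl
    · exact (h.five_eq hi hij hjk (Nat.lt_succ_self k) hlt hl).2.2.1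
  have s2 : c i j k (k + 1) = c i j (j + 1) (j + 2) := by
    rcases (show j + 1 ≤ k from hjk).eq_or_lt with rfl | hlt
    · rfl
    · rw [(h.five_eq hi hij (Nat.lt_succ_self j) hlt (Nat.lt_succ_self k) (by omega)).2.1]
      rcases (show j + 2 ≤ k from hlt).eq_or_lt with rfl | hlt'
      · rfl
      · exact (h.five_eq hi hij (Nat.lt_succ_self j) (Nat.lt_succ_self (j + 1)) hlt'
          (by omega)).2.2.1
  have s3 : c i j (j + 1) (j + 2) = c i (i + 1) (i + 2) (i + 3) := by
    have s : ∀ j, i + 1 ≤ j → j + 2 ≤ N → c i j (j + 1) (j + 2) = c i (i + 1) (i + 2) (i + 3) := by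
      intro j hj
      induction j, hj using Nat.le_induction with
      | base => exact fun _ => rfl
      | succ j hj ih =>
        intro hN
        have f := h.five_eq hi (show i < j by omega) (Nat.lt_succ_self j)
          (Nat.lt_succ_self (j + 1)) (Nat.lt_succ_self (j + 2)) hN
        rw [← ih (by omega)]
        exact f.2.2.2
    exact s j hij (by omega)
  have s4 : ∀ i, 1 ≤ i → i + 3 ≤ N → c i (i + 1) (i + 2) (i + 3) = c 1 2 3 4 := by
    intro i hi
    induction i, hi using Nat.le_induction with
    | base => exact fun _ => rfl
    | succ i hi ih =>
      intro hN
      rw [← ih (by omega)]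
      exact (h.five_eq hi (Nat.lt_succ_self i) (Nat.lt_succ_self (i + 1))
        (Nat.lt_succ_self (i + 2)) (Nat.lt_succ_self (i + 3)) hN).1
  rw [s1, s2, s3, s4 i hi (by omega)]

end FivePointSystem

/-! ### Reconstruction of points on a circle from their cross-ratios -/

theorem sin_arctan_sub_arctan (x y : ℝ) : Real.sin (Real.arctan y - Real.arctan x) =
    (y - x) * (Real.cos (Real.arctan y) * Real.cos (Real.arctan x)) := by
  have h : ∀ z, Real.sin (Real.arctan z) = z * Real.cos (Real.arctan z) := fun z => by
    have := Real.tan_mul_cos (Real.cos_arctan_pos z).ne'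
    rw [Real.tan_arctan] at this
    exact this.symm
  rw [Real.sin_sub, h, h]
  ring

namespace FivePointSystem

variable {N : ℕ} {c r : ℕ → ℕ → ℕ → ℕ → ℝ}

/-- Affine coordinates of the points `2, …, N` on the projective line, the point `1` lying at
infinity. -/
def coord (r : ℕ → ℕ → ℕ → ℕ → ℝ) (k : ℕ) : ℝ :=
  if k ≤ 2 then 0 else if k = 3 then 1 else 1 + r 1 2 3 k

theorem coord_two : coord r 2 = 0 := rfl

theorem coord_three : coord r 3 = 1 := rfl

theorem coord_of_lt {k : ℕ} (h : 3 < k) : coord r k = 1 + r 1 2 3 k := by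
  rw [coord, if_neg (by omega), if_neg (by omega)]

theorem coord_pos (h : FivePointSystem N c r) {k : ℕ} (h3 : 3 ≤ k) (hk : k ≤ N) :
    0 < coord r k := by
  rcases h3.eq_or_lt with rfl | h3
  · exact one_pos
  · rw [coord_of_lt h3]
    linarith [h.r_pos le_rfl (show 1 < 2 by omega) (show 2 < 3 by omega) h3 hk]

/-- With point 1 at infinity and point 2 at 0, 1 + r(1,2,k,l) is the quotient of two coordinates.
`ratio_right` says that these quantities multiply along 3 < k < l. -/
theorem coord_ratio (h : FivePointSystem N c r) {k l : ℕ} (h3 : 3 ≤ k) (hkl : k < l) (hl : l ≤ N) :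
    coord r l = coord r k * (1 + r 1 2 k l) := by
  rcases h3.eq_or_lt with rfl | h3
  · rw [coord_of_lt hkl, coord_three, one_mul]
  · rw [coord_of_lt h3, coord_of_lt (h3.trans hkl),
      (h.ratio_right (p₀ := 1) (p₁ := 2) (p₂ := 3) le_rfl (by omega) (by omega) h3 hkl hl).1]
    ring

theorem coord_lt (h : FivePointSystem N c r) {k l : ℕ} (h2 : 2 ≤ k) (hkl : k < l) (hl : l ≤ N) :
    coord r k < coord r l := by
  rcases h2.eq_or_lt with rfl | h2
  · exact h.coord_pos hkl hl
  · rw [h.coord_ratio h2 hkl hl]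
    have := mul_pos (h.coord_pos h2 (hkl.le.trans hl))
      (h.r_pos le_rfl (show 1 < 2 by omega) h2 hkl hl)
    linarith

/-- With one point at infinity the cross-ratio degenerates to a quotient of two differences. -/
theorem ratio_one (h : FivePointSystem N c r) {j k l : ℕ} (h2 : 2 ≤ j) (hjk : j < k) (hkl : k < l)
    (hl : l ≤ N) : r 1 j k l * (coord r k - coord r j) = coord r l - coord r k := by
  rcases h2.eq_or_lt with rfl | h2
  · rw [coord_two, h.coord_ratio hjk hkl hl]
    ring
  · have e := (h.ratio_left (p₀ := 1) (p₁ := 2) le_rfl (by omega) h2 hjk hkl hl).2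
    rw [h.coord_ratio (h2.trans hjk) hkl hl, h.coord_ratio h2 hjk (by omega)]
    linear_combination (-coord r j) * e

/-- The five points 1, i, j, k, l express a general cross-ratio through two that involve the point
at infinity. -/
theorem ratio_coord (h : FivePointSystem N c r) {i j k l : ℕ} (h2 : 2 ≤ i) (hij : i < j)
    (hjk : j < k) (hkl : k < l) (hl : l ≤ N) :
    r i j k l * ((coord r k - coord r j) * (coord r l - coord r i)) =
      (coord r j - coord r i) * (coord r l - coord r k) := by
  have e := (h.ratio_right (p₀ := 1) le_rfl h2 hij hjk hkl hl).2
  have a := h.ratio_one h2 hij (hjk.trans hkl) hl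
  have b := h.ratio_one h2 (hij.trans hjk) hkl hl
  linear_combination (-(coord r k - coord r i) * (coord r j - coord r i)) * e -
    r i j k l * (coord r k - coord r i) * a + (1 + r i j k l) * (coord r j - coord r i) * b

/-- Every five-point system comes from points on a circle. -/
theorem exists_angles (h : FivePointSystem N c r) :
    ∃ θ : ℕ → ℝ, (∀ i j, 1 ≤ i → i < j → j ≤ N → θ i < θ j) ∧ θ N - θ 1 < 2 * Real.pi ∧
      ∀ i j k l, 1 ≤ i → i < j → j < k → k < l → l ≤ N →
        r i j k l * (Real.sin ((θ k - θ j) / 2) * Real.sin ((θ l - θ i) / 2)) =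
          Real.sin ((θ j - θ i) / 2) * Real.sin ((θ l - θ k) / 2) := by
  -- Inverse stereographic projection: the point at infinity goes to -π and all others into (-π, π),
  -- which also bounds the total angle by 2π.
  set θ : ℕ → ℝ := fun k => if k ≤ 1 then -Real.pi else 2 * Real.arctan (coord r k) with hθ
  have t1 : θ 1 = -Real.pi := rfl
  have t2 : ∀ {k}, 2 ≤ k → θ k = 2 * Real.arctan (coord r k) := fun {k} hk => by
    simp only [hθ]
    rw [if_neg (by omega)]
  -- A half-angle sine is a coordinate difference times one factor for each endpoint; these factors
  -- cancel in cross-ratios.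
  have sd : ∀ {k l}, 2 ≤ k → 2 ≤ l → Real.sin ((θ l - θ k) / 2) = (coord r l - coord r k) *
      (Real.cos (Real.arctan (coord r l)) * Real.cos (Real.arctan (coord r k))) := by
    intro k l hk hl
    rw [t2 hk, t2 hl, ← sin_arctan_sub_arctan]
    congr 1; ring
  have s1 : ∀ {l}, 2 ≤ l → Real.sin ((θ l - θ 1) / 2) = Real.cos (Real.arctan (coord r l)) := by
    intro l hl
    rw [t2 hl, t1, ← Real.sin_add_pi_div_two]
    congr 1; ring
  refine ⟨θ, fun i j hi hij hj => ?_, ?_, fun i j k l hi hij hjk hkl hl => ?_⟩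
  · rw [t2 (show 2 ≤ j by omega)]
    rcases hi.eq_or_lt with rfl | hi
    · rw [t1]
      linarith [Real.neg_pi_div_two_lt_arctan (coord r j)]
    · rw [t2 hi]
      linarith [Real.arctan_strictMono (h.coord_lt hi hij hj)]
  · rw [t1]
    have := Real.pi_pos
    rcases le_or_gt N 1 with hN | hN
    · have : θ N = -Real.pi := if_pos hN
      linarith
    · rw [t2 hN]
      linarith [Real.arctan_lt_pi_div_two (coord r N)]
  · rw [sd (show 2 ≤ j by omega) (show 2 ≤ k by omega), sd (show 2 ≤ k by omega) (show 2 ≤ l by omega)]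
    rcases hi.eq_or_lt with rfl | hi
    · rw [s1 (show 2 ≤ l by omega), s1 hij, ← h.ratio_one hij hjk hkl hl]
      ring
    · rw [sd hi (show 2 ≤ l by omega), sd hi (show 2 ≤ j by omega)]
      linear_combination (Real.cos (Real.arctan (coord r k)) * Real.cos (Real.arctan (coord r j)) *
        Real.cos (Real.arctan (coord r l)) * Real.cos (Real.arctan (coord r i))) *
        h.ratio_coord hi hij hjk hkl hl

end FivePointSystem

/-! ### Existence of intrinsic angles -/

section IntrinsicAngles

/-- Ptolemy's identity for chords of a circle; it passes between η / (1 - η) and η. -/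
theorem sin_cross_identity (a b c : ℝ) : Real.sin (a + b) * Real.sin (b + c) =
    Real.sin b * Real.sin (a + b + c) + Real.sin a * Real.sin c := by
  simp only [Real.sin_add, Real.cos_add]
  linear_combination (Real.sin a * Real.sin c) * Real.sin_sq_add_cos_sq b

/-- The cross-ratio `η` of a ratio `η / (1 - η)` given by sines. -/
theorem etaGeo_eq {a b c ρ : ℝ} (ha : 0 < a) (hb : 0 < b) (hc : 0 < c)
    (hs : a + b + c < 2 * Real.pi)
    (h : ρ * (Real.sin (b / 2) * Real.sin ((a + b + c) / 2)) = Real.sin (a / 2) * Real.sin (c / 2)) :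
    ρ / (1 + ρ) = etaGeo a b c := by
  have p : ∀ {x}, 0 < x → x < 2 * Real.pi → 0 < Real.sin (x / 2) := fun h1 h2 =>
    Real.sin_pos_of_pos_of_lt_pi (by linarith) (by linarith)
  have pa := p ha (by linarith)
  have pb := p hb (by linarith)
  have pc := p hc (by linarith)
  have ps := p (show 0 < a + b + c by linarith) hs
  have hρ : 0 < ρ := by
    have : 0 < ρ * (Real.sin (b / 2) * Real.sin ((a + b + c) / 2)) := by rw [h]; positivity
    exact pos_of_mul_pos_left this (by positivity)
  have id := sin_cross_identity (a / 2) (b / 2) (c / 2)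
  rw [show a / 2 + b / 2 + c / 2 = (a + b + c) / 2 by ring] at id
  rw [etaGeo, show (a + b) / 2 = a / 2 + b / 2 by ring, show (b + c) / 2 = b / 2 + c / 2 by ring, id,
    ← h]
  field_simp

theorem angle_sub (θ : ℕ → ℝ) {i j : ℕ} (hij : i ≤ j) :
    angle (fun x => θ (x + 1) - θ x) i j = θ j - θ i := by
  rw [angle, Finset.sum_Ico_sub θ hij]

theorem exists_intrinsicAngles {W : PolarLattice} {ψ : W.H} (hA1 : AxiomA1 W ψ)
    (hc : ∀ D : Ruler W.n, ctot W ψ D ≠ 0)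
    (hψ : ‖ψ‖ = 1) (hstat : Stationary W ψ) (hgen : Generic W ψ) :
    ∃ φ : ℕ → ℝ, IntrinsicAngles W ψ φ := by
  obtain ⟨θ, hmono, htot, hr⟩ := (fivePointSystem hA1 hc hψ hstat hgen).exists_angles
  refine ⟨fun x => θ (x + 1) - θ x, ⟨fun x hx => ?_, ?_, fun D => ?_⟩⟩
  · rw [Finset.mem_Ico] at hx
    exact sub_pos.2 (hmono _ _ hx.1 (Nat.lt_succ_self x) hx.2)
  · rwa [angle_sub θ (by omega)]
  · have h1 := D.one_le_i₀
    have h2 := D.lt₀₁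
    have h3 := D.lt₁₂
    have h4 := D.lt₂₃
    have h5 := D.i₃_le
    rw [angle_sub θ h2.le, angle_sub θ h3.le, angle_sub θ h4.le, η_eq_eVal hA1,
      eVal_eq (eVal_lt_one (cVal_spec hA1 hc h1 h2 h3 h4 h5))]
    refine etaGeo_eq (sub_pos.2 (hmono _ _ h1 h2 (by omega)))
      (sub_pos.2 (hmono _ _ (by omega) h3 (by omega)))
      (sub_pos.2 (hmono _ _ (by omega) h4 h5)) ?_ ?_
    · have a : θ 1 ≤ θ D.i₀ := by
        rcases h1.eq_or_lt with e | h
        · rw [← e]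
        · exact (hmono _ _ le_rfl h (by omega)).le
      have b : θ D.i₃ ≤ θ (W.n + 1) := by
        rcases h5.eq_or_lt with e | h
        · rw [e]
        · exact (hmono _ _ (by omega) h le_rfl).le
      linarith
    · rw [← hr _ _ _ _ h1 h2 h3 h4 h5]
      congr 4
      ring

end IntrinsicAngles

/-! ### Sectors with attached outer cells are disks -/

section DiskLike

variable {n : ℕ}

theorem linked_of_row {s : Set (Cell n)} {r x y : ℕ} (hr : r < 5) (hxy : x ≤ y) (hy : y < n + 2)
    (h : ∀ z, x ≤ z → z ≤ y → cellAt n z r ∈ s) : Linked s (cellAt n x r) (cellAt n y r) := by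
  induction y, hxy using Nat.le_induction with
  | base => exact Linked.refl (h x le_rfl le_rfl)
  | succ y hxy ih =>
    refine (ih (by omega) fun z h1 h2 => h z h1 (by omega)).trans
      (Linked.of_adj (h y hxy (by omega)) (h _ (by omega) le_rfl) ?_)
    rw [adj_cellAt (by omega) hr hy hr, CoordAdj]
    omega

/-- A sector and a run of cells of layer `3` that borders it form a disk. -/
theorem diskLike_sectorBlocks {i j s t e e' : ℕ} (hj : j ≤ n + 1) (ht : t ≤ n + 1)
    (hs : s ≤ e) (he : e < t) (hi : i ≤ e') (hj' : e' < j) (hee : e' = e ∨ e' = e + 1) :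
    DiskLike (sectorBlocks n i j s t) := by
  constructor
  · have mem : ∀ {y q}, y < n + 2 → q < 5 →
        (cellAt n y q ∈ (sectorBlocks n i j s t : Set (Cell n)) ↔
          (i ≤ y ∧ y < j ∧ q ≤ 2) ∨ (s ≤ y ∧ y < t ∧ q = 3)) := fun hy hq => by
      rw [Finset.mem_coe, mem_sectorBlocks hy hq]
    have low : ∀ y q, i ≤ y → y < j → q ≤ 2 →
        Linked (sectorBlocks n i j s t : Set (Cell n)) (cellAt n y q) (cellAt n i 0) := by
      intro y q h1 h2 h3
      refine (linked_of_row (by omega) h1 (by omega) fun z h4 h5 =>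
        (mem (by omega) (by omega)).2 (by omega)).symm.trans ?_
      induction q with
      | zero => exact Linked.refl ((mem (by omega) (by omega)).2 (by omega))
      | succ q ih =>
        refine Linked.trans (Linked.of_adj ((mem (by omega) (by omega)).2 (by omega))
          ((mem (by omega) (by omega)).2 (by omega)) ?_) (ih (by omega))
        rw [adj_cellAt (by omega) (by omega) (by omega) (by omega), CoordAdj]
        omega
    have anchor : Linked (sectorBlocks n i j s t : Set (Cell n)) (cellAt n e 3)
        (cellAt n i 0) := by
      refine Linked.trans (Linked.of_adj (b := cellAt n e' 2)
        ((mem (by omega) (by omega)).2 (by omega)) ((mem (by omega) (by omega)).2 (by omega)) ?_)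
        (low e' 2 hi hj' le_rfl)
      rw [adj_cellAt (by omega) (by omega) (by omega) (by omega), CoordAdj]
      omega
    refine connected_iff_linked.2 ⟨cellAt n i 0, (mem (by omega) (by omega)).2 (by omega),
      fun a ha => ?_⟩
    rcases cell_cases a with rfl | ⟨y, q, hy, hq, rfl⟩
    · exact absurd ha none_notMem_sectorBlocks
    · rcases (mem hy hq).1 ha with h | ⟨h1, h2, rfl⟩
      · exact low y q h.1 h.2.1 h.2.2
      · refine Linked.trans ?_ anchor
        rcases le_total y e with h | h
        · exact linked_of_row hq h (by omega) fun z h4 h5 => (mem (by omega) (by omega)).2 (by omega)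
        · exact (linked_of_row hq h (by omega) fun z h4 h5 =>
            (mem (by omega) (by omega)).2 (by omega)).symm
  · refine connected_of_rows (by simp [none_notMem_sectorBlocks]) fun x r hx hr hm => ?_
    have mem : ∀ {y q}, y < n + 2 → q < 5 →
        (cellAt n y q ∈ (sectorBlocks n i j s t : Set (Cell n))ᶜ ↔
          ¬ ((i ≤ y ∧ y < j ∧ q ≤ 2) ∨ (s ≤ y ∧ y < t ∧ q = 3))) := fun hy hq => by
      rw [Set.mem_compl_iff, Finset.mem_coe, mem_sectorBlocks hy hq]
    rw [mem hx hr] at hm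
    by_cases h : (r ≤ 2 ∧ x < i) ∨ (r = 3 ∧ x < s) ∨ 4 ≤ r
    · exact Or.inl fun y hy => (mem (by omega) hr).2 (by omega)
    · exact Or.inr fun y hy hy' => (mem (by omega) hr).2 (by omega)

end DiskLike

/-! ### Cancellation of boundary terms in Δ -/

section BoundaryTerm

variable {n : ℕ} {i₀ i₁ i₂ i₃ s m t : ℕ}

theorem mem_iff_of_notMem_sector {z : Cell n} (h12 : i₁ ≤ i₂)
    (hz : z ∉ sector n i₁ i₂) :
    (z ∈ sectorBlocks n i₀ i₂ s m ↔ z ∈ sectorBlocks n i₀ i₁ s m) ∧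
      (z ∈ sectorBlocks n i₁ i₃ m t ↔ z ∈ sectorBlocks n i₂ i₃ m t) := by
  rw [← sectorBlocks_self n i₁ i₂ 0] at hz
  rcases cell_cases z with rfl | ⟨y, q, hy, hq, rfl⟩
  · simp [none_notMem_sectorBlocks]
  · simp only [mem_sectorBlocks hy hq] at hz ⊢
    omega

/-- All neighbors of B lie in the ruler: A' and C' together cover its top, A and C its sides. So
next to B the regions AA'B and CC' are complementary, as are CC'B and AA'. -/
theorem mem_iff_of_adj_sector {b z : Cell n} (h0 : 1 ≤ i₀) (hs : i₀ ≤ s) (hs₁ : s < i₁)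
    (hm : i₁ ≤ m) (hm₂ : m < i₂) (ht : i₂ ≤ t) (ht₃ : t < i₃) (hn : i₃ ≤ n + 1)
    (hb : b ∈ sector n i₁ i₂) (hz : z = b ∨ (cellGraph n).Adj z b) :
    (z ∈ sectorBlocks n i₀ i₂ s m ↔ z ∉ sectorBlocks n i₂ i₃ m t) ∧
      (z ∈ sectorBlocks n i₁ i₃ m t ↔ z ∉ sectorBlocks n i₀ i₁ s m) := by
  rw [← sectorBlocks_self n i₁ i₂ 0] at hb
  rcases cell_cases b with rfl | ⟨x, r, hx, hr, rfl⟩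
  · exact absurd hb none_notMem_sectorBlocks
  rw [mem_sectorBlocks hx hr] at hb
  rcases cell_cases z with rfl | ⟨y, q, hy, hq, rfl⟩
  · rcases hz with h | h
    · exact absurd h.symm (cellAt_ne_none hx hr)
    · have := (adj_none_cellAt hx hr).1 h.symm
      omega
  · rw [cellAt_inj hy hq hx hr, adj_cellAt hy hq hx hr, CoordAdj] at hz
    simp only [mem_sectorBlocks hy hq]
    omega

/-- A pairwise adjacent set of cells sees the four regions of `Δ` in two equal or complementary
pairs. -/
theorem mem_dichotomy {Z : Set (Cell n)} (hZ : ∀ a ∈ Z, ∀ b ∈ Z, a = b ∨ (cellGraph n).Adj a b)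
    (h0 : 1 ≤ i₀) (hs : i₀ ≤ s) (hs₁ : s < i₁)
    (hm : i₁ ≤ m) (hm₂ : m < i₂) (ht : i₂ ≤ t) (ht₃ : t < i₃) (hn : i₃ ≤ n + 1) :
    (∀ z ∈ Z, (z ∈ sectorBlocks n i₀ i₂ s m ↔ z ∈ sectorBlocks n i₀ i₁ s m) ∧
      (z ∈ sectorBlocks n i₁ i₃ m t ↔ z ∈ sectorBlocks n i₂ i₃ m t)) ∨
    ∀ z ∈ Z, (z ∈ sectorBlocks n i₀ i₂ s m ↔ z ∉ sectorBlocks n i₂ i₃ m t) ∧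
      (z ∈ sectorBlocks n i₁ i₃ m t ↔ z ∉ sectorBlocks n i₀ i₁ s m) := by
  by_cases h : ∃ b ∈ Z, b ∈ sector n i₁ i₂
  · obtain ⟨b, hbZ, hb⟩ := h
    exact Or.inr fun z hz => mem_iff_of_adj_sector h0 hs hs₁ hm hm₂ ht ht₃ hn hb (hZ z hz b hbZ)
  · refine Or.inl fun z hz => mem_iff_of_notMem_sector (by omega)
      fun hb => h ⟨z, hz, hb⟩

open Classical in
/-- The boundary segments, summed over ordered pairs of cells. -/
theorem two_mul_segments (α : Sym2 (Cell n) → ℝ) (X : Finset (Cell n)) :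
    2 * (∑ u ∈ X, ∑ v ∈ Xᶜ, if (cellGraph n).Adj u v then α s(u, v) else 0) =
      ∑ u, ∑ v, if (cellGraph n).Adj u v ∧ ¬ (u ∈ X ↔ v ∈ X) then α s(u, v) else 0 := by
  have h1 : (∑ u ∈ X, ∑ v ∈ Xᶜ, if (cellGraph n).Adj u v then α s(u, v) else 0) =
      ∑ u, ∑ v, if (cellGraph n).Adj u v ∧ u ∈ X ∧ v ∉ X then α s(u, v) else 0 := by
    refine (Finset.sum_congr rfl fun u hu => ?_).trans
      (Finset.sum_subset (Finset.subset_univ X) fun u _ hu => by simp [hu])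
    refine (Finset.sum_congr rfl fun v hv => ?_).trans
      (Finset.sum_subset (Finset.subset_univ Xᶜ) fun v _ hv => by
        rw [Finset.mem_compl, not_not] at hv
        simp [hv])
    simp [hu, Finset.mem_compl.1 hv]
  have h2 : (∑ u, ∑ v, if (cellGraph n).Adj u v ∧ u ∈ X ∧ v ∉ X then α s(u, v) else 0) =
      ∑ u, ∑ v, if (cellGraph n).Adj u v ∧ v ∈ X ∧ u ∉ X then α s(u, v) else 0 := by
    rw [Finset.sum_comm]
    simp only [SimpleGraph.adj_comm, Sym2.eq_swap]
  have h3 : ∀ x y z : ℝ, x = y → y = z → 2 * x = y + z := by intros; linarith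
  rw [h3 _ _ _ h1 h2, ← Finset.sum_add_distrib]
  refine Finset.sum_congr rfl fun u _ => ?_
  rw [← Finset.sum_add_distrib]
  refine Finset.sum_congr rfl fun v _ => ?_
  by_cases hA : (cellGraph n).Adj u v <;> by_cases hu : u ∈ X <;> by_cases hv : v ∈ X <;>
    simp [hA, hu, hv]

/-- The boundary terms cancel in `Δ`. -/
theorem boundaryTerm_add (α : Sym2 (Cell n) → ℝ) (κ : Cell n → Sym2 (Cell n) → ℝ)
    (h0 : 1 ≤ i₀) (hs : i₀ ≤ s) (hs₁ : s < i₁)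
    (hm : i₁ ≤ m) (hm₂ : m < i₂) (ht : i₂ ≤ t) (ht₃ : t < i₃) (hn : i₃ ≤ n + 1) :
    boundaryTerm α κ (sectorBlocks n i₀ i₂ s m) + boundaryTerm α κ (sectorBlocks n i₁ i₃ m t) =
      boundaryTerm α κ (sectorBlocks n i₀ i₁ s m) +
        boundaryTerm α κ (sectorBlocks n i₂ i₃ m t) := by
  classical
  -- Segments and meeting points are sets of pairwise adjacent cells, and their contributions do not
  -- distinguish a region from its complement. On each such set the four regions pair off, with
  -- signs that cancel.
  have dich := fun (Z : Set (Cell n)) hZ => mem_dichotomy (Z := Z) hZ h0 hs hs₁ hm hm₂ ht ht₃ hn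
  generalize sectorBlocks n i₀ i₂ s m = P at *
  generalize sectorBlocks n i₁ i₃ m t = Q at *
  generalize sectorBlocks n i₀ i₁ s m = R at *
  generalize sectorBlocks n i₂ i₃ m t = T at *
  have seg : ∀ u v : Cell n,
      ((if (cellGraph n).Adj u v ∧ ¬ (u ∈ P ↔ v ∈ P) then α s(u, v) else 0) +
        if (cellGraph n).Adj u v ∧ ¬ (u ∈ Q ↔ v ∈ Q) then α s(u, v) else 0) =
      (if (cellGraph n).Adj u v ∧ ¬ (u ∈ R ↔ v ∈ R) then α s(u, v) else 0) +
        if (cellGraph n).Adj u v ∧ ¬ (u ∈ T ↔ v ∈ T) then α s(u, v) else 0 := by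
    intro u v
    by_cases hA : (cellGraph n).Adj u v
    · rcases dich {u, v} (by
        rintro a (rfl | rfl) b (rfl | rfl)
        exacts [Or.inl rfl, Or.inr hA, Or.inr hA.symm, Or.inl rfl]) with h | h
      · simp only [(h u (Or.inl rfl)).1, (h u (Or.inl rfl)).2, (h v (Or.inr rfl)).1,
          (h v (Or.inr rfl)).2]
      · simp only [(h u (Or.inl rfl)).1, (h u (Or.inl rfl)).2, (h v (Or.inr rfl)).1,
          (h v (Or.inr rfl)).2, not_iff_not]
        exact add_comm _ _
    · simp [hA]
  have pt : ∀ (u : Cell n), ∀ e ∈ Finset.univ.filter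
      (fun e : Sym2 (Cell n) => e ∈ (cellGraph n).edgeSet),
      ((if (∀ v ∈ e, (cellGraph n).Adj u v) ∧
          ((u ∈ P ∧ ∀ v ∈ e, v ∉ P) ∨ (u ∉ P ∧ ∀ v ∈ e, v ∈ P)) then κ u e else 0) +
        if (∀ v ∈ e, (cellGraph n).Adj u v) ∧
          ((u ∈ Q ∧ ∀ v ∈ e, v ∉ Q) ∨ (u ∉ Q ∧ ∀ v ∈ e, v ∈ Q)) then κ u e else 0) =
      (if (∀ v ∈ e, (cellGraph n).Adj u v) ∧
          ((u ∈ R ∧ ∀ v ∈ e, v ∉ R) ∨ (u ∉ R ∧ ∀ v ∈ e, v ∈ R)) then κ u e else 0) +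
        if (∀ v ∈ e, (cellGraph n).Adj u v) ∧
          ((u ∈ T ∧ ∀ v ∈ e, v ∉ T) ∨ (u ∉ T ∧ ∀ v ∈ e, v ∈ T)) then κ u e else 0 := by
    intro u e he
    by_cases hA : ∀ v ∈ e, (cellGraph n).Adj u v
    · induction e using Sym2.ind with
      | _ a b =>
        have hab : (cellGraph n).Adj a b := by simpa using he
        simp only [Sym2.mem_iff, forall_eq_or_imp, forall_eq] at hA ⊢
        rcases dich {u, a, b} (by
          rintro x (rfl | rfl | rfl) y (rfl | rfl | rfl)
          exacts [Or.inl rfl, Or.inr hA.1, Or.inr hA.2, Or.inr hA.1.symm, Or.inl rfl, Or.inr hab,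
            Or.inr hA.2.symm, Or.inr hab.symm, Or.inl rfl]) with h | h
        · have hu := h u (by simp)
          have ha := h a (by simp)
          have hb := h b (by simp)
          simp only [hu.1, hu.2, ha.1, ha.2, hb.1, hb.2]
        · have hu := h u (by simp)
          have ha := h a (by simp)
          have hb := h b (by simp)
          simp only [hu.1, hu.2, ha.1, ha.2, hb.1, hb.2, not_not]
          rw [add_comm]
          congr 1 <;> refine if_congr (and_congr_right fun _ => or_comm) rfl rfl
    · simp [hA]
  have segs := two_mul_segments α P
  have segs' := two_mul_segments α Q
  have segs₂ := two_mul_segments α R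
  have segs₂' := two_mul_segments α T
  have hseg := Finset.sum_congr rfl fun u (_ : u ∈ (Finset.univ : Finset (Cell n))) =>
    Finset.sum_congr rfl fun v (_ : v ∈ (Finset.univ : Finset (Cell n))) => seg u v
  have hpt := Finset.sum_congr rfl fun u (_ : u ∈ (Finset.univ : Finset (Cell n))) =>
    Finset.sum_congr rfl (pt u)
  simp only [Finset.sum_add_distrib] at hseg hpt
  rw [← segs, ← segs', ← segs₂, ← segs₂'] at hseg
  simp only [boundaryTerm]
  have key : ∀ a b c d a' b' c' d' : ℝ, 2 * a + 2 * b = 2 * c + 2 * d → a' + b' = c' + d' →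
      a + a' + (b + b') = c + c' + (d + d') := by intros; linarith
  refine key _ _ _ _ _ _ _ _ ?_ ?_
  · convert hseg
  · convert hpt

end BoundaryTerm

/-! ### The functional equation of the corner function -/

section SecondDifference

open Filter Topology

/-- The combination of corner contributions that appears in `Δ`. -/
def cornerDiff (F : ℝ → ℝ) (p : ℝ × ℝ × ℝ) : ℝ :=
  F (p.1 + p.2.1) + F (p.2.1 + p.2.2) - F p.1 - F p.2.2

theorem continuousAt_cornerDiff {F : ℝ → ℝ} (hF : ContinuousOn F (Set.Ioo 0 (2 * Real.pi)))
    {a b c : ℝ} (ha : 0 < a) (hb : 0 < b) (hc : 0 < c) (hs : a + b + c < 2 * Real.pi) :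
    ContinuousAt (cornerDiff F) (a, b, c) := by
  have h : ∀ {x : ℝ}, 0 < x → x < 2 * Real.pi → ContinuousAt F x := fun h1 h2 =>
    hF.continuousAt (Ioo_mem_nhds h1 h2)
  have c1 : ContinuousAt (fun p : ℝ × ℝ × ℝ => F (p.1 + p.2.1)) (a, b, c) :=
    ContinuousAt.comp (g := F) (f := fun p : ℝ × ℝ × ℝ => p.1 + p.2.1)
      (h (by simp only; linarith) (by simp only; linarith)) (by fun_prop)
  have c2 : ContinuousAt (fun p : ℝ × ℝ × ℝ => F (p.2.1 + p.2.2)) (a, b, c) :=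
    ContinuousAt.comp (g := F) (f := fun p : ℝ × ℝ × ℝ => p.2.1 + p.2.2)
      (h (by simp only; linarith) (by simp only; linarith)) (by fun_prop)
  have c3 : ContinuousAt (fun p : ℝ × ℝ × ℝ => F p.1) (a, b, c) :=
    ContinuousAt.comp (g := F) (f := fun p : ℝ × ℝ × ℝ => p.1)
      (h (by simp only; linarith) (by simp only; linarith)) (by fun_prop)
  have c4 : ContinuousAt (fun p : ℝ × ℝ × ℝ => F p.2.2) (a, b, c) :=
    ContinuousAt.comp (g := F) (f := fun p : ℝ × ℝ × ℝ => p.2.2)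
      (h (by simp only; linarith) (by simp only; linarith)) (by fun_prop)
  exact ((c1.add c2).sub c3).sub c4

/-- The corner function of a conformal field theory, up to a constant factor. -/
def logSin (θ : ℝ) : ℝ := Real.log (Real.sin (θ / 2))

theorem sin_half_pos {θ : ℝ} (h0 : 0 < θ) (h1 : θ < 2 * Real.pi) : 0 < Real.sin (θ / 2) :=
  Real.sin_pos_of_pos_of_lt_pi (by linarith) (by linarith)

theorem continuousOn_logSin : ContinuousOn logSin (Set.Ioo 0 (2 * Real.pi)) :=
  ContinuousOn.log (by fun_prop) fun _ hx => (sin_half_pos hx.1 hx.2).ne'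

variable {a b c : ℝ}

theorem neg_log_etaGeo (ha : 0 < a) (hb : 0 < b) (hc : 0 < c) (hs : a + b + c < 2 * Real.pi) :
    -Real.log (etaGeo a b c) = cornerDiff logSin (a, b, c) := by
  have pa := sin_half_pos ha (by linarith)
  have pc := sin_half_pos hc (by linarith)
  have pab := sin_half_pos (show 0 < a + b by linarith) (by linarith)
  have pbc := sin_half_pos (show 0 < b + c by linarith) (by linarith)
  rw [etaGeo, Real.log_div (by positivity) (by positivity), Real.log_mul pa.ne' pc.ne',
    Real.log_mul pab.ne' pbc.ne']
  simp only [cornerDiff, logSin]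
  ring

/-- Ptolemy's identity exceeds the numerator of η_g by a positive product, so η_g < 1. Positivity
permits solving the functional equation for its constant. -/
theorem cornerDiff_logSin_pos (ha : 0 < a) (hb : 0 < b) (hc : 0 < c)
    (hs : a + b + c < 2 * Real.pi) : 0 < cornerDiff logSin (a, b, c) := by
  have pa := sin_half_pos ha (by linarith)
  have pb := sin_half_pos hb (by linarith)
  have pc := sin_half_pos hc (by linarith)
  have pab := sin_half_pos (show 0 < a + b by linarith) (by linarith)
  have pbc := sin_half_pos (show 0 < b + c by linarith) (by linarith)
  have ps := sin_half_pos (show 0 < a + b + c by linarith) hs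
  rw [← neg_log_etaGeo ha hb hc hs, neg_pos]
  refine Real.log_neg (by rw [etaGeo]; positivity) ?_
  rw [etaGeo, div_lt_one (by positivity), show (a + b) / 2 = a / 2 + b / 2 by ring,
    show (b + c) / 2 = b / 2 + c / 2 by ring, sin_cross_identity,
    show a / 2 + b / 2 + c / 2 = (a + b + c) / 2 by ring]
  have := mul_pos pb ps
  linarith

/-- If the functional equation holds at angles that become dense, with constants `C k`, then it
holds at all angles with one constant. -/
theorem exists_cornerDiff_eq {f : ℝ → ℝ} (hf : ContinuousOn f (Set.Ioo 0 (2 * Real.pi)))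
    {C : ℕ → ℝ}
    (h : ∀ a b c : ℝ, 0 < a → 0 < b → 0 < c → a + b + c < 2 * Real.pi →
      ∃ p : ℕ → ℝ × ℝ × ℝ, Tendsto p atTop (𝓝 (a, b, c)) ∧
        ∀ᶠ k in atTop, cornerDiff f (p k) = C k / 6 * cornerDiff logSin (p k)) :
    ∃ C₀ : ℝ, ∀ a b c : ℝ, 0 < a → 0 < b → 0 < c → a + b + c < 2 * Real.pi →
      cornerDiff f (a, b, c) = C₀ / 6 * cornerDiff logSin (a, b, c) := by
  -- The constants are quotients of two combinations that converge at every triple. One sequence has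
  -- one limit, so the limiting quotient is the same for all triples.
  have lim : ∀ a b c : ℝ, 0 < a → 0 < b → 0 < c → a + b + c < 2 * Real.pi →
      Tendsto C atTop (𝓝 (6 * cornerDiff f (a, b, c) / cornerDiff logSin (a, b, c))) := by
    intro a b c ha hb hc hs
    obtain ⟨p, hp, he⟩ := h a b c ha hb hc hs
    have l1 := (continuousAt_cornerDiff hf ha hb hc hs).tendsto.comp hp
    have l2 := (continuousAt_cornerDiff continuousOn_logSin ha hb hc hs).tendsto.comp hp
    have hpos := cornerDiff_logSin_pos ha hb hc hs
    refine ((l1.const_mul 6).div l2 hpos.ne').congr' ?_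
    filter_upwards [he, l2.eventually_ne hpos.ne'] with k hk hk'
    simp only [Function.comp_apply] at hk'
    simp only [Pi.div_apply, Function.comp_apply, hk]
    field_simp
  have hπ := Real.pi_pos
  have l₀ := lim (Real.pi / 2) (Real.pi / 2) (Real.pi / 2) (by linarith) (by linarith) (by linarith)
    (by linarith)
  refine ⟨6 * cornerDiff f (Real.pi / 2, Real.pi / 2, Real.pi / 2) /
    cornerDiff logSin (Real.pi / 2, Real.pi / 2, Real.pi / 2), fun a b c ha hb hc hs => ?_⟩
  rw [tendsto_nhds_unique l₀ (lim a b c ha hb hc hs)]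
  have := (cornerDiff_logSin_pos ha hb hc hs).ne'
  field_simp

/-- The functional equation determines the corner function up to a constant. -/
theorem eq_logSin_of_cornerDiff {f : ℝ → ℝ} {C : ℝ}
    (h : ∀ a b c : ℝ, 0 < a → 0 < b → 0 < c → a + b + c < 2 * Real.pi →
      cornerDiff f (a, b, c) = C / 6 * cornerDiff logSin (a, b, c))
    (hπ : f Real.pi = 0) {θ : ℝ} (hθ : θ ∈ Set.Ioo 0 (2 * Real.pi)) :
    f θ = C / 6 * Real.log (Real.sin (θ / 2)) := by
  -- With a = c = x and b = y - x the combination is twice the difference of the values at y and x,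
  -- so no differential equation is needed.
  have mono : ∀ x y : ℝ, 0 < x → x < y → x + y < 2 * Real.pi →
      f y - C / 6 * logSin y = f x - C / 6 * logSin x := by
    intro x y hx hxy hs
    have := h x (y - x) x hx (by linarith) hx (by linarith)
    simp only [cornerDiff] at this
    rw [show x + (y - x) = y by ring, show y - x + x = y by ring] at this
    linarith
  have hp := Real.pi_pos
  -- A reference angle small enough to be compared with both θ and π.
  obtain ⟨x, hx0, hx⟩ := exists_between (show (0 : ℝ) < min (min θ Real.pi)
    (2 * Real.pi - θ) by simp only [lt_min_iff]; exact ⟨⟨hθ.1, hp⟩, by linarith [hθ.2]⟩)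
  simp only [lt_min_iff] at hx
  have e1 := mono x θ hx0 hx.1.1 (by linarith)
  have e2 := mono x Real.pi hx0 hx.1.2 (by linarith)
  have e3 : logSin Real.pi = 0 := by simp [logSin]
  rw [hπ, e3] at e2
  rw [logSin] at e1
  linarith

end SecondDifference

/-! ### Corner contributions on rulers, and rulers of nearly prescribed shape -/

section Corner

variable {W : PolarLattice} {ψ : W.H} {φ : ℕ → ℝ} {f : ℝ → ℝ}

theorem angle_add (φ : ℕ → ℝ) {i j k : ℕ} (hij : i ≤ j) (hjk : j ≤ k) :
    angle φ i j + angle φ j k = angle φ i k :=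
  Finset.sum_Ico_consecutive φ hij hjk

/-- The boundary contributions cancel in `Δ`, which leaves the corner contributions. -/
theorem Δ_eq_cornerDiff (h : CornerContribution W ψ φ f) (D : Ruler W.n) :
    Δ W ψ D = cornerDiff f
      (angle φ D.i₀ D.i₁, angle φ D.i₁ D.i₂, angle φ D.i₂ D.i₃) := by
  obtain ⟨α, κ, γ, h⟩ := h
  have h0 := D.one_le_i₀
  have h1 := D.i₀_le_s
  have h2 := D.s_lt_i₁
  have h3 := D.i₁_le_m
  have h4 := D.m_lt_i₂
  have h5 := D.i₂_le_t
  have h6 := D.t_lt_i₃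
  have h7 := D.i₃_le
  have b := boundaryTerm_add α κ h0 h1 h2 h3 h4 h5 h6 h7
  have s1 := h D.i₀ D.i₂ D.s D.m h0 (by omega) (by omega) (by omega) (by omega)
    (diskLike_sectorBlocks (e := D.s) (e' := D.s) (by omega) (by omega) (by omega) (by omega)
      (by omega) (by omega) (by omega))
  have s2 := h D.i₁ D.i₃ D.m D.t (by omega) (by omega) (by omega) (by omega) (by omega)
    (diskLike_sectorBlocks (e := D.m) (e' := D.m) (by omega) (by omega) (by omega) (by omega)
      (by omega) (by omega) (by omega))
  have s3 := h D.i₀ D.i₁ D.s D.m h0 (by omega) (by omega) (by omega) (by omega)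
    (diskLike_sectorBlocks (e := D.s) (e' := D.s) (by omega) (by omega) (by omega) (by omega)
      (by omega) (by omega) (by omega))
  -- C' may stop at the line between B and C; its cell of index i₂ - 1 lies over that line and still
  -- borders slice i₂ of C.
  have s4 := h D.i₂ D.i₃ D.m D.t (by omega) (by omega) (by omega) (by omega) (by omega)
    (diskLike_sectorBlocks (e := D.i₂ - 1) (e' := D.i₂) (by omega) (by omega) (by omega) (by omega)
      (by omega) (by omega) (by omega))
  rw [Δ, D.A_union_A'_union_B, D.C_union_C'_union_B, D.A_union_A', D.C_union_C']
  simp only [cornerDiff]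
  rw [angle_add φ D.lt₀₁.le D.lt₁₂.le, angle_add φ D.lt₁₂.le D.lt₂₃.le]
  simp only [sectorBlocks] at b ⊢
  linarith

theorem IntrinsicAngles.angle_pos (h : IntrinsicAngles W ψ φ) {i j : ℕ} (hi : 1 ≤ i) (hij : i < j)
    (hj : j ≤ W.n + 1) : 0 < angle φ i j :=
  Finset.sum_pos (fun x hx => h.pos x (by
    rw [Finset.mem_Ico] at hx ⊢
    omega)) (Finset.nonempty_Ico.2 hij)

theorem IntrinsicAngles.angle_nonneg (h : IntrinsicAngles W ψ φ) {i j : ℕ} (hi : 1 ≤ i)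
    (hj : j ≤ W.n + 1) : 0 ≤ angle φ i j :=
  Finset.sum_nonneg fun x hx => (h.pos x (by
    rw [Finset.mem_Ico] at hx ⊢
    omega)).le

theorem IntrinsicAngles.ruler_angles (h : IntrinsicAngles W ψ φ) (D : Ruler W.n) :
    0 < angle φ D.i₀ D.i₁ ∧ 0 < angle φ D.i₁ D.i₂ ∧ 0 < angle φ D.i₂ D.i₃ ∧
      angle φ D.i₀ D.i₁ + angle φ D.i₁ D.i₂ + angle φ D.i₂ D.i₃ < 2 * Real.pi := by
  have h0 := D.one_le_i₀
  have h1 := D.lt₀₁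
  have h2 := D.lt₁₂
  have h3 := D.lt₂₃
  have h4 := D.i₃_le
  refine ⟨h.angle_pos h0 h1 (by omega), h.angle_pos (by omega) h2 (by omega),
    h.angle_pos (by omega) h3 h4, ?_⟩
  rw [angle_add φ h1.le h2.le, angle_add φ (h1.trans h2).le h3.le]
  have e1 := angle_add φ h0 (show D.i₀ ≤ W.n + 1 by omega)
  have e2 := angle_add φ (show D.i₀ ≤ D.i₃ by omega) h4
  have := h.angle_nonneg le_rfl (show D.i₀ ≤ W.n + 1 by omega)
  have := h.angle_nonneg (show 1 ≤ D.i₃ by omega) (le_refl (W.n + 1))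
  linarith [h.total]

/-- `Δ` in terms of `𝔠_tot` and the intrinsic angles. -/
theorem IntrinsicAngles.Δ_eq (h : IntrinsicAngles W ψ φ) {D : Ruler W.n} (hc : ctot W ψ D ≠ 0) :
    Δ W ψ D = -(ctot W ψ D / 6) * Real.log
      (etaGeo (angle φ D.i₀ D.i₁) (angle φ D.i₁ D.i₂) (angle φ D.i₂ D.i₃)) := by
  rw [← h.cross_ratio D, η, Real.log_exp]
  field_simp

/-- Fine partial sums come close to every angle. -/
theorem exists_angle_mem {n : ℕ} {δ τ : ℝ}
    (hδ : ∀ x ∈ Finset.Ico 1 (n + 1), φ x < δ) (hδ₀ : 0 < δ) (hτ : 0 ≤ τ)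
    (hτ' : τ ≤ angle φ 1 (n + 1)) :
    ∃ k, 1 ≤ k ∧ k ≤ n + 1 ∧ τ ≤ angle φ 1 k ∧ angle φ 1 k < τ + δ := by
  classical
  -- The first partial sum that reaches τ overshoots by less than one angle.
  have hex : ∃ k, 1 ≤ k ∧ τ ≤ angle φ 1 k := ⟨n + 1, by omega, hτ'⟩
  obtain ⟨h1, h2⟩ := Nat.find_spec hex
  have h3 : Nat.find hex ≤ n + 1 := Nat.find_min' hex ⟨by omega, hτ'⟩
  have hmin := fun m => Nat.find_min hex (m := m)
  generalize Nat.find hex = k at *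
  refine ⟨k, h1, h3, h2, ?_⟩
  rcases h1.eq_or_lt with rfl | h1
  · simp only [angle, Finset.Ico_self, Finset.sum_empty]
    linarith
  · have h4 := hmin (k - 1) (by omega)
    rw [not_and, not_le] at h4
    have h5 := h4 (by omega)
    have h6 := angle_add φ (show 1 ≤ k - 1 by omega) (show k - 1 ≤ k by omega)
    have h7 : angle φ (k - 1) k = φ (k - 1) := by
      obtain ⟨l, rfl⟩ : ∃ l, k = l + 1 := ⟨k - 1, by omega⟩
      simp [angle]
    have := hδ (k - 1) (by rw [Finset.mem_Ico]; omega)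
    linarith

/-- Fine intrinsic angles provide rulers of nearly any given shape. -/
theorem IntrinsicAngles.exists_ruler (h : IntrinsicAngles W ψ φ) {δ a b c : ℝ}
    (hδ : ∀ x ∈ Finset.Ico 1 (W.n + 1), φ x < δ)
    (hδ' : 2 * Real.pi - angle φ 1 (W.n + 1) < δ) (ha : 0 < a) (hb : δ < b) (hc : δ < c)
    (hs : a + b + c < 2 * Real.pi - δ) :
    ∃ D : Ruler W.n, |angle φ D.i₀ D.i₁ - a| < δ ∧ |angle φ D.i₁ D.i₂ - b| < δ ∧
      |angle φ D.i₂ D.i₃ - c| < δ := by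
  have hδ₀ : 0 < δ := by linarith [h.total]
  -- The division points approximate a, a + b and a + b + c from above within δ, so each sector is
  -- off by a difference of two overshoots; b, c > δ keeps the points distinct.
  obtain ⟨k₁, h1, h1', l1, u1⟩ := exists_angle_mem hδ hδ₀ ha.le (by linarith)
  obtain ⟨k₂, h2, h2', l2, u2⟩ := exists_angle_mem (τ := a + b) hδ hδ₀ (by linarith) (by linarith)
  obtain ⟨k₃, h3, h3', l3, u3⟩ := exists_angle_mem (τ := a + b + c) hδ hδ₀ (by linarith)
    (by linarith)
  have lt_of : ∀ {k l}, 1 ≤ l → k ≤ W.n + 1 → angle φ 1 k < angle φ 1 l → k < l := by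
    intro k l hl hk hkl
    by_contra hcon
    have := angle_add φ hl (not_lt.1 hcon)
    have := h.angle_nonneg (i := l) (j := k) hl hk
    linarith
  have k01 : 1 < k₁ := by
    rcases h1.eq_or_lt with rfl | h
    · simp only [angle, Finset.Ico_self, Finset.sum_empty] at l1
      linarith
    · exact h
  have k12 : k₁ < k₂ := lt_of h2 h1' (by linarith)
  have k23 : k₂ < k₃ := lt_of h3 h2' (by linarith)
  refine ⟨stdRuler le_rfl k01 k12 k23 h3', ?_⟩
  change |angle φ 1 k₁ - a| < δ ∧ |angle φ k₁ k₂ - b| < δ ∧ |angle φ k₂ k₃ - c| < δ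
  have e1 := angle_add φ k01.le k12.le
  have e2 := angle_add φ (k01.trans k12).le k23.le
  simp only [abs_lt]
  exact ⟨⟨by linarith, by linarith⟩, ⟨by linarith, by linarith⟩, by linarith, by linarith⟩

end Corner

/-! ### Passage to the family of states -/

section Family

open Filter Topology

theorem tendsto_of_abs_sub_lt {u : ℕ → ℝ} {a : ℝ}
    (h : ∀ᶠ k : ℕ in atTop, |u k - a| < 1 / ((k : ℝ) + 1)) : Tendsto u atTop (𝓝 a) := by
  rw [tendsto_iff_dist_tendsto_zero]
  refine squeeze_zero' (Eventually.of_forall fun _ => dist_nonneg) ?_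
    tendsto_one_div_add_atTop_nhds_zero_nat
  filter_upwards [h] with k hk
  exact hk.le

/-- `𝔠_tot` does not depend on the ruler. -/
theorem exists_ctot_eq {W : PolarLattice} {ψ : W.H} (hA1 : AxiomA1 W ψ)
    (hc : ∀ D : Ruler W.n, ctot W ψ D ≠ 0)
    (hψ : ‖ψ‖ = 1) (hstat : Stationary W ψ) (hgen : Generic W ψ) :
    ∃ c : ℝ, 0 < c ∧ ∀ D : Ruler W.n, ctot W ψ D = c := by
  have key : ∀ D : Ruler W.n, ctot W ψ D = cVal W ψ 1 2 3 4 := fun D => by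
    rw [ctot_eq_cVal hA1]
    exact (fivePointSystem hA1 hc hψ hstat hgen).c_eq D.one_le_i₀ D.lt₀₁ D.lt₁₂ D.lt₂₃ D.i₃_le
  -- With too few slices there is no ruler, and any positive constant serves.
  rcases isEmpty_or_nonempty (Ruler W.n) with he | ⟨⟨D₀⟩⟩
  · exact ⟨1, one_pos, fun D => (he.false D).elim⟩
  · exact ⟨cVal W ψ 1 2 3 4, by rw [← key D₀]; exact (ctot_spec (hc D₀)).1, key⟩

/-- The corner contribution of a family of states with arbitrarily fine intrinsic angles. -/
theorem exists_corner_formula {J : Type*} {W : J → PolarLattice} {Ψ : ∀ j, (W j).H} {C : J → ℝ}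
    (hC : ∀ j, 0 < C j) (hctot : ∀ j (D : Ruler (W j).n), ctot (W j) (Ψ j) D = C j)
    {φ : J → ℕ → ℝ} {f : ℝ → ℝ} (hφ : ∀ j, IntrinsicAngles (W j) (Ψ j) (φ j))
    (hfine : ∀ δ > 0, ∃ j, (∀ x ∈ Finset.Ico 1 ((W j).n + 1), φ j x < δ) ∧
      2 * Real.pi - angle (φ j) 1 ((W j).n + 1) < δ)
    (hcorner : ∀ j, CornerContribution (W j) (Ψ j) (φ j) f)
    (hf : ContinuousOn f (Set.Ioo 0 (2 * Real.pi))) (hπ : f Real.pi = 0) :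
    ∃ c : ℝ, 0 < c ∧ (∀ j, Nonempty (Ruler (W j).n) → C j = c) ∧
      ∀ θ ∈ Set.Ioo 0 (2 * Real.pi), f θ = c / 6 * Real.log (Real.sin (θ / 2)) := by
  have eqD : ∀ j (D : Ruler (W j).n),
      cornerDiff f (angle (φ j) D.i₀ D.i₁, angle (φ j) D.i₁ D.i₂, angle (φ j) D.i₂ D.i₃) =
        C j / 6 * cornerDiff logSin
          (angle (φ j) D.i₀ D.i₁, angle (φ j) D.i₁ D.i₂, angle (φ j) D.i₂ D.i₃) := by
    intro j D
    obtain ⟨ha, hb, hc, hs⟩ := (hφ j).ruler_angles D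
    rw [← Δ_eq_cornerDiff (hcorner j), (hφ j).Δ_eq (by rw [hctot]; exact (hC j).ne'), hctot,
      ← neg_log_etaGeo ha hb hc hs]
    ring
  -- A sequence of states whose angles are finer than 1 / (k + 1); the constants may depend on the
  -- state until the limit shows otherwise.
  choose q hq hq' using fun k : ℕ => hfine (1 / ((k : ℝ) + 1)) Nat.one_div_pos_of_nat
  obtain ⟨c, hc⟩ := exists_cornerDiff_eq (C := fun k => C (q k)) hf (by
    intro a b c ha hb hc hs
    have hk : ∀ k : ℕ, ∃ p : ℝ × ℝ × ℝ, 1 / ((k : ℝ) + 1) < min (min b c) (2 * Real.pi - (a + b + c)) →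
        |p.1 - a| < 1 / ((k : ℝ) + 1) ∧ |p.2.1 - b| < 1 / ((k : ℝ) + 1) ∧
          |p.2.2 - c| < 1 / ((k : ℝ) + 1) ∧
          cornerDiff f p = C (q k) / 6 * cornerDiff logSin p := by
      intro k
      by_cases hlt : 1 / ((k : ℝ) + 1) < min (min b c) (2 * Real.pi - (a + b + c))
      · rw [lt_min_iff, lt_min_iff] at hlt
        obtain ⟨D, h1, h2, h3⟩ := (hφ (q k)).exists_ruler (hq k) (hq' k) ha hlt.1.1 hlt.1.2
          (by linarith [hlt.2])
        exact ⟨(angle (φ (q k)) D.i₀ D.i₁, angle (φ (q k)) D.i₁ D.i₂, angle (φ (q k)) D.i₂ D.i₃),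
          fun _ => ⟨h1, h2, h3, eqD _ D⟩⟩
      · exact ⟨0, fun h => absurd h hlt⟩
    choose p hp using hk
    have hev : ∀ᶠ k : ℕ in atTop,
        1 / ((k : ℝ) + 1) < min (min b c) (2 * Real.pi - (a + b + c)) :=
      tendsto_one_div_add_atTop_nhds_zero_nat.eventually_lt_const
        (by simp only [lt_min_iff]; exact ⟨⟨hb, hc⟩, by linarith⟩)
    refine ⟨p, ?_, hev.mono fun k hk => (hp k hk).2.2.2⟩
    exact (tendsto_of_abs_sub_lt (hev.mono fun k hk => (hp k hk).1)).prodMk_nhds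
      ((tendsto_of_abs_sub_lt (hev.mono fun k hk => (hp k hk).2.1)).prodMk_nhds
        (tendsto_of_abs_sub_lt (hev.mono fun k hk => (hp k hk).2.2.1))))
  have hCc : ∀ j, Nonempty (Ruler (W j).n) → C j = c := by
    rintro j ⟨D⟩
    obtain ⟨h1, h2, h3, hs⟩ := (hφ j).ruler_angles D
    have e := (eqD j D).symm.trans (hc _ _ _ h1 h2 h3 hs)
    have := mul_right_cancel₀ (cornerDiff_logSin_pos h1 h2 h3 hs).ne' e
    linarith
  refine ⟨c, ?_, hCc, fun θ hθ => eq_logSin_of_cornerDiff hc hπ hθ⟩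
  -- Positivity of the limit constant needs one actual ruler: three sectors close to π / 2 fit at
  -- fineness 1 because π > 3.
  obtain ⟨j, h1, h2⟩ := hfine 1 one_pos
  have := Real.pi_gt_three
  obtain ⟨D, _⟩ := (hφ j).exists_ruler (a := Real.pi / 2) (b := Real.pi / 2) (c := Real.pi / 2) h1 h2
    (by linarith) (by linarith) (by linarith) (by linarith)
  rw [← hCc j ⟨D⟩]
  exact hC j

end Family

end CornerEntanglement

end
theorem mainTheorem4 {J : Type*} (W : J → CornerEntanglement.PolarLattice)
    (Ψ : ∀ j, (W j).H) (hΨ : ∀ j, ‖Ψ j‖ = 1)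
    (hA0 : ∀ j, CornerEntanglement.AxiomA0 (W j) (Ψ j))
    (hA1 : ∀ j, CornerEntanglement.AxiomA1 (W j) (Ψ j))
    (hc : ∀ j (D : CornerEntanglement.Ruler (W j).n),
      CornerEntanglement.ctot (W j) (Ψ j) D ≠ 0)
    (hstat : ∀ j, CornerEntanglement.Stationary (W j) (Ψ j))
    (hgen : ∀ j, CornerEntanglement.Generic (W j) (Ψ j)) :
    (∀ j, ∃ c : ℝ, 0 < c ∧ ∀ D : CornerEntanglement.Ruler (W j).n,
      CornerEntanglement.ctot (W j) (Ψ j) D = c) ∧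
    (∀ j, ∃ φ : ℕ → ℝ, CornerEntanglement.IntrinsicAngles (W j) (Ψ j) φ) ∧
    ∀ (φ : J → ℕ → ℝ) (f : ℝ → ℝ),
      (∀ j, CornerEntanglement.IntrinsicAngles (W j) (Ψ j) (φ j)) →
      (∀ δ > 0, ∃ j, (∀ x ∈ Finset.Ico 1 ((W j).n + 1), φ j x < δ) ∧
        2 * Real.pi - CornerEntanglement.angle (φ j) 1 ((W j).n + 1) < δ) →
      (∀ j, CornerEntanglement.CornerContribution (W j) (Ψ j) (φ j) f) →
      ContinuousOn f (Set.Ioo 0 (2 * Real.pi)) →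
      f Real.pi = 0 →
      ∃ c : ℝ, 0 < c ∧
        (∀ j (D : CornerEntanglement.Ruler (W j).n),
          CornerEntanglement.ctot (W j) (Ψ j) D = c ∧
          CornerEntanglement.Δ (W j) (Ψ j) D = -(c / 6) * Real.log
            (CornerEntanglement.etaGeo (CornerEntanglement.angle (φ j) D.i₀ D.i₁)
              (CornerEntanglement.angle (φ j) D.i₁ D.i₂)
              (CornerEntanglement.angle (φ j) D.i₂ D.i₃))) ∧
        ∀ θ ∈ Set.Ioo 0 (2 * Real.pi), f θ = c / 6 * Real.log (Real.sin (θ / 2)) := by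
  choose C hC hctot using fun j =>
    CornerEntanglement.exists_ctot_eq (hA1 j) (hc j) (hΨ j) (hstat j) (hgen j)
  refine ⟨fun j => ⟨C j, hC j, hctot j⟩, fun j =>
    CornerEntanglement.exists_intrinsicAngles (hA1 j) (hc j) (hΨ j) (hstat j) (hgen j),
    fun φ f hφ hfine hcorner hf hπ => ?_⟩
  obtain ⟨c, hpos, hCc, hfc⟩ :=
    CornerEntanglement.exists_corner_formula hC hctot hφ hfine hcorner hf hπ
  refine ⟨c, hpos, fun j D => ?_, hfc⟩
  have h : CornerEntanglement.ctot (W j) (Ψ j) D = c := by rw [hctot, hCc j ⟨D⟩]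
  exact ⟨h, by rw [(hφ j).Δ_eq (hc j D), h]⟩
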